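/- **Setting.** Let $\phi_i$, $i\in\frac12+\mathbb Z$, be free bosons, $\phi_i\phi_j-\phi_j\phi_i=(-1)^{j-\frac12}\delta_{i,-j}$, acting on the Fock space with vacuum $|0\rangle$, $\phi_j|0\rangle=0$ for $j<0$, $\langle0|\phi_j=0$ for $j>0$, $\langle 0|0\rangle=1$; let $\hat F$ be its completion with respect to the grading $\deg\phi_j=j$ (realized as $\mathbb C[[z_0,z_1,\dots]]$ with $\phi_{m+\frac12}=z_m$, $\phi_{-m-\frac12}=(-1)^m\partial/\partial z_m$, $m\ge0$, $|0\rangle=1$). Put $\phi(z)=\sum_j\phi_jz^{j-\frac12}$, $J_n=\frac12\sum_j(-1)^{j+\frac12}\phi_j\phi_{-j-n}$ for $n$ odd, $V_\pm(z)=\exp\sum_{\pm k>0,\,k\text{ odd}}\frac2kJ_kz^{-k}$, and define $J_i$, $i\in\frac12+\mathbb Z$, by $V_-(z)^{-1}\phi(z)V_+(z)^{-1}=2\sum_{i}J_iz^{-i-\frac12}$. Let $t=(t_1,t_3,\dots)$, $H(t)=\sum_{k>0\text{ odd}}t_kJ_k$, $\varphi(t,z)=\sum_{k>0\text{ odd}}t_kz^k$,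 $\partial=\partial/\partial t_1$. Let ${\rm ODP}$ be the set of strict partitions $\alpha=(\alpha_1>\dots>\alpha_n>0)$ with odd parts (including the empty partition $0$), ${\rm ODP}_{\rm odd}$ those with $n$ odd. Put $\langle\alpha|=\langle0|J_{\alpha_n/2}\cdots J_{\alpha_1/2}$ and $\xi_\alpha=t_{\alpha_1/2}\cdots t_{\alpha_n/2}$ with Grassmann times $t_{1/2},t_{3/2},\dots$, and $$\sigma(f)=\sum_{\alpha}\langle\alpha|e^{H(t)}f\rangle\,\xi_\alpha\qquad(f\in\hat F).$$ Let $v=g|0\rangle\in\hat F$ be an even vector, i.e. a possibly infinite linear combination of products of an even number of $\phi_j$'s applied to $|0\rangle$. Write $\sigma(v)=\sum_\alpha\tau_\alpha(t)\xi_\alpha$ (the super tau function) and $\sigma(\phi(z)v)=\sum_\alpha g_\alpha(t,z)\xi_\alpha$. The CKP Hirota equation for $v$ is ${\rm Res}_z\,\phi(z)v\otimes\phi(-z)v=0$. **Theorem.** 1. $\sigma$ is a linear bijection of $\hat F$ onto the formal power series in all even and Grassmann times, $\sigma(|0\rangle)=1$, and $\sigma J_j\sigma^{-1}=\partial/\partial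 t_j$, $\sigma J_{-j}\sigma^{-1}=(-1)^{[\frac12-j]}\frac j2t_j$ for all $j>0$, $j$ an odd integer or $j\in\frac12+\mathbb Z$. For even $v$ only partitions with an even number of parts occur in $\sigma(v)$, and only those with an odd number of parts occur in $\sigma(\phi(z)v)$. 2. The Hirota equation for $v$ holds if and only if $${\rm Res}_z\,g_\alpha(t,z)\,g_\beta(s,-z)=0\qquad\text{for all }\alpha,\beta\in{\rm ODP}_{\rm odd}.$$ 3. For $\alpha=(\alpha_1>\dots>\alpha_k)\in{\rm ODP}_{\rm odd}$, $$g_\alpha(t,z)=e^{\varphi(t,z)}\exp\Big(\sum_{j>0\text{ odd}}\frac2j\frac{\partial}{\partial t_j}z^{-j}\Big)\Big(\sum_{i=1}^k(-1)^{i-1}\frac{\alpha_i}2\,\tau_{\alpha\setminus\alpha_i}(t)(-z)^{\frac{\alpha_i-1}2}+2\sum_{\nu>0\text{ odd},\,\nu\notin\alpha}s(\nu,\alpha)\,\tau_{\alpha\cup\nu}(t)z^{-\frac{\nu+1}2}\Big),$$ where $s(\nu,\alpha)=(-1)^{|\{i:\alpha_i>\nu\}|}$. 4. For $\alpha\in{\rm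 ODP}_{\rm odd}$ with $\tau_{\alpha\setminus\alpha_1}\ne0$, let, with coefficients in the fraction field of $\mathbb C[[t]]$, $$w_\alpha(t,z)=\frac{g_\alpha(t,z)}{(-1)^{\frac{\alpha_1-1}2}\frac{\alpha_1}2\tau_{\alpha\setminus\alpha_1}(t)},\qquad \hat w_\alpha(t,z)=(-z)^{-\frac{\alpha_1-1}2}\frac{g_\alpha(t,z)e^{-\varphi(t,z)}}{\frac{\alpha_1}2\tau_{\alpha\setminus\alpha_1}(t)}.$$ Then $w_\alpha=\hat w_\alpha z^{\frac{\alpha_1-1}2}e^{\varphi(t,z)}$ and $\hat w_\alpha=1+O(z^{-1})$. If also $\tau_{\beta\setminus\beta_1}\neq0$, $\beta\in{\rm ODP}_{\rm odd}$, then ${\rm Res}_zg_\alpha(t,z)g_\beta(s,-z)=0$ if and only if ${\rm Res}_zw_\alpha(t,z)w_\beta(s,-z)=0$. If $v$ satisfies the Hirota equation, both hold, and the pseudodifferential operators $\hat w_\alpha(t,\partial)$ (obtained from $\hat w_\alpha(t,z)=\sum_m a_mz^m$ as $\sum_ma_m\partial^m$) satisfy $$\Big(\hat w_\alpha(t,\partial)\,\partial^{\frac{\alpha_1+\beta_1-2}2}\,\hat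 w_\beta(t,\partial)^*\Big)_-=0,$$ where $(a\partial^m)^*=(-\partial)^ma$ and $(\cdot)_-$, $(\cdot)_+$ denote the parts with negative, respectively non-negative, powers of $\partial$. 5. Suppose that $v$ satisfies the Hirota equation and $\tau_0\ne0$, and put $w=w_{(1)}$, $\hat w=\hat w_{(1)}$. Then $\hat w(t,\partial)$ is invertible and $$\hat w(t,\partial)^*=\hat w(t,\partial)^{-1},$$ and for every odd $k>0$ $$\frac{\partial\hat w(t,\partial)}{\partial t_k}=-\big(\hat w\,\partial^k\hat w^{-1}\big)_-\hat w,\qquad \frac{\partial w(t,z)}{\partial t_k}=\big(\hat w\,\partial^k\hat w^{-1}\big)_+w(t,z).$$ The Lax operator $L=\hat w\,\partial\,\hat w^{-1}$ has the form $\partial+\sum_{k\ge1}u_k(t)\partial^{-k}$, satisfies $L^*=-L$, and for every odd $k>0$ $$\frac{\partial L}{\partial t_k}=\big[(L^k)_+,L\big].$$ -/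

import Mathlib

open Finset

noncomputable section

namespace CKP

/-! ### The completed bosonic Fock space

Half-integers are indexed by integers: `m : ℤ` stands for `m + 1/2`.
Strict partitions with odd parts (`ODP`) are indexed by `Finset ℕ`: the element `n` stands for
the part `2 n + 1`; the empty set is the partition `0`, and the largest part comes first. -/

/-- The completion (product of all graded pieces, `deg z_m = m + 1/2`) of the bosonic Fock space
`F = ℂ[z_0, z_1, …]`, the monomial `∏ z_m ^ a_m` being `∏ φ_{m+1/2} ^ a_m |0⟩`. -/
abbrev Fock : Type := MvPowerSeries ℕ ℂ

/-- Formal power series in the even times; the variable `X k` is `t_{2k+1}`. -/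
abbrev Times : Type := MvPowerSeries ℕ ℂ

/-- The free boson `φ_{m+1/2}`: multiplication by `z_m` for `m ≥ 0`, and
`φ_{-k-1/2} = (-1)^k ∂/∂z_k` for `m = -k-1 < 0`. -/
def phi : ℤ → Module.End ℂ Fock
  | Int.ofNat k => LinearMap.mulLeft ℂ (MvPowerSeries.X k : Fock)
  | Int.negSucc k =>
      ((-1 : ℂ) ^ k) • (MvPowerSeries.pderiv ℂ k : Derivation ℂ Fock Fock).toLinearMap

/-- The vacuum vector `|0⟩`. -/
def vac : Fock := 1

/-- The functional `⟨0|`, normalised by `⟨0|0⟩ = 1`. -/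
def vev : Fock →ₗ[ℂ] ℂ := MvPowerSeries.coeff (0 : ℕ →₀ ℕ)

theorem phi_comm_single (i j : ℤ) (f : Fock) :
    phi i (phi j f) - phi j (phi i f) = if i + j = -1 then (-1 : ℂ) ^ j • f else 0 := by
  have hX : ∀ k l : ℕ, MvPowerSeries.pderiv ℂ k ((MvPowerSeries.X l : Fock) * f) =
      (MvPowerSeries.X l : Fock) * MvPowerSeries.pderiv ℂ k f + (if l = k then f else 0) := by
    intro k l
    rw [Derivation.leibniz]
    by_cases h : l = k
    · subst h; simp [MvPowerSeries.pderiv_X_self]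
    · simp [MvPowerSeries.pderiv_X_of_ne h, h]
  rcases i with k | k <;> rcases j with l | l
  · have h : ¬ (Int.ofNat k + Int.ofNat l = -1) := by simp; omega
    rw [if_neg h]
    simp only [phi, LinearMap.mulLeft_apply]
    ring
  · have e : (Int.ofNat k + Int.negSucc l = -1) ↔ k = l := by
      rw [Int.negSucc_eq]; simp; omega
    simp only [phi, LinearMap.mulLeft_apply, LinearMap.smul_apply,
      Derivation.coeFn_coe, hX, e]
    by_cases h : k = l
    · subst h
      simp only [if_true, zpow_negSucc, pow_succ]
      have : ((-1 : ℂ) ^ k * -1)⁻¹ = -(-1) ^ k := by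
        rcases neg_one_pow_eq_or ℂ k with h | h <;> rw [h] <;> norm_num
      rw [this, smul_add, mul_smul_comm, neg_smul]
      abel
    · simp [h]
  · have e : (Int.negSucc k + Int.ofNat l = -1) ↔ l = k := by
      rw [Int.negSucc_eq]; simp; omega
    simp only [phi, LinearMap.mulLeft_apply, LinearMap.smul_apply,
      Derivation.coeFn_coe, hX, e]
    by_cases h : l = k
    · subst h
      simp [smul_add]
    · simp [h]
  · have h : ¬ (Int.negSucc k + Int.negSucc l = -1) := by
      rw [Int.negSucc_eq, Int.negSucc_eq]; omega
    rw [if_neg h]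
    simp only [phi, LinearMap.smul_apply,
      Derivation.coeFn_coe, map_smul, sub_eq_zero]
    rw [smul_comm]
    congr 2
    ext a
    simp only [MvPowerSeries.coeff_pderiv, Finsupp.add_apply]
    rw [add_right_comm a]
    by_cases hkl : k = l
    · subst hkl; rfl
    · simp [hkl, Ne.symm hkl]
      ring

theorem phi_vac (k : ℕ) : phi (Int.negSucc k) vac = 0 := by
  simp [phi, vac]

theorem vev_phi (k : ℕ) (f : Fock) : vev (phi (Int.ofNat k) f) = 0 := by
  simp [phi, vev]

/-- Each coefficient of `∑_j ± φ_j φ_{-j-n} f` is a finite sum for odd `n`. -/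
theorem finite_support_current (n : ℤ) (hn : Odd n) (f : Fock) (a : ℕ →₀ ℕ) :
    (Function.support fun j : ℤ => (-1 : ℂ) ^ (j + 1) *
      MvPowerSeries.coeff a (phi j (phi (-j - n - 1) f))).Finite := by
  have key : ∀ (k : ℕ) (h : Fock), MvPowerSeries.coeff a (phi (Int.ofNat k) h) ≠ 0 →
      k ∈ a.support := by
    intro k h hne
    by_contra hk
    apply hne
    simp only [phi, LinearMap.mulLeft_apply]
    rw [MvPowerSeries.X, MvPowerSeries.coeff_monomial_mul, if_neg]
    intro hle
    have := hle k
    simp at this hk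
    omega
  have hfin : ((a.support.image (fun k : ℕ => (k : ℤ)) ∪
      a.support.image (fun k : ℕ => -(k : ℤ) - n - 1) ∪ Finset.Icc (-n) 0 : Finset ℤ) :
      Set ℤ).Finite := Finset.finite_toSet _
  refine hfin.subset ?_
  intro j hj
  have hj : MvPowerSeries.coeff a (phi j (phi (-j - n - 1) f)) ≠ 0 :=
    right_ne_zero_of_mul (Function.mem_support.mp hj)
  have hc := phi_comm_single j (-j - n - 1) f
  rw [if_neg (by intro h; rcases hn with ⟨r, hr⟩; omega), sub_eq_zero] at hc
  simp only [Finset.coe_union, Set.mem_union, Finset.mem_coe, Finset.mem_image, Finset.mem_Icc]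
  by_cases h1 : 0 ≤ j
  · obtain ⟨k, rfl⟩ := Int.eq_ofNat_of_zero_le h1
    exact Or.inl (Or.inl ⟨k, key k _ hj, rfl⟩)
  · by_cases h2 : 0 ≤ -j - n - 1
    · obtain ⟨k, hk⟩ := Int.eq_ofNat_of_zero_le h2
      rw [hc, hk] at hj
      exact Or.inl (Or.inr ⟨k, key k _ hj, by omega⟩)
    · exact Or.inr ⟨by omega, by omega⟩

/-- The bosonic current
`J_n = (1/2) ∑_{j ∈ 1/2 + ℤ} (-1)^{j + 1/2} φ_j φ_{-j-n}` for odd `n`, and `J_n = 0` for even `n`.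
-/
def J (n : ℤ) : Module.End ℂ Fock :=
  if hn : Odd n then
    { toFun := fun f a => (1 / 2 : ℂ) * ∑ᶠ j : ℤ, (-1 : ℂ) ^ (j + 1) *
        MvPowerSeries.coeff a (phi j (phi (-j - n - 1) f))
      map_add' := fun f g => by
        funext a
        have h := finsum_add_distrib (finite_support_current n hn f a)
          (finite_support_current n hn g a)
        simp only [map_add, mul_add] at h ⊢
        rw [h, mul_add]
        rfl
      map_smul' := fun c f => by
        funext a
        have h := smul_finsum' c (finite_support_current n hn f a)
        simp only [map_smul, smul_eq_mul] at h ⊢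
        change _ = c * _
        rw [mul_left_comm, h]
        congr 1
        exact finsum_congr fun j => by ring }
  else 0

/-- The exponential `∑ Aⁿ / n!` of a formal power series `A` without constant term, with
coefficients in a possibly noncommutative algebra. -/
def fexp {σ R : Type} [Ring R] [Algebra ℂ R] (A : MvPowerSeries σ R) : MvPowerSeries σ R :=
  fun a => ∑ n ∈ range (a.degree + 1), ((n.factorial : ℂ)⁻¹) • MvPowerSeries.coeff a (A ^ n)

/-- `V_+(z)⁻¹ = exp (-∑_{k > 0 odd} (2/k) J_k z^{-k})`, a power series in `z⁻¹`. -/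
def VplusInv : PowerSeries (Module.End ℂ Fock) :=
  fexp (PowerSeries.mk fun k : ℕ => if Odd k then (-(2 / k : ℂ)) • J k else 0)

/-- `V_-(z)⁻¹ = exp (-∑_{k < 0 odd} (2/k) J_k z^{-k})`, a power series in `z`. -/
def VminusInv : PowerSeries (Module.End ℂ Fock) :=
  fexp (PowerSeries.mk fun k : ℕ => if Odd k then (2 / k : ℂ) • J (-k) else 0)

/-- The fermionic mode `J_{m+1/2}`, defined by
`V_-(z)⁻¹ φ(z) V_+(z)⁻¹ = θ(z) = 2 ∑_{i ∈ 1/2 + ℤ} J_i z^{-i-1/2}`, where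
`φ(z) = ∑_j φ_j z^{j-1/2}`. Every coefficient is a finite sum, since `J_k` lowers the degree
by `k`. -/
def Jhalf (m : ℤ) (f : Fock) : Fock := fun c =>
  (1 / 2 : ℂ) * ∑ᶠ p : ℕ × ℕ, MvPowerSeries.coeff c
    (PowerSeries.coeff p.2 VminusInv
      (phi (-m - 1 + p.1 - p.2) (PowerSeries.coeff p.1 VplusInv f)))

/-- `e^{H(t)}` with `H(t) = ∑_{k ≥ 0} t_{2k+1} J_{2k+1}`, a power series in the even times with
operator coefficients. -/
def expH : MvPowerSeries ℕ (Module.End ℂ Fock) :=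
  fexp (fun a => ∑ k ∈ a.support, if a = Finsupp.single k 1 then J (2 * k + 1) else 0)

/-- The functional `⟨α| = ⟨0| J_{α_n/2} ⋯ J_{α_1/2}`, `α_1 > ⋯ > α_n`. -/
def bra (α : Finset ℕ) (f : Fock) : ℂ :=
  vev ((α.sort (· ≥ ·)).foldl (fun x n => Jhalf (n : ℤ) x) f)

/-- Superfunctions `∑_α f_α(t) ξ_α` of all times, as the families `(f_α)`, where
`ξ_α = t_{α_1/2} ⋯ t_{α_n/2}` with `α_1 > ⋯ > α_n` is a monomial in the Grassmann times. -/
abbrev Super : Type := Finset ℕ → Times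

/-- `σ(f) = ⟨0| e^{H(t)} e^{χ(t_odd)} f`, whose `ξ_α`-component is `⟨α| e^{H(t)} f`. -/
def sigma (f : Fock) : Super := fun α a => bra α (MvPowerSeries.coeff a expH f)

/-- `(-1)` to the number of parts of `α` that are larger than the part indexed by `n`. -/
def sgn (n : ℕ) (α : Finset ℕ) : ℂ := (-1) ^ (α.filter (n < ·)).card

/-- The left derivative with respect to the Grassmann time `t_{n+1/2}`. -/
def dOdd (n : ℕ) (F : Super) : Super := fun α =>
  if n ∈ α then 0 else sgn n α • F (insert n α)

/-- Left multiplication by the Grassmann time `t_{n+1/2}`. -/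
def mOdd (n : ℕ) (F : Super) : Super := fun α =>
  if n ∈ α then sgn n α • F (α.erase n) else 0

/-- `s` is the boson-(boson + fermion) isomorphism: it is linear and bijective, it maps the vacuum
to `1`, and for `j > 0` it turns `J_j` into `∂/∂t_j` and `J_{-j}` into
`(-1)^{[1/2 - j]} (j/2) t_j`. -/
structure IsBoseFermi (s : Fock → Super) : Prop where
  linear : IsLinearMap ℂ s
  bijective : Function.Bijective s
  vacuum : s vac = fun α => if α = ∅ then 1 else 0
  even_pos : ∀ (k : ℕ) (f : Fock) (α : Finset ℕ),
    s (J (2 * k + 1) f) α = MvPowerSeries.pderiv ℂ k (s f α)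
  even_neg : ∀ (k : ℕ) (f : Fock) (α : Finset ℕ),
    s (J (-(2 * k + 1)) f) α = (-((2 * k + 1) / 2) : ℂ) • (MvPowerSeries.X k * s f α)
  odd_pos : ∀ (k : ℕ) (f : Fock), s (Jhalf k f) = dOdd k (s f)
  odd_neg : ∀ (k : ℕ) (f : Fock),
    s (Jhalf (-k - 1) f) = ((-1) ^ k * ((2 * k + 1) / 4) : ℂ) • mOdd k (s f)

/-! ### Hirota equation, tau function and the functions `g_α` -/

/-- `v` is a (possibly infinite) linear combination of products of an even number of `φ_j`'s
applied to the vacuum. -/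
def IsEven (v : Fock) : Prop := ∀ a : ℕ →₀ ℕ, Odd a.degree → MvPowerSeries.coeff a v = 0

/-- `Res_z u(z) ⊗ w(-z)` for formal series `u(z) = ∑_m u_m z^m` and `w(z) = ∑_m w_m z^m` of power
series, in power series in two disjoint sets of variables: the coefficient at the pair of
monomials with exponents `a` and `b`. -/
def res (u w : ℤ → MvPowerSeries ℕ ℂ) (a b : ℕ →₀ ℕ) : ℂ :=
  ∑ᶠ m : ℤ, (-1 : ℂ) ^ (-1 - m) *
    (MvPowerSeries.coeff a (u m) * MvPowerSeries.coeff b (w (-1 - m)))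

/-- The residue `Res_z u(z) ⊗ w(-z)` exists (every coefficient is a finite sum) and vanishes. -/
def ResZero (u w : ℤ → MvPowerSeries ℕ ℂ) : Prop :=
  ∀ a b : ℕ →₀ ℕ,
    (Function.support fun m : ℤ =>
      MvPowerSeries.coeff a (u m) * MvPowerSeries.coeff b (w (-1 - m))).Finite ∧
    res u w a b = 0

/-- The CKP Hirota equation `Res_z φ(z) v ⊗ φ(-z) v = 0`. -/
def Hirota (v : Fock) : Prop := ResZero (fun m => phi m v) (fun m => phi m v)

/-- The components `τ_α(t)` of the super tau function `σ(v) = ∑_α τ_α(t) ξ_α`. -/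
def tau (v : Fock) (α : Finset ℕ) : Times := sigma v α

/-- The components `g_α(t,z)` in `σ(φ(z) v) = ∑_α g_α(t,z) ξ_α`; `g v α m` is the coefficient
of `z^m`. -/
def g (v : Fock) (α : Finset ℕ) (m : ℤ) : Times := sigma (phi m v) α

/-- `e^{c φ(t,z)}` with `φ(t,z) = ∑_{k > 0 odd} t_k z^k`, a power series in `z`. -/
def expVarphi (c : ℂ) : PowerSeries Times :=
  fexp (PowerSeries.mk fun k : ℕ => if Odd k then c • (MvPowerSeries.X (k / 2) : Times) else 0)

/-- The product of `e^{c φ(t,z)}` and `u(t,z) = ∑_m u_m z^m`; the coefficient of `z^m`. Each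
coefficient is a finite sum, since the coefficient of `z^n` in `e^{c φ}` is homogeneous of
weight `n`. -/
def mulExp (c : ℂ) (u : ℤ → Times) (m : ℤ) : Times := fun a =>
  ∑ᶠ n : ℕ, MvPowerSeries.coeff a (PowerSeries.coeff n (expVarphi c) * u (m - n))

/-- `exp (∑_{k > 0 odd} (2/k) ∂/∂t_k z^{-k})`, a power series in `z⁻¹`. -/
def shift : PowerSeries (Module.End ℂ Times) :=
  fexp (PowerSeries.mk fun k : ℕ => if Odd k then
    (2 / k : ℂ) • (MvPowerSeries.pderiv ℂ (k / 2) : Derivation ℂ Times Times).toLinearMap else 0)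

/-- `shift` applied to `u(t,z) = ∑_m u_m z^m` with only finitely many positive powers of `z`;
the coefficient of `z^m`. -/
def applyShift (u : ℤ → Times) (m : ℤ) : Times := fun a =>
  ∑ᶠ n : ℕ, MvPowerSeries.coeff a (PowerSeries.coeff n shift (u (m + n)))

/-- The coefficient of `z^m` in
`∑_i (-1)^{i-1} (α_i/2) τ_{α∖α_i} (-z)^{(α_i-1)/2} + 2 ∑_{ν ∉ α} s(ν,α) τ_{α∪ν} z^{-(ν+1)/2}`. -/
def bracket (v : Fock) (α : Finset ℕ) : ℤ → Times
  | Int.ofNat n =>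
      if n ∈ α then (sgn n α * ((2 * n + 1) / 2) * (-1) ^ n) • tau v (α.erase n) else 0
  | Int.negSucc n =>
      if n ∈ α then 0 else (2 * sgn n α) • tau v (insert n α)

/-! ### The wave functions -/

/-- The field of fractions of the ring of power series in the even times. -/
abbrev K : Type := FractionRing Times

/-- `top α = (α_1 - 1)/2` for the largest part `α_1` of `α ≠ 0`. -/
def top (α : Finset ℕ) : ℕ := α.sup id

/-- `τ_{α∖α_1}(t)`. -/
def tauTop (v : Fock) (α : Finset ℕ) : Times := tau v (α.erase (top α))

/-- The wave function `w_α(t,z) = g_α(t,z) / ((-1)^{(α_1-1)/2} (α_1/2) τ_{α∖α_1}(t))`;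
the coefficient of `z^m`. -/
def wave (v : Fock) (α : Finset ℕ) (m : ℤ) : K :=
  algebraMap Times K (g v α m) /
    algebraMap Times K (((-1 : ℂ) ^ top α * ((2 * top α + 1) / 2)) • tauTop v α)

/-- `ŵ_α(t,z) = (-z)^{-(α_1-1)/2} g_α(t,z) e^{-φ(t,z)} / ((α_1/2) τ_{α∖α_1}(t))`;
the coefficient of `z^m`. -/
def hatw (v : Fock) (α : Finset ℕ) (m : ℤ) : K :=
  algebraMap Times K ((-1 : ℂ) ^ top α • mulExp (-1) (g v α) (m + top α)) /
    algebraMap Times K ((((2 * top α + 1) / 2) : ℂ) • tauTop v α)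

/-- `Res_z u(t,z) w(s,-z) = 0` for series whose coefficients are fractions with a common
denominator. -/
def FracResZero (u w : ℤ → K) : Prop :=
  ∃ (d e : Times) (U W : ℤ → Times), d ≠ 0 ∧ e ≠ 0 ∧
    (∀ m, u m = algebraMap Times K (U m) / algebraMap Times K d) ∧
    (∀ m, w m = algebraMap Times K (W m) / algebraMap Times K e) ∧
    ResZero U W

/-- `w(t,z) = u(t,z) z^r e^{φ(t,z)}` for series whose coefficients are fractions with a common
denominator. -/
def FracMulExp (u : ℤ → K) (r : ℕ) (w : ℤ → K) : Prop :=
  ∃ (d : Times) (U : ℤ → Times), d ≠ 0 ∧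
    (∀ m, u m = algebraMap Times K (U m) / algebraMap Times K d) ∧
    (∀ m, w m = algebraMap Times K (mulExp 1 (fun n => U (n - r)) m) / algebraMap Times K d)

/-- The extension of a derivation to the field of fractions, by the quotient rule. -/
def fracDeriv (D : Derivation ℂ Times Times) (x : K) : K :=
  let p := IsLocalization.sec (nonZeroDivisors Times) x
  (algebraMap Times K (D p.1) * algebraMap Times K p.2 -
    algebraMap Times K p.1 * algebraMap Times K (D p.2)) / algebraMap Times K p.2 ^ 2

theorem fracDeriv_div (D : Derivation ℂ Times Times) (a b : Times) (hb : b ≠ 0) :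
    fracDeriv D (algebraMap Times K a / algebraMap Times K b) =
      (algebraMap Times K (D a) * algebraMap Times K b -
        algebraMap Times K a * algebraMap Times K (D b)) / algebraMap Times K b ^ 2 := by
  have inj := IsFractionRing.injective Times K
  have hb' : algebraMap Times K b ≠ 0 := fun h => hb (inj (by rw [h, map_zero]))
  obtain ⟨p, hp⟩ : ∃ p, p = IsLocalization.sec (nonZeroDivisors Times)
    (algebraMap Times K a / algebraMap Times K b) := ⟨_, rfl⟩
  have hs := IsLocalization.sec_spec (nonZeroDivisors Times)
    (algebraMap Times K a / algebraMap Times K b)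
  have hq : algebraMap Times K p.2 ≠ 0 := fun h =>
    nonZeroDivisors.ne_zero p.2.2 (inj (by rw [h, map_zero]))
  unfold fracDeriv
  rw [← hp] at hs ⊢
  simp only
  have h1 : a * p.2 = p.1 * b := by
    apply inj
    rw [map_mul, map_mul, ← hs]
    field_simp
  have h2 := congrArg (algebraMap Times K) (congrArg D h1)
  have h3 := congrArg (algebraMap Times K) h1
  simp only [Derivation.leibniz, smul_eq_mul, map_add, map_mul] at h2 h3
  rw [div_eq_div_iff (pow_ne_zero 2 hq) (pow_ne_zero 2 hb')]
  generalize algebraMap Times K a = A at *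
  generalize algebraMap Times K b = B at *
  generalize algebraMap Times K p.1 = P at *
  generalize algebraMap Times K p.2 = Q at *
  generalize algebraMap Times K (D a) = A' at *
  generalize algebraMap Times K (D b) = B' at *
  generalize algebraMap Times K (D p.1) = P' at *
  generalize algebraMap Times K (D p.2) = Q' at *
  linear_combination (-B * Q) * h2 + (B * Q' + Q * B') * h3

/-- `∂/∂t_{2k+1}` on fractions; `tderiv 0` is `∂ = ∂/∂x = ∂/∂t_1`. -/
def tderiv (k : ℕ) : K → K := fracDeriv (MvPowerSeries.pderiv ℂ k)

theorem tderiv_zero (k : ℕ) : tderiv k 0 = 0 := by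
  have h := fracDeriv_div (MvPowerSeries.pderiv ℂ k) 0 1 one_ne_zero
  simpa [tderiv] using h

theorem tderiv_iterate_zero (k n : ℕ) : (tderiv k)^[n] 0 = 0 :=
  Function.iterate_fixed (tderiv_zero k) n

/-! ### Formal pseudodifferential operators -/

/-- Formal pseudodifferential operators `∑_m P_m ∂^m`, with `P_m = 0` for large `m`. -/
@[ext] structure PsiDO : Type where
  coeff : ℤ → K
  bdd : ∃ N : ℤ, ∀ m, N < m → coeff m = 0

namespace PsiDO

instance : Zero PsiDO := ⟨⟨fun _ => 0, 0, fun _ _ => rfl⟩⟩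

/-- `∂^n`. -/
def dpow (n : ℤ) : PsiDO := ⟨fun m => if m = n then 1 else 0, n, fun _ h => if_neg h.ne'⟩

instance : One PsiDO := ⟨dpow 0⟩

instance : Neg PsiDO := ⟨fun P => ⟨fun m => -P.coeff m, by
  obtain ⟨N, h⟩ := P.bdd
  exact ⟨N, fun m hm => by simp [h m hm]⟩⟩⟩

instance : Sub PsiDO := ⟨fun P Q => ⟨fun m => P.coeff m - Q.coeff m, by
  obtain ⟨N, h⟩ := P.bdd
  obtain ⟨N', h'⟩ := Q.bdd
  exact ⟨max N N', fun m hm => by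
    simp [h m (lt_of_le_of_lt (le_max_left _ _) hm), h' m (lt_of_le_of_lt (le_max_right _ _) hm)]⟩⟩⟩

/-- The product, determined by `∂^m a = ∑_{k ≥ 0} binom(m,k) (∂^k a) ∂^{m-k}`. -/
instance : Mul PsiDO := ⟨fun P Q =>
  ⟨fun N => ∑ᶠ p : ℤ × ℕ,
      (Ring.choose p.1 p.2 : ℤ) • (P.coeff p.1 * (tderiv 0)^[p.2] (Q.coeff (N - p.1 + p.2))), by
    obtain ⟨M, h⟩ := P.bdd
    obtain ⟨M', h'⟩ := Q.bdd
    refine ⟨M + M', fun N hN => finsum_eq_zero_of_forall_eq_zero fun p => ?_⟩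
    by_cases hp : M < p.1
    · simp [h _ hp]
    · rw [h' _ (by omega), tderiv_iterate_zero]
      simp⟩⟩

instance : Pow PsiDO ℕ := ⟨fun P n => npowRec n P⟩

/-- The inverse: a two-sided inverse if there is one, and `0` otherwise. -/
instance : Inv PsiDO := ⟨fun P =>
  open Classical in if h : ∃ Q : PsiDO, P * Q = 1 ∧ Q * P = 1 then h.choose else 0⟩

/-- The formal adjoint, determined by `(a ∂^m)^* = (-∂)^m a`. -/
def adj (P : PsiDO) : PsiDO :=
  ⟨fun N => ∑ᶠ k : ℕ, ((-1 : ℤˣ) ^ (N + k) : ℤˣ) •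
      ((Ring.choose (N + k) k : ℤ) • (tderiv 0)^[k] (P.coeff (N + k))), by
    obtain ⟨M, h⟩ := P.bdd
    refine ⟨M, fun N hN => finsum_eq_zero_of_forall_eq_zero fun k => ?_⟩
    rw [h _ (by omega), tderiv_iterate_zero]
    simp⟩

/-- The differential part `P_+`. -/
def plusPart (P : PsiDO) : PsiDO := ⟨fun m => if 0 ≤ m then P.coeff m else 0, by
  obtain ⟨N, h⟩ := P.bdd
  exact ⟨N, fun m hm => by simp [h m hm]⟩⟩

/-- The integral part `P_-`. -/
def minusPart (P : PsiDO) : PsiDO := ⟨fun m => if m < 0 then P.coeff m else 0, by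
  obtain ⟨N, h⟩ := P.bdd
  exact ⟨N, fun m hm => by simp [h m hm]⟩⟩

/-- `∂P/∂t_{2k+1}`, coefficientwise. -/
def timeDeriv (k : ℕ) (P : PsiDO) : PsiDO := ⟨fun m => tderiv k (P.coeff m), by
  obtain ⟨N, h⟩ := P.bdd
  exact ⟨N, fun m hm => by rw [h m hm, tderiv_zero]⟩⟩

/-- The operator `∑_m u_m ∂^m` with symbol `∑_m u_m z^m` (`0` if `u` has no upper bound). -/
def ofSymbol (u : ℤ → K) : PsiDO :=
  open Classical in if h : ∃ N : ℤ, ∀ m, N < m → u m = 0 then ⟨u, h⟩ else 0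

/-- The action of the differential part of `P` on `u(t,z) = ∑_m u_m z^m`, coefficientwise
in `z`. -/
def act (P : PsiDO) (u : ℤ → K) (m : ℤ) : K :=
  ∑ᶠ n : ℕ, P.coeff n * (tderiv 0)^[n] (u m)

end PsiDO

/-- The operator `ŵ_α(t,∂)`. -/
def hatW (v : Fock) (α : Finset ℕ) : PsiDO := PsiDO.ofSymbol (hatw v α)

/-- The Lax operator `L = ŵ ∂ ŵ⁻¹`, `ŵ = ŵ_{(1)}`. -/
def Lax (v : Fock) : PsiDO := hatW v {0} * PsiDO.dpow 1 * (hatW v {0})⁻¹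

end CKP

end

open Finset

noncomputable section

namespace CKP

/-! ### Formal exponentials -/

section Fexp
variable {σ R : Type} [Ring R]

/-! The first half of the theorem is proved on the dual side. Under ⟨p, f⟩ = (p(∂)f)(0) (`pair`)
power series are the full dual of polynomials, so operators on the completed Fock space are
transposes of operators on polynomials, where no completion is needed: φ becomes `psi`, J_n becomes
`-JD (-n)`, the half-integer modes become half of `thetaD`. The map σ turns out to be the transpose
of the inverse of an isomorphism `bos` from polynomials onto polynomial superfunctions `SPoly`
(`pair_sigma`), so each statement about σ is the transpose of one about `bos`.

The map `bos` is built from the superfunction side. Dress the fermion θ(z) by vertex operators to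
Φ(z) = V_-(z) θ(z) V_+(z). Moving V_+(z) past V_-(w) produces (z+w)/(z-w), which changes sign when z
and w are exchanged and has a zero at z = -w. The first property turns anticommutators into
commutators; the second reduces the derivative of a delta function at z = -w in {θ(z), θ(w)} to a
plain delta function. Hence Φ satisfies the boson relations (`Phi_comm`), and the creation modes Φ_k
may be substituted for the variables. That the currents correspond as well follows because a vector
killed by all annihilators and without vacuum component is zero (`eq_zero_of_vacuum`).

Transposing the three factors of Φ gives the formula for g_α: V_+ becomes e^φ, V_- the shift of
times, θ the bracket of tau functions (`g_eq`). The Hirota equation becomes the vanishing of a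
bilinear form on superfunctions, which may be tested on the monomials ξ_α q
(`hirota_iff_resZero_g`).

For the hierarchy put s = t. Since φ(t,z) is odd in z, e^{φ(t,z)} e^{φ(t,-z)} = 1, so the bilinear
identity becomes a residue identity for the symbols (`diagRes_eq_zero`), and Res_z P(z)Q(-z) is the
coefficient of ∂^{-1} in P Q^* (`coeff_mul_adj_neg_one`). Derivatives in s_1 taken before putting s
= t replace Q by ∂^n Q, so every negative coefficient of P Q^* vanishes (`isDiff_of_resZero`). For α
= β = (1) the product W W^* is differential, monic and of order zero, hence 1; a t_k-derivative of
the identity shows that (W_{t_k} + W ∂^k) W^* is differential, which is Sato's equation. These facts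
form `Dressing`, from which the Lax equations follow by algebra. -/

theorem coeff_pow_eq_zero_of_degree_lt {A : MvPowerSeries σ R} (hA : MvPowerSeries.coeff 0 A = 0)
    {n : ℕ} : ∀ {a : σ →₀ ℕ}, a.degree < n → MvPowerSeries.coeff a (A ^ n) = 0 := by
  classical
  induction n with
  | zero => intro a h; omega
  | succ n ih =>
    intro a h
    rw [pow_succ', MvPowerSeries.coeff_mul]
    refine Finset.sum_eq_zero fun p hp => ?_
    rw [HasAntidiagonal.mem_antidiagonal] at hp
    by_cases h0 : p.1 = 0
    · rw [h0, hA, zero_mul]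
    · have h1 : p.1.degree ≠ 0 := fun h => h0 ((Finsupp.degree_eq_zero_iff _).mp h)
      have h2 : p.1.degree + p.2.degree = a.degree := by rw [← hp]; simp
      rw [ih (by omega), mul_zero]

theorem sum_antidiagonal_swap {M N : Type*} [AddCommMonoid M] [AddCommMonoid N]
    [HasAntidiagonal M] (a : M) (f : M → M → N) :
    ∑ p ∈ antidiagonal a, f p.2 p.1 = ∑ p ∈ antidiagonal a, f p.1 p.2 :=
  Finset.sum_nbij' Prod.swap Prod.swap
    (fun p hp => by rw [HasAntidiagonal.mem_antidiagonal] at hp ⊢; simpa [add_comm] using hp)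
    (fun p hp => by rw [HasAntidiagonal.mem_antidiagonal] at hp ⊢; simpa [add_comm] using hp)
    (fun _ _ => rfl) (fun _ _ => rfl) fun _ _ => rfl

theorem commute_of_coeff {f g : MvPowerSeries σ R}
    (h : ∀ a b, Commute (MvPowerSeries.coeff a f) (MvPowerSeries.coeff b g)) : Commute f g := by
  classical
  ext a
  rw [MvPowerSeries.coeff_mul, MvPowerSeries.coeff_mul,
    ← sum_antidiagonal_swap a fun i j => MvPowerSeries.coeff i g * MvPowerSeries.coeff j f]
  exact Finset.sum_congr rfl fun p _ => (h _ _).eq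

variable [Algebra ℂ R]

theorem coeff_fexp_of_lt {A : MvPowerSeries σ R} (hA : MvPowerSeries.coeff 0 A = 0)
    {a : σ →₀ ℕ} {N : ℕ} (h : a.degree < N) :
    MvPowerSeries.coeff a (fexp A) =
      ∑ n ∈ range N, ((n.factorial : ℂ)⁻¹) • MvPowerSeries.coeff a (A ^ n) := by
  change ∑ n ∈ range (a.degree + 1), _ = _
  refine Finset.sum_subset (fun n hn => ?_) fun n _ hn => ?_
  · rw [mem_range] at hn ⊢; omega
  · rw [mem_range] at hn
    rw [coeff_pow_eq_zero_of_degree_lt hA (by omega), smul_zero]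

theorem coeff_zero_fexp {A : MvPowerSeries σ R} (hA : MvPowerSeries.coeff 0 A = 0) :
    MvPowerSeries.coeff 0 (fexp A) = 1 := by
  classical
  rw [coeff_fexp_of_lt hA (N := 1) (by simp)]
  simp

/-- Applies the operators `δ a` to the coefficients of a formal power series. -/
def mapDeriv (δ : (σ →₀ ℕ) → R →ₗ[ℂ] R) (f : MvPowerSeries σ R) : MvPowerSeries σ R :=
  fun a => δ a (MvPowerSeries.coeff a f)

theorem coeff_mapDeriv (δ : (σ →₀ ℕ) → R →ₗ[ℂ] R) (f : MvPowerSeries σ R) (a : σ →₀ ℕ) :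
    MvPowerSeries.coeff a (mapDeriv δ f) = δ a (MvPowerSeries.coeff a f) := rfl

variable {δ : (σ →₀ ℕ) → R →ₗ[ℂ] R}

theorem mapDeriv_mul (hδ : ∀ a b x y, δ (a + b) (x * y) = δ a x * y + x * δ b y)
    (f g : MvPowerSeries σ R) :
    mapDeriv δ (f * g) = mapDeriv δ f * g + f * mapDeriv δ g := by
  classical
  ext a
  rw [coeff_mapDeriv, map_add, MvPowerSeries.coeff_mul, MvPowerSeries.coeff_mul,
    MvPowerSeries.coeff_mul, map_sum, ← Finset.sum_add_distrib]
  refine Finset.sum_congr rfl fun p hp => ?_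
  rw [HasAntidiagonal.mem_antidiagonal] at hp
  rw [← hp, hδ]
  rfl

theorem mapDeriv_one (hδ : ∀ a b x y, δ (a + b) (x * y) = δ a x * y + x * δ b y) :
    mapDeriv δ (1 : MvPowerSeries σ R) = 0 := by
  have h := mapDeriv_mul hδ 1 1
  simpa using h

theorem mapDeriv_pow_succ (hδ : ∀ a b x y, δ (a + b) (x * y) = δ a x * y + x * δ b y)
    {A : MvPowerSeries σ R} (hc : Commute (mapDeriv δ A) A) (n : ℕ) :
    mapDeriv δ (A ^ (n + 1)) = (n + 1) • (mapDeriv δ A * A ^ n) := by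
  induction n with
  | zero => simp
  | succ n ih =>
    have h : A ^ (n + 1) * mapDeriv δ A = mapDeriv δ A * A ^ (n + 1) :=
      (hc.pow_right (n + 1)).eq.symm
    rw [pow_succ, mapDeriv_mul hδ, ih, h, smul_mul_assoc, mul_assoc, ← pow_succ,
      add_smul (n + 1) 1, one_smul]

/-- Chain rule, the source of all the exponential identities: δ may be an Euler operator in the
variables, a commutator with a fixed operator, or a derivation of the coefficients. Commutation of
δA with A is what allows the powers to be differentiated as in the commutative case. -/
theorem mapDeriv_fexp (hδ : ∀ a b x y, δ (a + b) (x * y) = δ a x * y + x * δ b y)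
    {A : MvPowerSeries σ R} (hA : MvPowerSeries.coeff 0 A = 0)
    (hc : Commute (mapDeriv δ A) A) : mapDeriv δ (fexp A) = mapDeriv δ A * fexp A := by
  classical
  ext a
  -- One term more than in the definition: the term n = 0 is killed by δ, and the shift n + 1 ↦ n
  -- then leaves the range that suffices on the right.
  rw [coeff_mapDeriv, coeff_fexp_of_lt hA (N := a.degree + 1 + 1) (by omega), map_sum,
    Finset.sum_range_succ', MvPowerSeries.coeff_mul]
  have h0 : δ a (((Nat.factorial 0 : ℂ)⁻¹) • MvPowerSeries.coeff a (A ^ 0)) = 0 := by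
    rw [map_smul, pow_zero, ← coeff_mapDeriv, mapDeriv_one hδ]; simp
  rw [h0, add_zero]
  have h1 : ∀ n, δ a ((((n + 1).factorial : ℂ)⁻¹) • MvPowerSeries.coeff a (A ^ (n + 1))) =
      ∑ p ∈ antidiagonal a, MvPowerSeries.coeff p.1 (mapDeriv δ A) *
        ((n.factorial : ℂ)⁻¹ • MvPowerSeries.coeff p.2 (A ^ n)) := by
    intro n
    rw [map_smul, ← coeff_mapDeriv, mapDeriv_pow_succ hδ hc, map_nsmul, ← Nat.cast_smul_eq_nsmul ℂ,
      smul_smul, Nat.factorial_succ, MvPowerSeries.coeff_mul]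
    have : (((n + 1) * n.factorial : ℕ) : ℂ)⁻¹ * ((n + 1 : ℕ) : ℂ) = (n.factorial : ℂ)⁻¹ := by
      have : ((n : ℂ) + 1) ≠ 0 := by exact_mod_cast Nat.succ_ne_zero n
      have : (n.factorial : ℂ) ≠ 0 := by exact_mod_cast n.factorial_ne_zero
      push_cast
      field_simp
    rw [this, Finset.smul_sum]
    simp only [mul_smul_comm]
  rw [Finset.sum_congr rfl fun n _ => h1 n, Finset.sum_comm]
  refine Finset.sum_congr rfl fun p hp => ?_
  rw [HasAntidiagonal.mem_antidiagonal] at hp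
  have : p.1.degree + p.2.degree = a.degree := by rw [← hp]; simp
  rw [coeff_fexp_of_lt hA (N := a.degree + 1) (by omega), Finset.mul_sum]

/-- Compatible relations between coefficients pass to formal exponentials. -/
theorem fexp_rel {R' : Type} [Ring R'] [Algebra ℂ R'] (r : R → R' → Prop) (h0 : r 0 0) (h1 : r 1 1)
    (hadd : ∀ x x' y y', r x x' → r y y' → r (x + y) (x' + y'))
    (hsmul : ∀ (c : ℂ) x x', r x x' → r (c • x) (c • x'))
    (hmul : ∀ x x' y y', r x x' → r y y' → r (x * y) (x' * y'))
    {A : MvPowerSeries σ R} {A' : MvPowerSeries σ R'}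
    (h : ∀ a, r (MvPowerSeries.coeff a A) (MvPowerSeries.coeff a A')) (a : σ →₀ ℕ) :
    r (MvPowerSeries.coeff a (fexp A)) (MvPowerSeries.coeff a (fexp A')) := by
  classical
  have hsum : ∀ {ι : Type} (s : Finset ι) (f : ι → R) (f' : ι → R'), (∀ i, r (f i) (f' i)) →
      r (∑ i ∈ s, f i) (∑ i ∈ s, f' i) := by
    intro ι s f f' hf
    induction s using Finset.induction_on with
    | empty => simpa
    | insert i s hi ih => rw [sum_insert hi, sum_insert hi]; exact hadd _ _ _ _ (hf i) ih
  have hpow : ∀ n a, r (MvPowerSeries.coeff a (A ^ n)) (MvPowerSeries.coeff a (A' ^ n)) := by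
    intro n
    induction n with
    | zero =>
      intro a
      rw [pow_zero, pow_zero, MvPowerSeries.coeff_one, MvPowerSeries.coeff_one]
      split_ifs <;> assumption
    | succ n ih =>
      intro a
      rw [pow_succ, pow_succ, MvPowerSeries.coeff_mul, MvPowerSeries.coeff_mul]
      exact hsum _ _ _ fun p => hmul _ _ _ _ (ih _) (h _)
  change r (∑ n ∈ range (a.degree + 1), ((n.factorial : ℂ)⁻¹) • MvPowerSeries.coeff a (A ^ n))
    (∑ n ∈ range (a.degree + 1), ((n.factorial : ℂ)⁻¹) • MvPowerSeries.coeff a (A' ^ n))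
  exact hsum _ _ _ fun n => hsmul _ _ _ (hpow n a)

/-- Relations between coefficients that reverse products pass to formal exponentials. -/
theorem fexp_rel_anti {R' : Type} [Ring R'] [Algebra ℂ R'] (r : R → R' → Prop) (h0 : r 0 0)
    (h1 : r 1 1) (hadd : ∀ x x' y y', r x x' → r y y' → r (x + y) (x' + y'))
    (hsmul : ∀ (c : ℂ) x x', r x x' → r (c • x) (c • x'))
    (hmul : ∀ x x' y y', r x x' → r y y' → r (x * y) (y' * x'))
    {A : MvPowerSeries σ R} {A' : MvPowerSeries σ R'}
    (h : ∀ a, r (MvPowerSeries.coeff a A) (MvPowerSeries.coeff a A')) (a : σ →₀ ℕ) :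
    r (MvPowerSeries.coeff a (fexp A)) (MvPowerSeries.coeff a (fexp A')) := by
  classical
  have hsum : ∀ {ι : Type} (s : Finset ι) (f : ι → R) (f' : ι → R'), (∀ i, r (f i) (f' i)) →
      r (∑ i ∈ s, f i) (∑ i ∈ s, f' i) := by
    intro ι s f f' hf
    induction s using Finset.induction_on with
    | empty => simpa
    | insert i s hi ih => rw [sum_insert hi, sum_insert hi]; exact hadd _ _ _ _ (hf i) ih
  have hpow : ∀ n a, r (MvPowerSeries.coeff a (A ^ n)) (MvPowerSeries.coeff a (A' ^ n)) := by
    intro n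
    induction n with
    | zero =>
      intro a
      rw [pow_zero, pow_zero, MvPowerSeries.coeff_one, MvPowerSeries.coeff_one]
      split_ifs <;> assumption
    | succ n ih =>
      intro a
      -- The last factor is split off on one side and the first on the other, since products are
      -- reversed.
      rw [pow_succ, pow_succ', MvPowerSeries.coeff_mul, MvPowerSeries.coeff_mul,
        ← sum_antidiagonal_swap a fun i j => MvPowerSeries.coeff i A' * MvPowerSeries.coeff j (A' ^ n)]
      exact hsum _ _ _ fun p => hmul _ _ _ _ (ih _) (h _)
  change r (∑ n ∈ range (a.degree + 1), ((n.factorial : ℂ)⁻¹) • MvPowerSeries.coeff a (A ^ n))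
    (∑ n ∈ range (a.degree + 1), ((n.factorial : ℂ)⁻¹) • MvPowerSeries.coeff a (A' ^ n))
  exact hsum _ _ _ fun n => hsmul _ _ _ (hpow n a)

/-- Here the derivation is z d/dz. -/
theorem fexp_euler {A : PowerSeries R} (hA : PowerSeries.coeff 0 A = 0)
    (hc : ∀ i j, Commute (PowerSeries.coeff i A) (PowerSeries.coeff j A)) (n : ℕ) :
    (n : ℂ) • PowerSeries.coeff n (fexp A) =
      ∑ p ∈ antidiagonal n, ((p.1 : ℂ) • PowerSeries.coeff p.1 A) * PowerSeries.coeff p.2 (fexp A)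
    := by
  have key : ∀ a : Unit →₀ ℕ, a = Finsupp.single () (a ()) := fun a => by ext; simp
  rw [PowerSeries.coeff, Finsupp.single_zero] at hA
  have h := mapDeriv_fexp (δ := fun a => ((a () : ℕ) : ℂ) • LinearMap.id) (A := A)
    (fun a b x y => by simp [add_smul]) hA
    (commute_of_coeff fun a b => by
      rw [coeff_mapDeriv]
      simp only [LinearMap.smul_apply, LinearMap.id_apply]
      rw [key a, key b]
      exact (hc _ _).smul_left _)
  have h' := congrArg (PowerSeries.coeff n) h
  rw [PowerSeries.coeff_mul] at h'
  simpa [PowerSeries.coeff, coeff_mapDeriv] using h'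

/-- Here the derivation is the commutator with `B`, the same in all degrees. -/
theorem fexp_commutator {A : PowerSeries R} (hA : PowerSeries.coeff 0 A = 0) (B : R)
    (hc : ∀ i j, Commute (B * PowerSeries.coeff i A - PowerSeries.coeff i A * B)
      (PowerSeries.coeff j A)) (n : ℕ) :
    B * PowerSeries.coeff n (fexp A) - PowerSeries.coeff n (fexp A) * B =
      ∑ p ∈ antidiagonal n, (B * PowerSeries.coeff p.1 A - PowerSeries.coeff p.1 A * B) *
        PowerSeries.coeff p.2 (fexp A) := by
  have key : ∀ a : Unit →₀ ℕ, a = Finsupp.single () (a ()) := fun a => by ext; simp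
  rw [PowerSeries.coeff, Finsupp.single_zero] at hA
  have h := mapDeriv_fexp (δ := fun _ => LinearMap.mulLeft ℂ B - LinearMap.mulRight ℂ B) (A := A)
    (fun a b x y => by simp only [LinearMap.sub_apply, LinearMap.mulLeft_apply,
      LinearMap.mulRight_apply]; noncomm_ring) hA
    (commute_of_coeff fun a b => by
      rw [coeff_mapDeriv, key a, key b]
      exact hc _ _)
  have h' := congrArg (PowerSeries.coeff n) h
  rw [PowerSeries.coeff_mul] at h'
  exact h'

end Fexp

/-- The Euler operator, which multiplies a coefficient by its degree, annihilates the product, so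
only the constant term survives. -/
theorem fexp_mul_fexp_neg {σ R : Type} [CommRing R] [Algebra ℂ R] {A : MvPowerSeries σ R}
    (hA : MvPowerSeries.coeff 0 A = 0) : fexp A * fexp (-A) = 1 := by
  classical
  have hδ : ∀ (a b : σ →₀ ℕ) (x y : R), (((a + b).degree : ℂ) • (LinearMap.id : R →ₗ[ℂ] R)) (x * y)
      = ((a.degree : ℂ) • (LinearMap.id : R →ₗ[ℂ] R)) x * y +
        x * ((b.degree : ℂ) • (LinearMap.id : R →ₗ[ℂ] R)) y := by
    intro a b x y; simp [add_smul]
  have hA' : MvPowerSeries.coeff 0 (-A) = 0 := by rw [map_neg, hA, neg_zero]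
  have h1 := mapDeriv_fexp (δ := fun a => (a.degree : ℂ) • (LinearMap.id : R →ₗ[ℂ] R)) hδ hA (Commute.all _ _)
  have h2 := mapDeriv_fexp (δ := fun a => (a.degree : ℂ) • (LinearMap.id : R →ₗ[ℂ] R)) hδ hA' (Commute.all _ _)
  have h3 := mapDeriv_mul (δ := fun a => (a.degree : ℂ) • (LinearMap.id : R →ₗ[ℂ] R)) hδ (fexp A) (fexp (-A))
  have h4 : mapDeriv (fun a => (a.degree : ℂ) • (LinearMap.id : R →ₗ[ℂ] R)) (-A) =
      -mapDeriv (fun a => (a.degree : ℂ) • (LinearMap.id : R →ₗ[ℂ] R)) A := by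
    ext a; simp [coeff_mapDeriv]
  rw [h1, h2, h4] at h3
  have h5 : mapDeriv (fun a => (a.degree : ℂ) • (LinearMap.id : R →ₗ[ℂ] R))
      (fexp A * fexp (-A)) = 0 := by rw [h3]; ring
  ext a
  rw [MvPowerSeries.coeff_one]
  split_ifs with ha
  · subst ha
    rw [MvPowerSeries.coeff_mul]
    simp [coeff_zero_fexp hA, coeff_zero_fexp hA']
  · have h6 := congrArg (MvPowerSeries.coeff a) h5
    rw [coeff_mapDeriv, LinearMap.smul_apply, LinearMap.id_apply, map_zero] at h6
    refine (smul_eq_zero.mp h6).resolve_left ?_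
    exact fun h => ha ((Finsupp.degree_eq_zero_iff _).mp (by exact_mod_cast h))

/-! ### Vertex operators and locally finite sums -/

section Vertex
variable {R : Type} [Ring R] [Algebra ℂ R]

/-- `exp (∑_{k > 0 odd} (c/k) J_k z^k)`. -/
def vop (c : ℂ) (J : ℕ → R) : PowerSeries R :=
  fexp (PowerSeries.mk fun k : ℕ => if Odd k then (c / k) • J k else 0)

theorem coeff_zero_vop (c : ℂ) (J : ℕ → R) : PowerSeries.coeff 0 (vop c J) = 1 := by
  rw [PowerSeries.coeff, Finsupp.single_zero]
  refine coeff_zero_fexp ?_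
  rw [← Finsupp.single_zero (), ← PowerSeries.coeff]
  simp

/-- The recursion n V_n = c ∑ J_k V_{n-k} over odd k determines V from V_0 = 1; the arguments about
vacuum vectors and matrix elements run through it instead of through the exponential series. -/
theorem vop_euler {c : ℂ} {J : ℕ → R} (hJ : ∀ i j, Odd i → Odd j → Commute (J i) (J j)) (n : ℕ) :
    (n : ℂ) • PowerSeries.coeff n (vop c J) = ∑ p ∈ antidiagonal n,
      if Odd p.1 then c • (J p.1 * PowerSeries.coeff p.2 (vop c J)) else 0 := by
  have hc : ∀ i j, Commute
      (PowerSeries.coeff i (PowerSeries.mk fun k : ℕ => if Odd k then (c / k) • J k else 0))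
      (PowerSeries.coeff j (PowerSeries.mk fun k : ℕ => if Odd k then (c / k) • J k else 0)) := by
    intro i j
    rw [PowerSeries.coeff_mk, PowerSeries.coeff_mk]
    split_ifs with hi hj
    · exact ((hJ i j hi hj).smul_left _).smul_right _
    all_goals simp
  rw [vop, fexp_euler (by simp) hc]
  refine Finset.sum_congr rfl fun p _ => ?_
  rw [PowerSeries.coeff_mk]
  split_ifs with h
  · have : (p.1 : ℂ) ≠ 0 := by exact_mod_cast h.pos.ne'
    rw [smul_smul, mul_div_cancel₀ _ this, smul_mul_assoc]
  · simp

/-- The commutator of `B` with the exponent is the central term (c e / k) z^k, so commuting `B` with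
the exponential merely multiplies the latter by this term. -/
theorem vop_commutator {c e : ℂ} {J : ℕ → R} {B : R} {k : ℕ} (hk : Odd k)
    (hB : ∀ i, Odd i → B * J i - J i * B = if i = k then e • 1 else 0) (n : ℕ) :
    B * PowerSeries.coeff n (vop c J) - PowerSeries.coeff n (vop c J) * B =
      if k ≤ n then (c / k * e) • PowerSeries.coeff (n - k) (vop c J) else 0 := by
  have hA : ∀ i, B * PowerSeries.coeff i
      (PowerSeries.mk fun k : ℕ => if Odd k then (c / k) • J k else 0) - PowerSeries.coeff i
      (PowerSeries.mk fun k : ℕ => if Odd k then (c / k) • J k else 0) * B =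
      if i = k then (c / k * e) • (1 : R) else 0 := by
    intro i
    rw [PowerSeries.coeff_mk]
    by_cases hi : Odd i
    · rw [if_pos hi, mul_smul_comm, smul_mul_assoc, ← smul_sub, hB i hi]
      split_ifs with h
      · rw [h, smul_smul]
      · simp
    · have : i ≠ k := fun h => hi (h ▸ hk)
      simp [hi, this]
  rw [vop, fexp_commutator (by simp) B fun i j => ?_]
  · simp only [hA]
    split_ifs with h
    · rw [Finset.sum_eq_single (k, n - k)]
      · simp
      · rintro ⟨i, j⟩ hp hne
        rw [HasAntidiagonal.mem_antidiagonal] at hp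
        simp only at hp ⊢
        rw [if_neg, zero_mul]
        rintro rfl
        exact hne (by rw [← hp, Nat.add_sub_cancel_left])
      · intro h'
        exact absurd (HasAntidiagonal.mem_antidiagonal.mpr (Nat.add_sub_cancel' h)) h'
    · refine Finset.sum_eq_zero fun p hp => ?_
      rw [HasAntidiagonal.mem_antidiagonal] at hp
      rw [if_neg (by omega), zero_mul]
  · rw [hA]
    split_ifs
    · exact (Commute.one_left _).smul_left _
    · exact Commute.zero_left _

theorem vop_commute {c : ℂ} {J : ℕ → R} {B : R} (hB : ∀ i, Odd i → Commute B (J i)) (n : ℕ) :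
    Commute B (PowerSeries.coeff n (vop c J)) := by
  -- The case of vanishing central term; the index 1 is an arbitrary odd number.
  have h := vop_commutator (c := c) (e := 0) (B := B) odd_one
    (fun i hi => by rw [(hB i hi).eq]; simp) n
  exact sub_eq_zero.mp (by rw [h]; simp)

end Vertex

theorem finsum_of_injective {ι κ M : Type*} [AddCommMonoid M] {e : ι → κ}
    (he : Function.Injective e) {f : κ → M} (hf : ∀ k, k ∉ Set.range e → f k = 0) :
    ∑ᶠ i, f (e i) = ∑ᶠ k, f k := by
  rw [← finsum_mem_range he, ← finsum_mem_univ (f := f)]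
  refine finsum_mem_inter_support_eq' _ _ _ fun k hk => ?_
  simp only [Set.mem_univ, iff_true]
  by_contra h
  exact hk (hf k h)

section LocSum
variable {M : Type} [AddCommGroup M] [Module ℂ M] {ι κ : Type}

/-- Only finitely many operators of the family act nontrivially on a given vector. -/
def LocFin (A : ι → Module.End ℂ M) : Prop := ∀ x, (Function.support fun i => A i x).Finite

open Classical in
/-- The sum of a locally finite family of operators. -/
def locSum (A : ι → Module.End ℂ M) : Module.End ℂ M :=
  if h : LocFin A then
    { toFun := fun x => ∑ᶠ i, A i x
      map_add' := fun x y => by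
        simp only [map_add]
        exact finsum_add_distrib (h x) (h y)
      map_smul' := fun c x => by
        simp only [map_smul, RingHom.id_apply]
        exact (smul_finsum' c (h x)).symm }
  else 0

theorem locSum_apply {A : ι → Module.End ℂ M} (h : LocFin A) (x : M) :
    locSum A x = ∑ᶠ i, A i x := by
  rw [locSum, dif_pos h]; rfl

theorem LocFin.mul_left {A : ι → Module.End ℂ M} (h : LocFin A) (B : Module.End ℂ M) :
    LocFin fun i => B * A i := fun x =>
  (h x).subset fun i hi => by
    rw [Function.mem_support] at hi ⊢
    intro h0
    exact hi (by rw [Module.End.mul_apply, h0, map_zero])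

theorem LocFin.mul_right {A : ι → Module.End ℂ M} (h : LocFin A) (B : Module.End ℂ M) :
    LocFin fun i => A i * B := fun x => h (B x)

theorem LocFin.smul {A : ι → Module.End ℂ M} (h : LocFin A) (c : ℂ) :
    LocFin fun i => c • A i := fun x =>
  (h x).subset fun i hi => by
    rw [Function.mem_support] at hi ⊢
    intro h0
    exact hi (by rw [LinearMap.smul_apply, h0, smul_zero])

theorem mul_locSum {A : ι → Module.End ℂ M} (h : LocFin A) (B : Module.End ℂ M) :
    B * locSum A = locSum fun i => B * A i := by
  ext x
  rw [locSum_apply (h.mul_left B), Module.End.mul_apply, locSum_apply h, map_finsum B (h x)]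
  rfl

theorem locSum_mul {A : ι → Module.End ℂ M} (h : LocFin A) (B : Module.End ℂ M) :
    locSum A * B = locSum fun i => A i * B := by
  ext x
  rw [locSum_apply (h.mul_right B), Module.End.mul_apply, locSum_apply h]
  rfl

theorem locSum_smul {A : ι → Module.End ℂ M} (h : LocFin A) (c : ℂ) :
    locSum (fun i => c • A i) = c • locSum A := by
  ext x
  rw [locSum_apply (h.smul c), LinearMap.smul_apply, locSum_apply h, smul_finsum' c (h x)]
  rfl

theorem locSum_add {A B : ι → Module.End ℂ M} (hA : LocFin A) (hB : LocFin B) :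
    locSum (fun i => A i + B i) = locSum A + locSum B := by
  have h : LocFin fun i => A i + B i := fun x =>
    ((hA x).union (hB x)).subset (Function.support_add _ _)
  ext x
  rw [locSum_apply h, LinearMap.add_apply, locSum_apply hA, locSum_apply hB,
    ← finsum_add_distrib (hA x) (hB x)]
  rfl

theorem locSum_sub {A B : ι → Module.End ℂ M} (hA : LocFin A) (hB : LocFin B) :
    locSum (fun i => A i - B i) = locSum A - locSum B := by
  have h := locSum_add hA (hB.smul (-1))
  rw [locSum_smul hB] at h
  simpa [sub_eq_add_neg] using h

theorem locSum_comp {A : κ → Module.End ℂ M} (h : LocFin A) {e : ι → κ}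
    (he : Function.Injective e) (h0 : ∀ k, k ∉ Set.range e → A k = 0) :
    (LocFin fun i => A (e i)) ∧ locSum (fun i => A (e i)) = locSum A := by
  have h' : LocFin fun i => A (e i) := fun x => (h x).preimage he.injOn
  refine ⟨h', ?_⟩
  ext x
  rw [locSum_apply h', locSum_apply h]
  exact finsum_of_injective he (f := fun k => A k x) fun k hk => by rw [h0 k hk]; rfl

/-- Coefficients of high order annihilate a given vector. -/
def LocNil (A : PowerSeries (Module.End ℂ M)) : Prop :=
  ∀ x, ∃ P : ℕ, ∀ p, P ≤ p → PowerSeries.coeff p A x = 0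

/-- Modes of very negative index annihilate a given vector. -/
def LowNil (φ : ℤ → Module.End ℂ M) : Prop := ∀ x, ∃ N : ℤ, ∀ l, l < N → φ l x = 0

/-- The coefficient of `z^m` in `B(z) φ(z) A(z⁻¹)`. -/
def dress (B : PowerSeries (Module.End ℂ M)) (φ : ℤ → Module.End ℂ M)
    (A : PowerSeries (Module.End ℂ M)) (m : ℤ) : Module.End ℂ M :=
  locSum fun p : ℕ × ℕ => PowerSeries.coeff p.2 B * φ (m + p.1 - p.2) * PowerSeries.coeff p.1 A

/-- Only finitely many `A p` act nontrivially on `x`, and for each of them `φ` kills the result once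
q is large. Plain families are used instead of power series so that the index-shifted families of
the commutator lemmas are covered too. -/
theorem finite_dress (B : ℕ → Module.End ℂ M) {φ : ℤ → Module.End ℂ M} (hφ : LowNil φ)
    {A : ℕ → Module.End ℂ M} (hA : ∀ x, ∃ P : ℕ, ∀ p, P ≤ p → A p x = 0) (m : ℤ) :
    LocFin fun p : ℕ × ℕ => B p.2 * φ (m + p.1 - p.2) * A p.1 := by
  intro x
  obtain ⟨P, hP⟩ := hA x
  choose N hN using fun p => hφ (A p x)
  refine (((range P).biUnion fun p => (range (m + p - N p + 1).toNat).image fun q => (p, q) :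
    Finset (ℕ × ℕ)).finite_toSet).subset ?_
  rintro ⟨p, q⟩ h
  rw [Function.mem_support] at h
  rw [Finset.mem_coe, mem_biUnion]
  refine ⟨p, ?_, ?_⟩
  · rw [mem_range]
    by_contra hp
    exact h (by simp [hP p (by omega)])
  · rw [mem_image]
    refine ⟨q, ?_, rfl⟩
    rw [mem_range]
    by_contra hq
    exact h (by simp [hN p (m + p - q) (by omega)])

variable {B : PowerSeries (Module.End ℂ M)} {φ : ℤ → Module.End ℂ M}
    {A : PowerSeries (Module.End ℂ M)}

theorem locFin_dress (hφ : LowNil φ) (hA : LocNil A) (m : ℤ) :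
    LocFin fun p : ℕ × ℕ => PowerSeries.coeff p.2 B * φ (m + p.1 - p.2) * PowerSeries.coeff p.1 A :=
  finite_dress (fun q => PowerSeries.coeff q B) hφ hA m

theorem dress_apply (hφ : LowNil φ) (hA : LocNil A) (m : ℤ) (x : M) : dress B φ A m x =
    ∑ᶠ p : ℕ × ℕ, PowerSeries.coeff p.2 B (φ (m + p.1 - p.2) (PowerSeries.coeff p.1 A x)) :=
  locSum_apply (locFin_dress hφ hA m) x

/-- Leibniz rule on B(z) φ(z) A(z⁻¹): commuting with the current multiplies B by b z^k and φ by f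
z^k and leaves A alone. For b = 1, f = 0 a field commuting with the currents acquires charge; for b
= -1, f = 1 the charge is removed. -/
theorem dress_commutator_pos (hφ : LowNil φ) (hA : LocNil A) {J : Module.End ℂ M} {k : ℕ}
    {b f : ℂ} (hBJ : ∀ q, J * PowerSeries.coeff q B - PowerSeries.coeff q B * J =
      if k ≤ q then b • PowerSeries.coeff (q - k) B else 0)
    (hφJ : ∀ l, J * φ l - φ l * J = f • φ (l - k))
    (hAJ : ∀ p, Commute J (PowerSeries.coeff p A)) (m : ℤ) :
    J * dress B φ A m - dress B φ A m * J = (b + f) • dress B φ A (m - k) := by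
  have h0 := locFin_dress (B := B) hφ hA m
  have h0' := locFin_dress (B := B) hφ hA (m - k)
  have h1 := finite_dress (fun q => if k ≤ q then PowerSeries.coeff (q - k) B else 0) hφ hA m
  -- The shift of the order in B by k becomes the shift of the mode index from m to m - k.
  have h2 := locSum_comp h1 (e := fun p : ℕ × ℕ => (p.1, p.2 + k))
    (fun p q h => by ext <;> simp at h <;> omega) (fun p hp => by
      rw [if_neg, zero_mul, zero_mul]
      intro hk
      exact hp ⟨(p.1, p.2 - k), by ext <;> simp [hk]⟩)
  have h3 : (fun p : ℕ × ℕ => (if k ≤ p.2 + k then PowerSeries.coeff (p.2 + k - k) B else 0) *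
      φ (m + p.1 - (p.2 + k : ℕ)) * PowerSeries.coeff p.1 A) = fun p : ℕ × ℕ =>
      PowerSeries.coeff p.2 B * φ (m - k + p.1 - p.2) * PowerSeries.coeff p.1 A := by
    funext p
    rw [if_pos (by omega), Nat.add_sub_cancel]
    congr 3
    push_cast
    ring
  rw [h3] at h2
  rw [dress, mul_locSum h0, locSum_mul h0, ← locSum_sub (h0.mul_left J) (h0.mul_right J), add_smul]
  conv_rhs => rw [dress, ← locSum_smul h0' f, h2.2, ← locSum_smul h1 b,
    ← locSum_add (h1.smul b) (h0'.smul f)]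
  congr 1
  funext p
  have e1 := hBJ p.2
  have e2 := hφJ (m + p.1 - p.2)
  have e3 := (hAJ p.1).eq
  have e4 : m + p.1 - p.2 - k = m - k + p.1 - p.2 := by ring
  rw [e4] at e2
  have e5 : b • ((if k ≤ p.2 then PowerSeries.coeff (p.2 - k) B else 0) *
      φ (m + p.1 - p.2) * PowerSeries.coeff p.1 A) =
      (J * PowerSeries.coeff p.2 B - PowerSeries.coeff p.2 B * J) * φ (m + p.1 - p.2) *
        PowerSeries.coeff p.1 A := by
    rw [e1]; split_ifs <;> simp
  have e6 : f • (PowerSeries.coeff p.2 B * φ (m - k + p.1 - p.2) * PowerSeries.coeff p.1 A) =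
      PowerSeries.coeff p.2 B * (J * φ (m + p.1 - p.2) - φ (m + p.1 - p.2) * J) *
        PowerSeries.coeff p.1 A := by
    rw [e2]; simp
  rw [e5, e6, mul_assoc _ (PowerSeries.coeff p.1 A) J, ← e3]
  noncomm_ring

/-- Mirror image: now A(z⁻¹) contributes a z^{-k} and B commutes with the current. -/
theorem dress_commutator_neg (hφ : LowNil φ) (hA : LocNil A) {J : Module.End ℂ M} {k : ℕ}
    {a f : ℂ} (hAJ : ∀ q, J * PowerSeries.coeff q A - PowerSeries.coeff q A * J =
      if k ≤ q then a • PowerSeries.coeff (q - k) A else 0)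
    (hφJ : ∀ l, J * φ l - φ l * J = f • φ (l + k))
    (hBJ : ∀ p, Commute J (PowerSeries.coeff p B)) (m : ℤ) :
    J * dress B φ A m - dress B φ A m * J = (a + f) • dress B φ A (m + k) := by
  have h0 := locFin_dress (B := B) hφ hA m
  have h0' := locFin_dress (B := B) hφ hA (m + k)
  have h1 := finite_dress (fun q => PowerSeries.coeff q B) hφ
    (A := fun q => if k ≤ q then PowerSeries.coeff (q - k) A else 0) (fun x => by
      obtain ⟨P, hP⟩ := hA x
      refine ⟨P + k, fun p hp => ?_⟩
      rw [if_pos (by omega), hP _ (by omega)]) m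
  have h2 := locSum_comp h1 (e := fun p : ℕ × ℕ => (p.1 + k, p.2))
    (fun p q h => by ext <;> simp at h <;> omega) (fun p hp => by
      rw [if_neg, mul_zero]
      intro hk
      exact hp ⟨(p.1 - k, p.2), by ext <;> simp [hk]⟩)
  have h3 : (fun p : ℕ × ℕ => PowerSeries.coeff p.2 B *
      φ (m + (p.1 + k : ℕ) - p.2) *
      (if k ≤ p.1 + k then PowerSeries.coeff (p.1 + k - k) A else 0)) = fun p : ℕ × ℕ =>
      PowerSeries.coeff p.2 B * φ (m + k + p.1 - p.2) * PowerSeries.coeff p.1 A := by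
    funext p
    rw [if_pos (by omega), Nat.add_sub_cancel]
    congr 3
    push_cast
    ring
  rw [h3] at h2
  rw [dress, mul_locSum h0, locSum_mul h0, ← locSum_sub (h0.mul_left J) (h0.mul_right J), add_smul]
  conv_rhs => rw [dress, ← locSum_smul h0' f, h2.2, ← locSum_smul h1 a,
    ← locSum_add (h1.smul a) (h0'.smul f)]
  congr 1
  funext p
  have e1 := hAJ p.1
  have e2 := hφJ (m + p.1 - p.2)
  have e3 := (hBJ p.2).eq
  have e4 : m + p.1 - p.2 + k = m + k + p.1 - p.2 := by ring
  rw [e4] at e2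
  have e5 : a • (PowerSeries.coeff p.2 B * φ (m + p.1 - p.2) *
      (if k ≤ p.1 then PowerSeries.coeff (p.1 - k) A else 0)) =
      PowerSeries.coeff p.2 B * φ (m + p.1 - p.2) *
        (J * PowerSeries.coeff p.1 A - PowerSeries.coeff p.1 A * J) := by
    rw [e1]; split_ifs <;> simp
  have e6 : f • (PowerSeries.coeff p.2 B * φ (m + k + p.1 - p.2) * PowerSeries.coeff p.1 A) =
      PowerSeries.coeff p.2 B * (J * φ (m + p.1 - p.2) - φ (m + p.1 - p.2) * J) *
        PowerSeries.coeff p.1 A := by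
    rw [e2]; simp
  rw [e5, e6, ← mul_assoc, ← mul_assoc, e3]
  noncomm_ring

end LocSum

/-! ### Polynomial superfunctions -/

abbrev Poly : Type := MvPolynomial ℕ ℂ

/-- Polynomials in the even and Grassmann times, as finitely supported families of components. -/
def SPoly : Type := Finset ℕ →₀ Poly

instance : AddCommGroup SPoly := inferInstanceAs (AddCommGroup (Finset ℕ →₀ Poly))

instance : Module ℂ SPoly := inferInstanceAs (Module ℂ (Finset ℕ →₀ Poly))

/-- The superfunction `f(t) ξ_α`. -/
def xi (α : Finset ℕ) : Poly →ₗ[ℂ] SPoly := Finsupp.lsingle α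

/-- The `ξ_α`-component. -/
def SPoly.proj (α : Finset ℕ) : SPoly →ₗ[ℂ] Poly := Finsupp.lapply α

/-- The linear map with given values on the superfunctions `f(t) ξ_α`. -/
def SPoly.lift {M : Type} [AddCommGroup M] [Module ℂ M] (F : Finset ℕ → Poly →ₗ[ℂ] M) :
    SPoly →ₗ[ℂ] M := Finsupp.lsum ℂ F

theorem SPoly.lift_xi {M : Type} [AddCommGroup M] [Module ℂ M] (F : Finset ℕ → Poly →ₗ[ℂ] M)
    (α : Finset ℕ) (f : Poly) : SPoly.lift F (xi α f) = F α f :=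
  Finsupp.lsum_single ℂ F α f

theorem SPoly.proj_xi (α β : Finset ℕ) (f : Poly) :
    SPoly.proj β (xi α f) = if α = β then f else 0 :=
  Finsupp.single_apply

theorem SPoly.ext {s s' : SPoly} (h : ∀ α, SPoly.proj α s = SPoly.proj α s') : s = s' :=
  Finsupp.ext h

theorem SPoly.hom_ext {M : Type} [AddCommGroup M] [Module ℂ M] {A B : SPoly →ₗ[ℂ] M}
    (h : ∀ α f, A (xi α f) = B (xi α f)) : A = B :=
  Finsupp.lhom_ext h

theorem SPoly.end_ext {A B : Module.End ℂ SPoly} (h : ∀ α f, A (xi α f) = B (xi α f)) : A = B :=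
  SPoly.hom_ext h

theorem SPoly.induction {p : SPoly → Prop} (h0 : p 0) (hadd : ∀ s s', p s → p s' → p (s + s'))
    (hxi : ∀ α f, p (xi α f)) (s : SPoly) : p s :=
  Finsupp.induction_linear s h0 hadd hxi

/-- An operator on polynomials in the even times, acting on all components. -/
def liftOp (A : Module.End ℂ Poly) : Module.End ℂ SPoly := SPoly.lift fun α => xi α ∘ₗ A

/-- Multiplication by the Grassmann time `t_{n+1/2}`. -/
def crea (n : ℕ) : Module.End ℂ SPoly := SPoly.lift fun α =>
  if n ∈ α then 0 else sgn n α • xi (insert n α)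

/-- The derivative with respect to the Grassmann time `t_{n+1/2}`. -/
def anni (n : ℕ) : Module.End ℂ SPoly := SPoly.lift fun α =>
  if n ∈ α then sgn n α • xi (α.erase n) else 0

theorem liftOp_xi (A : Module.End ℂ Poly) (α : Finset ℕ) (f : Poly) :
    liftOp A (xi α f) = xi α (A f) := by
  rw [liftOp, SPoly.lift_xi]; rfl

theorem proj_liftOp (A : Module.End ℂ Poly) (s : SPoly) (α : Finset ℕ) :
    SPoly.proj α (liftOp A s) = A (SPoly.proj α s) := by
  induction s using SPoly.induction with
  | h0 => simp
  | hadd s s' hs hs' => simp [hs, hs']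
  | hxi β f =>
    rw [liftOp_xi, SPoly.proj_xi, SPoly.proj_xi]
    split_ifs <;> simp

theorem crea_xi (n : ℕ) (α : Finset ℕ) (f : Poly) : crea n (xi α f) =
    if n ∈ α then 0 else sgn n α • xi (insert n α) f := by
  rw [crea, SPoly.lift_xi]
  split_ifs <;> simp

theorem anni_xi (n : ℕ) (α : Finset ℕ) (f : Poly) : anni n (xi α f) =
    if n ∈ α then sgn n α • xi (α.erase n) f else 0 := by
  rw [anni, SPoly.lift_xi]
  split_ifs <;> simp

theorem liftOp_commute_crea (A : Module.End ℂ Poly) (n : ℕ) : Commute (liftOp A) (crea n) :=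
  SPoly.end_ext fun α f => by
    simp only [Module.End.mul_apply, liftOp_xi, crea_xi]
    split_ifs <;> simp [liftOp_xi]

theorem liftOp_commute_anni (A : Module.End ℂ Poly) (n : ℕ) : Commute (liftOp A) (anni n) :=
  SPoly.end_ext fun α f => by
    simp only [Module.End.mul_apply, liftOp_xi, anni_xi]
    split_ifs <;> simp [liftOp_xi]

theorem sgn_insert {n m : ℕ} {α : Finset ℕ} (hm : m ∉ α) :
    sgn n (insert m α) = if n < m then -sgn n α else sgn n α := by
  unfold sgn
  rw [filter_insert]
  split_ifs with h
  · rw [card_insert_of_notMem (fun h' => hm (mem_filter.mp h').1), pow_succ]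
    ring
  · rfl

theorem sgn_insert_self (n : ℕ) (α : Finset ℕ) : sgn n (insert n α) = sgn n α := by
  unfold sgn
  rw [filter_insert, if_neg (lt_irrefl n)]

theorem sgn_erase_self (n : ℕ) (α : Finset ℕ) : sgn n (α.erase n) = sgn n α := by
  unfold sgn
  rw [filter_erase, erase_eq_of_notMem (by simp)]

theorem sgn_erase {n m : ℕ} {α : Finset ℕ} (hm : m ∈ α) :
    sgn n (α.erase m) = if n < m then -sgn n α else sgn n α := by
  have h := sgn_insert (n := n) (notMem_erase m α)
  rw [insert_erase hm] at h
  rw [h]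
  split_ifs <;> simp

theorem sgn_mul_self (n : ℕ) (α : Finset ℕ) : sgn n α * sgn n α = 1 := by
  unfold sgn
  rw [← mul_pow]; simp

theorem crea_crea (n m : ℕ) : crea n * crea m + crea m * crea n = 0 :=
  SPoly.end_ext fun α f => by
    simp only [LinearMap.add_apply, Module.End.mul_apply, crea_xi, LinearMap.zero_apply]
    by_cases hn : n ∈ α
    · simp only [hn, if_true, map_zero, add_zero]
      split_ifs with hm
      · simp
      · simp [crea_xi, hn]
    by_cases hm : m ∈ α
    · simp [hm, hn, crea_xi]
    simp only [hn, hm, if_false, map_smul, crea_xi, mem_insert, or_false]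
    by_cases h : n = m
    · subst h; simp
    · rw [if_neg h, if_neg (Ne.symm h), sgn_insert hn, sgn_insert hm, Finset.insert_comm, smul_smul,
        smul_smul, ← add_smul]
      rcases lt_or_gt_of_ne h with h' | h'
      · rw [if_pos h', if_neg h'.not_gt]; ring_nf; simp
      · rw [if_neg h'.not_gt, if_pos h']; ring_nf; simp

theorem anni_anni (n m : ℕ) : anni n * anni m + anni m * anni n = 0 :=
  SPoly.end_ext fun α f => by
    simp only [LinearMap.add_apply, Module.End.mul_apply, anni_xi, LinearMap.zero_apply]
    by_cases hn : n ∈ α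
    swap
    · simp only [hn, if_false, map_zero, add_zero]
      split_ifs with hm
      · simp [anni_xi, hn]
      · simp
    by_cases hm : m ∈ α
    swap
    · simp [hm, hn, anni_xi]
    simp only [hn, hm, if_true, map_smul, anni_xi, mem_erase, and_true]
    by_cases h : n = m
    · subst h; simp
    · rw [if_pos h, if_pos (Ne.symm h), sgn_erase hn, sgn_erase hm, Finset.erase_right_comm,
        smul_smul, smul_smul, ← add_smul]
      rcases lt_or_gt_of_ne h with h' | h'
      · rw [if_pos h', if_neg h'.not_gt]; ring_nf; simp
      · rw [if_neg h'.not_gt, if_pos h']; ring_nf; simp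

theorem crea_anni (n m : ℕ) : crea n * anni m + anni m * crea n = if n = m then 1 else 0 :=
  SPoly.end_ext fun α f => by
    simp only [LinearMap.add_apply, Module.End.mul_apply, anni_xi, crea_xi]
    by_cases h : n = m
    · subst h
      by_cases hn : n ∈ α
      · simp [hn, crea_xi, sgn_erase_self, insert_erase hn, smul_smul, sgn_mul_self]
      · simp [hn, anni_xi, sgn_insert_self, smul_smul, sgn_mul_self, erase_insert hn]
    · rw [if_neg h]
      by_cases hn : n ∈ α <;> by_cases hm : m ∈ α
      · simp [hn, hm, crea_xi, h]
      · simp [hn, hm]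
      · simp only [hn, hm, if_true, if_false, map_smul, crea_xi, anni_xi, mem_erase,
          mem_insert, and_false, or_true, LinearMap.zero_apply]
        rw [sgn_erase hm, sgn_insert hn, erase_insert_of_ne h, smul_smul, smul_smul, ← add_smul]
        rcases lt_or_gt_of_ne h with h' | h'
        · rw [if_pos h', if_neg h'.not_gt]; ring_nf; simp
        · rw [if_neg h'.not_gt, if_pos h']; ring_nf; simp
      · simp [hn, hm, anni_xi, Ne.symm h]

/-- The modes of the fermionic field, `theta l` being the coefficient of `z^l`. -/
def theta : ℤ → Module.End ℂ SPoly
  | Int.ofNat n => (2 : ℂ) • crea n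
  | Int.negSucc n => ((-1) ^ n * ((2 * n + 1) / 2) : ℂ) • anni n

/-- The weight 2a + 1 makes the anticommutator a first derivative of a delta function at z = -w;
this is exactly the form that `sum_antisymm` needs to produce boson commutators. -/
theorem theta_anticomm (a b : ℤ) : theta a * theta b + theta b * theta a =
    if a + b = -1 then ((-1) ^ a * (2 * a + 1) : ℂ) • 1 else 0 := by
  rcases a with n | n <;> rcases b with m | m
  · rw [if_neg (by simp; omega)]
    simp only [theta, smul_mul_smul_comm]
    rw [← smul_add, crea_crea, smul_zero]
  · simp only [theta, smul_mul_smul_comm]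
    rw [mul_comm _ (2 : ℂ), ← smul_add, crea_anni]
    by_cases h : n = m
    · subst h
      rw [if_pos rfl, if_pos (by rw [Int.negSucc_eq]; simp)]
      congr 1
      simp
      ring
    · rw [if_neg h, if_neg (by rw [Int.negSucc_eq]; simp; omega), smul_zero]
  · simp only [theta, smul_mul_smul_comm]
    rw [mul_comm _ (2 : ℂ), ← smul_add, add_comm (anni n * crea m), crea_anni]
    by_cases h : n = m
    · subst h
      rw [if_pos rfl, if_pos (by rw [Int.negSucc_eq]; simp)]
      congr 1
      rw [zpow_negSucc, pow_succ]
      have : ((-1 : ℂ) ^ n * -1)⁻¹ = -(-1) ^ n := by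
        rcases neg_one_pow_eq_or ℂ n with h | h <;> rw [h] <;> norm_num
      rw [this, Int.negSucc_eq]
      push_cast
      ring
    · rw [if_neg (Ne.symm h), if_neg (by rw [Int.negSucc_eq]; simp; omega), smul_zero]
  · rw [if_neg (by rw [Int.negSucc_eq, Int.negSucc_eq]; omega)]
    simp only [theta, smul_mul_smul_comm]
    rw [mul_comm, ← smul_add, anni_anni, smul_zero]

theorem liftOp_commute_theta (A : Module.End ℂ Poly) (l : ℤ) : Commute (liftOp A) (theta l) := by
  rcases l with n | n
  · exact (liftOp_commute_crea A n).smul_right _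
  · exact (liftOp_commute_anni A n).smul_right _

theorem lowNil_theta : LowNil theta := by
  intro x
  induction x using SPoly.induction with
  | h0 => exact ⟨0, fun l _ => map_zero _⟩
  | hadd f g hf hg =>
    obtain ⟨N, hN⟩ := hf
    obtain ⟨N', hN'⟩ := hg
    refine ⟨min N N', fun l hl => ?_⟩
    rw [map_add, hN l (by omega), hN' l (by omega), add_zero]
  | hxi α f =>
    refine ⟨-(α.sup id : ℕ) - 1, fun l hl => ?_⟩
    rcases l with n | n
    · exact absurd hl (by simp; omega)
    · rw [theta, LinearMap.smul_apply, anni_xi, if_neg, smul_zero]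
      intro hn
      have : n ≤ α.sup id := Finset.le_sup (f := id) hn
      rw [Int.negSucc_eq] at hl
      omega

/-- The current `J_k`, `k > 0` odd, on polynomial superfunctions. -/
def Jpos (k : ℕ) : Module.End ℂ SPoly :=
  (k / 2 : ℂ) • liftOp (MvPolynomial.pderiv (k / 2) : Derivation ℂ Poly Poly).toLinearMap

/-- The current `J_{-k}`, `k > 0` odd, on polynomial superfunctions. -/
def Jneg (k : ℕ) : Module.End ℂ SPoly :=
  -liftOp (LinearMap.mulLeft ℂ (MvPolynomial.X (k / 2) : Poly))

theorem Jpos_xi (k : ℕ) (α : Finset ℕ) (f : Poly) : Jpos k (xi α f) =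
    (k / 2 : ℂ) • xi α (MvPolynomial.pderiv (k / 2) f) := by
  rw [Jpos, LinearMap.smul_apply, liftOp_xi]; rfl

theorem Jneg_xi (k : ℕ) (α : Finset ℕ) (f : Poly) : Jneg k (xi α f) =
    -xi α (MvPolynomial.X (k / 2) * f) := by
  rw [Jneg, LinearMap.neg_apply, liftOp_xi]; rfl

/-! ### Heisenberg relations of the currents on superfunctions -/

theorem pderiv_comm (i j : ℕ) (f : Poly) : MvPolynomial.pderiv i (MvPolynomial.pderiv j f) =
    MvPolynomial.pderiv j (MvPolynomial.pderiv i f) := by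
  have h : ⁅(MvPolynomial.pderiv i : Derivation ℂ Poly Poly),
      (MvPolynomial.pderiv j : Derivation ℂ Poly Poly)⁆ = 0 := by
    refine MvPolynomial.derivation_ext fun k => ?_
    rw [Derivation.commutator_apply]
    rw [MvPolynomial.pderiv_X, MvPolynomial.pderiv_X, Pi.single_apply, Pi.single_apply]
    split_ifs <;> simp
  have := congrArg (fun D => D f) h
  rw [Derivation.commutator_apply] at this
  exact sub_eq_zero.mp this

theorem Jpos_commute (i j : ℕ) : Commute (Jpos i) (Jpos j) :=
  SPoly.end_ext fun α f => by
    simp only [Module.End.mul_apply, Jpos_xi, map_smul]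
    rw [smul_comm, pderiv_comm]

theorem Jneg_commute (i j : ℕ) : Commute (Jneg i) (Jneg j) :=
  SPoly.end_ext fun α f => by
    simp only [Module.End.mul_apply, Jneg_xi, map_neg]
    rw [mul_left_comm]

theorem Jpos_Jneg {i j : ℕ} (hi : Odd i) (hj : Odd j) : Jpos i * Jneg j - Jneg j * Jpos i =
    if j = i then (-(i / 2) : ℂ) • 1 else 0 :=
  SPoly.end_ext fun α f => by
    simp only [LinearMap.sub_apply, Module.End.mul_apply, Jneg_xi, Jpos_xi, map_neg,
      map_smul, Derivation.leibniz, MvPolynomial.pderiv_X]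
    by_cases h : j = i
    · subst h
      simp
    · have : j / 2 ≠ i / 2 := by
        rcases hi with ⟨a, rfl⟩; rcases hj with ⟨b, rfl⟩; omega
      simp [h, this]

theorem Jneg_Jpos {i j : ℕ} (hi : Odd i) (hj : Odd j) : Jneg i * Jpos j - Jpos j * Jneg i =
    if j = i then (i / 2 : ℂ) • 1 else 0 := by
  rw [← neg_sub (Jpos j * Jneg i), Jpos_Jneg hj hi]
  by_cases h : j = i
  · subst h
    refine SPoly.end_ext fun α f => ?_
    simp [neg_smul]
  · simp [h, Ne.symm h]

/-- The specialisation `t = 0` of the even times. -/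
def evalZero : Module.End ℂ SPoly :=
  liftOp (Algebra.linearMap ℂ Poly ∘ₗ MvPolynomial.lcoeff ℂ (0 : ℕ →₀ ℕ))

theorem evalZero_xi (α : Finset ℕ) (f : Poly) : evalZero (xi α f) =
    xi α (MvPolynomial.C (MvPolynomial.coeff 0 f)) := by
  rw [evalZero, liftOp_xi]; rfl

theorem evalZero_mul_Jneg (k : ℕ) : evalZero * Jneg k = 0 :=
  SPoly.end_ext fun α f => by
    rw [Module.End.mul_apply, Jneg_xi, map_neg, evalZero_xi]
    simp [MvPolynomial.coeff_X_mul']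

theorem evalZero_commute_theta (l : ℤ) : Commute evalZero (theta l) := liftOp_commute_theta _ l

theorem Jpos_one (k : ℕ) (α : Finset ℕ) : Jpos k (xi α 1) = 0 := by
  rw [Jpos_xi]; simp

/-- A subspace of polynomial superfunctions that is stable under the derivatives and consists of
functions vanishing at `t = 0` is trivial. -/
theorem eq_zero_of_evalZero {Z : Set SPoly} (hZ : ∀ z ∈ Z, ∀ k, Odd k → Jpos k z ∈ Z)
    (h0 : ∀ z ∈ Z, evalZero z = 0) {z : SPoly} (hz : z ∈ Z) : z = 0 := by
  suffices h : ∀ (a : ℕ →₀ ℕ), ∀ z ∈ Z, ∀ α, MvPolynomial.coeff a (SPoly.proj α z) = 0 by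
    refine SPoly.ext fun α => ?_
    rw [map_zero]
    ext a
    exact h a z hz α
  intro a
  obtain ⟨d, hd⟩ : ∃ d, d = a.degree := ⟨_, rfl⟩
  induction d generalizing a with
  | zero =>
    intro z hz α
    have ha : a = 0 := (Finsupp.degree_eq_zero_iff a).mp hd.symm
    have h := congrArg (fun s : SPoly => MvPolynomial.coeff 0 (SPoly.proj α s)) (h0 z hz)
    rw [evalZero] at h
    simpa [proj_liftOp, ha] using h
  | succ d ih =>
    intro z hz α
    have ha : a ≠ 0 := by rintro rfl; simp at hd
    obtain ⟨n, hn⟩ := Finsupp.support_nonempty_iff.mpr ha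
    rw [Finsupp.mem_support_iff] at hn
    have hle : Finsupp.single n 1 ≤ a := by
      rw [Finsupp.single_le_iff]; omega
    obtain ⟨b, rfl⟩ := exists_add_of_le hle
    rw [add_comm] at hd ⊢
    -- Taylor expansion at t = 0: up to a nonzero factor the coefficient of z at b + e_n is the
    -- coefficient at b of J_{2n+1} z, and that function again lies in Z.
    have h := ih b (by simp at hd; omega) _ (hZ z hz (2 * n + 1) ⟨n, rfl⟩) α
    have h3 : (2 * n + 1) / 2 = n := by omega
    rw [Jpos, LinearMap.smul_apply, map_smul, proj_liftOp, h3] at h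
    simp only [Derivation.coeFn_coe, MvPolynomial.coeff_smul, MvPolynomial.coeff_pderiv,
      smul_eq_mul] at h
    have h4 : ((2 * n + 1 : ℕ) / 2 : ℂ) ≠ 0 := by
      have : ((2 * n + 1 : ℕ) : ℂ) ≠ 0 := by exact_mod_cast Nat.succ_ne_zero (2 * n)
      exact div_ne_zero this two_ne_zero
    have h5 : ((b n : ℂ) + 1) ≠ 0 := by exact_mod_cast Nat.succ_ne_zero (b n)
    exact (mul_eq_zero.mp ((mul_eq_zero.mp h).resolve_left h4)).resolve_right h5

/-- An operator is zero if its iterated commutators with the currents have no component mapping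
functions of the Grassmann times to functions of the Grassmann times. -/
theorem eq_zero_of_currents {X : Set (Module.End ℂ SPoly)}
    (hpos : ∀ A ∈ X, ∀ k, Odd k → Jpos k * A - A * Jpos k ∈ X)
    (hneg : ∀ A ∈ X, ∀ k, Odd k → Jneg k * A - A * Jneg k ∈ X)
    (h0 : ∀ A ∈ X, ∀ α, evalZero (A (xi α 1)) = 0) {A : Module.End ℂ SPoly}
    (hA : A ∈ X) : A = 0 := by
  have h1 : ∀ A ∈ X, ∀ α, A (xi α 1) = 0 := by
    intro A hA α
    -- Since J_k kills ξ_α, J_k A ξ_α is the commutator applied to ξ_α; so the images of ξ_α under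
    -- the members of X are stable under the derivatives.
    refine eq_zero_of_evalZero (Z := {z | ∃ A ∈ X, z = A (xi α 1)}) ?_ ?_ ⟨A, hA, rfl⟩
    · rintro _ ⟨A, hA, rfl⟩ k hk
      refine ⟨_, hpos A hA k hk, ?_⟩
      rw [LinearMap.sub_apply, Module.End.mul_apply, Module.End.mul_apply, Jpos_one, map_zero,
        sub_zero]
    · rintro _ ⟨A, hA, rfl⟩
      exact h0 A hA α
  refine SPoly.end_ext fun α f => ?_
  rw [LinearMap.zero_apply]
  suffices h : ∀ A ∈ X, A (xi α f) = 0 from h A hA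
  induction f using MvPolynomial.induction_on with
  | C a =>
    intro A hA
    have : xi α (MvPolynomial.C a : Poly) = a • xi α 1 := by
      rw [← map_smul, MvPolynomial.smul_eq_C_mul, mul_one]
    rw [this, map_smul, h1 A hA, smul_zero]
  | add p q hp hq =>
    intro A hA
    rw [map_add, map_add, hp A hA, hq A hA, add_zero]
  | mul_X p n hp =>
    intro A hA
    -- The commutator with J_{-(2n+1)} is again in X and vanishes on ξ_α p, so A can be moved past
    -- the multiplication by the n-th time.
    have h2 := hp _ (hneg A hA (2 * n + 1) ⟨n, rfl⟩)
    have h3 : (2 * n + 1) / 2 = n := by omega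
    rw [LinearMap.sub_apply, Module.End.mul_apply, Module.End.mul_apply, hp A hA, Jneg_xi,
      map_zero, zero_sub, map_neg, neg_neg, h3, mul_comm] at h2
    exact h2

/-! ### The bosonic field on polynomial superfunctions -/

theorem finsum_nat_succ {M : Type*} [AddCommMonoid M] {f : ℕ → M} {K : ℕ}
    (hf : ∀ p, K ≤ p → f p = 0) : ∑ᶠ p, f p = f 0 + ∑ᶠ p, f (p + 1) := by
  have h1 : Function.support f ⊆ (range (K + 1) : Finset ℕ) := fun p hp => by
    rw [Finset.mem_coe, mem_range]
    by_contra h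
    exact hp (hf p (by omega))
  have h2 : (Function.support fun p => f (p + 1)) ⊆ (range K : Finset ℕ) := fun p hp => by
    rw [Finset.mem_coe, mem_range]
    by_contra h
    exact hp (hf (p + 1) (by omega))
  rw [finsum_eq_sum_of_support_subset _ h1, finsum_eq_sum_of_support_subset _ h2,
    Finset.sum_range_succ', add_comm]

/-- The coefficients of `(1 + x) / (1 - x)`. -/
def cayley (p : ℕ) : ℂ := if p = 0 then 1 else 2

/-- Coefficient of x^p in x/(1-x²) · (1+x)/(1-x) = x/(1-x)². With the Euler recursion this
identifies exp ∑ (2/k) x^k, over odd k, with (1+x)/(1-x). -/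
theorem sum_cayley (p : ℕ) :
    ∑ q ∈ antidiagonal p, (if Odd q.1 then cayley q.2 else 0) = p := by
  rw [← sum_antidiagonal_swap p fun i j => if Odd i then cayley j else 0,
    Finset.Nat.sum_antidiagonal_eq_sum_range_succ fun j i => if Odd i then cayley j else 0]
  induction p using Nat.twoStepInduction with
  | zero => simp
  | one => simp [Finset.sum_range_succ, cayley]
  | more p ih _ =>
    rw [Finset.sum_range_succ, Finset.sum_range_succ]
    have h : ∀ j ∈ range (p + 1), (if Odd (p + 2 - j) then cayley j else 0) =
        if Odd (p - j) then cayley j else 0 := by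
      intro j hj
      rw [mem_range] at hj
      have : p + 2 - j = p - j + 2 := by omega
      rw [this]
      congr 1
      simp [Nat.odd_add]
    rw [Finset.sum_congr rfl h, ih]
    have h1 : p + 2 - (p + 1) = 1 := by omega
    simp [h1, cayley]

/-- The modes of a fermionic bilinear, antisymmetrised. -/
theorem sum_antisymm {M : Type} [AddCommGroup M] [Module ℂ M] {F : ℤ → M} {x : M} {s N : ℤ}
    (hN : ∀ a, N ≤ a → F a = 0)
    (hF : ∀ a, F a + F (s - a) = (if s = -1 then ((-1) ^ a * (2 * a + 1) : ℂ) else 0) • x)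
    (m : ℤ) : (∑ᶠ p : ℕ, cayley p • F (m + p)) - ∑ᶠ p : ℕ, cayley p • F (s - m + p) =
      (if s = -1 then (-1 : ℂ) ^ (s - m) else 0) • x := by
  obtain ⟨G, hG⟩ : ∃ G : ℤ → M, G = fun m => ∑ᶠ p : ℕ, cayley p • F (m + p) := ⟨_, rfl⟩
  obtain ⟨T, hT⟩ : ∃ T : ℤ → M, T = fun m => ∑ᶠ p : ℕ, F (m + p) := ⟨_, rfl⟩
  have hT1 : ∀ m, T m = F m + T (m + 1) := by
    intro m
    rw [hT]
    simp only
    rw [finsum_nat_succ (K := (N - m).toNat) fun p hp => hN _ (by omega)]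
    simp [add_comm, add_left_comm]
  have hG1 : ∀ m, G m = F m + (2 : ℂ) • T (m + 1) := by
    intro m
    rw [hG, hT]
    simp only
    rw [finsum_nat_succ (K := (N - m).toNat) fun p hp => by rw [hN _ (by omega), smul_zero],
      smul_finsum']
    · simp [cayley, add_comm, add_left_comm]
    · refine (range (N - m).toNat).finite_toSet.subset fun p hp => ?_
      rw [Finset.mem_coe, mem_range]
      by_contra h
      exact hp (hN _ (by omega))
  -- The identity (1-x) · (1+x)/(1-x) = 1 + x in coefficients.
  have hG2 : ∀ m, G m - G (m + 1) = F m + F (m + 1) := by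
    intro m
    rw [hG1 m, hG1 (m + 1), hT1 (m + 1), smul_add, two_smul ℂ (F (m + 1))]
    abel
  obtain ⟨ε, hε⟩ : ∃ ε : ℤ → ℂ, ε = fun m => if s = -1 then (-1 : ℂ) ^ (s - m) else 0 := ⟨_, rfl⟩
  have hsucc : ∀ m : ℤ, (-1 : ℂ) ^ (m + 1) = -(-1) ^ m := by
    intro m; rw [zpow_add₀ (by norm_num)]; simp
  have hε1 : ∀ m, ε (s - m) = -ε m := by
    intro m
    rw [hε]
    simp only
    split_ifs with h
    · subst h
      have h1 : (-1 : ℤ) - m = -(m + 1) := by ring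
      have h2 : (-1 : ℤ) - (-1 - m) = m := by ring
      rw [h2, h1, zpow_neg, hsucc]
      rcases Int.even_or_odd m with h | h
      · rw [h.neg_one_zpow]; norm_num
      · rw [h.neg_one_zpow]; norm_num
    · simp
  have hε2 : ∀ m : ℤ, s = -1 → ε m = -(-1) ^ m := by
    intro m h
    have := hε1 m
    rw [hε] at this ⊢
    simp only [h, if_true] at this ⊢
    have h2 : (-1 : ℤ) - (-1 - m) = m := by ring
    rw [h2] at this
    rw [this, neg_neg]
  -- H is the defect of the claim. It changes sign under m ↦ s - m, and it is constant in m because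
  -- both the sums and the sign ε have the same consecutive differences; hence it vanishes.
  obtain ⟨H, hH⟩ : ∃ H : ℤ → M, H = fun m => G m - G (s - m) - ε m • x := ⟨_, rfl⟩
  have hH1 : ∀ m, H (s - m) = -H m := by
    intro m
    rw [hH]
    simp only
    rw [sub_sub_cancel, hε1, neg_smul]
    abel
  have hH2 : ∀ m, H m = H (m + 1) := by
    intro m
    have h1 := hG2 m
    have h2 := hG2 (s - (m + 1))
    have e : s - (m + 1) + 1 = s - m := by ring
    rw [e] at h2
    have h3 := hF m
    have h4 := hF (m + 1)
    rw [← sub_eq_zero, hH]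
    simp only
    have : G m - G (s - m) - ε m • x - (G (m + 1) - G (s - (m + 1)) - ε (m + 1) • x) =
        (F m + F (s - m)) + (F (m + 1) + F (s - (m + 1))) - (ε m - ε (m + 1)) • x := by
      rw [sub_smul]
      have e1 : G m = F m + F (m + 1) + G (m + 1) := by rw [← h1]; abel
      have e2 : G (s - (m + 1)) = F (s - (m + 1)) + F (s - m) + G (s - m) := by rw [← h2]; abel
      rw [e1, e2]
      abel
    rw [this, h3, h4, ← add_smul, ← sub_smul]
    by_cases hs : s = -1
    · rw [if_pos hs, if_pos hs, hε2 m hs, hε2 (m + 1) hs, hsucc]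
      push_cast
      ring_nf
      simp
    · rw [if_neg hs, if_neg hs, hε]
      simp [hs]
  have hH3 : ∀ m, H m = H 0 := by
    intro m
    induction m using Int.induction_on with
    | zero => rfl
    | succ i ih => rw [← hH2, ih]
    | pred i ih => rw [hH2, ← ih]; congr 1; ring
  have hH4 : H m = 0 := by
    have h1 := hH1 m
    rw [hH3 (s - m), hH3 m] at h1
    rw [hH3 m]
    have h2 : (2 : ℂ) • H 0 = 0 := by
      rw [two_smul]
      nth_rewrite 1 [h1]
      simp
    exact (smul_eq_zero.mp h2).resolve_left two_ne_zero
  rw [hH, sub_eq_zero, hε, hG] at hH4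
  exact hH4

/-! ### Vertex operators on vectors killed by the currents, and local nilpotency -/

section
variable {M : Type} [AddCommGroup M] [Module ℂ M]

/-- In the Euler recursion the current can be moved to the right, where it kills `x`. -/
theorem vop_apply_eq_zero {c : ℂ} {J : ℕ → Module.End ℂ M}
    (hJ : ∀ i j, Odd i → Odd j → Commute (J i) (J j)) {x : M} (hx : ∀ i, Odd i → J i x = 0) {p : ℕ}
    (hp : p ≠ 0) : PowerSeries.coeff p (vop c J) x = 0 := by
  have h := congrArg (fun A : Module.End ℂ M => A x) (vop_euler (c := c) hJ p)
  simp only [LinearMap.smul_apply, LinearMap.sum_apply] at h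
  rw [Finset.sum_eq_zero] at h
  · exact (smul_eq_zero.mp h).resolve_left (by exact_mod_cast hp)
  · intro q _
    split_ifs with hq
    · rw [(vop_commute (c := c) (fun i hi => hJ q.1 i hq hi) q.2).eq, LinearMap.smul_apply,
        Module.End.mul_apply, hx _ hq, map_zero, smul_zero]
    · rfl

theorem mul_vop_eq_zero {c : ℂ} {J : ℕ → Module.End ℂ M}
    (hJ : ∀ i j, Odd i → Odd j → Commute (J i) (J j)) {P : Module.End ℂ M}
    (hx : ∀ i, Odd i → P * J i = 0) {p : ℕ} (hp : p ≠ 0) :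
    P * PowerSeries.coeff p (vop c J) = 0 := by
  have h := congrArg (fun A : Module.End ℂ M => P * A) (vop_euler (c := c) hJ p)
  simp only [mul_smul_comm, Finset.mul_sum] at h
  rw [Finset.sum_eq_zero] at h
  · exact (smul_eq_zero.mp h).resolve_left (by exact_mod_cast hp)
  · intro q _
    split_ifs with hq
    · rw [mul_smul_comm, ← mul_assoc, hx _ hq, zero_mul, smul_zero]
    · rw [mul_zero]

theorem lowNil_dress {B : PowerSeries (Module.End ℂ M)} {φ : ℤ → Module.End ℂ M}
    {A : PowerSeries (Module.End ℂ M)} (hφ : LowNil φ) (hA : LocNil A) :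
    LowNil (dress B φ A) := by
  intro x
  obtain ⟨P, hP⟩ := hA x
  choose N hN using fun p => hφ (PowerSeries.coeff p A x)
  obtain ⟨K, hK⟩ : ∃ K : ℤ, ∀ p < P, K ≤ N p - p := by
    induction P with
    | zero => exact ⟨0, fun p hp => absurd hp (by omega)⟩
    | succ P _ =>
      refine ⟨(range (P + 1)).inf' (by simp) fun p => N p - p, fun p hp => ?_⟩
      exact Finset.inf'_le _ (mem_range.mpr hp)
  refine ⟨K, fun l hl => ?_⟩
  rw [dress_apply hφ hA]
  refine finsum_eq_zero_of_forall_eq_zero fun p => ?_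
  by_cases hp : p.1 < P
  · have := hK p.1 hp
    rw [hN p.1 _ (by omega), map_zero]
  · rw [hP p.1 (by omega), map_zero, map_zero]

end

/-- Multiplication by the n-th time is -J_{-(2n+1)}, and commuting it with V_+ shifts the order by
2n + 1; so each further variable raises the bound by 2n + 1. -/
theorem locNil_vop_Jpos (c : ℂ) : LocNil (vop c Jpos) := by
  intro x
  induction x using SPoly.induction with
  | h0 => exact ⟨0, fun l _ => map_zero _⟩
  | hadd f g hf hg =>
    obtain ⟨N, hN⟩ := hf
    obtain ⟨N', hN'⟩ := hg
    refine ⟨max N N', fun l hl => ?_⟩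
    rw [map_add, hN l (by omega), hN' l (by omega), add_zero]
  | hxi α f =>
    induction f using MvPolynomial.induction_on with
    | C a =>
      refine ⟨1, fun p hp => vop_apply_eq_zero (fun i j _ _ => Jpos_commute i j) (fun i _ => ?_)
        (by omega)⟩
      rw [Jpos_xi]; simp
    | add f g hf hg =>
      obtain ⟨N, hN⟩ := hf
      obtain ⟨N', hN'⟩ := hg
      refine ⟨max N N', fun l hl => ?_⟩
      rw [map_add, map_add, hN l (by omega), hN' l (by omega), add_zero]
    | mul_X f n hf =>
      obtain ⟨N, hN⟩ := hf
      have hk : Odd (2 * n + 1) := ⟨n, rfl⟩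
      refine ⟨N + (2 * n + 1), fun p hp => ?_⟩
      have h := congrArg (fun A : Module.End ℂ SPoly => A (xi α f))
        (vop_commutator (c := c) hk (fun i hi => Jneg_Jpos hk hi) p)
      have h3 : (2 * n + 1) / 2 = n := by omega
      simp only [LinearMap.sub_apply, Module.End.mul_apply] at h
      rw [hN p (by omega), map_zero, zero_sub, Jneg_xi, map_neg, neg_neg, h3, mul_comm,
        if_pos (by omega), LinearMap.smul_apply, hN _ (by omega), smul_zero] at h
      exact h

/-- The modes of the bosonic field, `Phi m` being the coefficient of `z^m`. -/
def Phi : ℤ → Module.End ℂ SPoly := dress (vop (-2) Jneg) theta (vop 2 Jpos)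

theorem lowNil_Phi : LowNil Phi := lowNil_dress lowNil_theta (locNil_vop_Jpos 2)

theorem Jpos_commute_theta (k : ℕ) (l : ℤ) : Commute (Jpos k) (theta l) :=
  (liftOp_commute_theta _ l).smul_left _

theorem Jneg_commute_theta (k : ℕ) (l : ℤ) : Commute (Jneg k) (theta l) :=
  (liftOp_commute_theta _ l).neg_left

theorem Jpos_vop_Jneg {k : ℕ} (hk : Odd k) (c : ℂ) (q : ℕ) :
    Jpos k * PowerSeries.coeff q (vop c Jneg) - PowerSeries.coeff q (vop c Jneg) * Jpos k =
      if k ≤ q then (-(c / 2)) • PowerSeries.coeff (q - k) (vop c Jneg) else 0 := by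
  rw [vop_commutator hk fun i hi => Jpos_Jneg hk hi]
  have : (k : ℂ) ≠ 0 := by exact_mod_cast hk.pos.ne'
  congr 2
  field_simp

theorem Jneg_vop_Jpos {k : ℕ} (hk : Odd k) (c : ℂ) (q : ℕ) :
    Jneg k * PowerSeries.coeff q (vop c Jpos) - PowerSeries.coeff q (vop c Jpos) * Jneg k =
      if k ≤ q then (c / 2) • PowerSeries.coeff (q - k) (vop c Jpos) else 0 := by
  rw [vop_commutator hk fun i hi => Jneg_Jpos hk hi]
  have : (k : ℂ) ≠ 0 := by exact_mod_cast hk.pos.ne'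
  congr 2
  field_simp

/-- The fermion commutes with the currents, so the charge of Φ comes from V_- alone. Together with
`Jneg_Phi` this reproduces, up to the sign of J_{-k}, the relations `JD_psi` of the free boson. -/
theorem Jpos_Phi {k : ℕ} (hk : Odd k) (m : ℤ) :
    Jpos k * Phi m - Phi m * Jpos k = Phi (m - k) := by
  have h := dress_commutator_pos (B := vop (-2) Jneg) lowNil_theta (locNil_vop_Jpos 2)
    (Jpos_vop_Jneg hk (-2)) (f := 0)
    (fun l => by rw [(Jpos_commute_theta k l).eq]; simp)
    (fun p => vop_commute (fun i _ => Jpos_commute k i) p) m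
  rw [Phi, h]
  norm_num

theorem Jneg_Phi {k : ℕ} (hk : Odd k) (m : ℤ) :
    Jneg k * Phi m - Phi m * Jneg k = Phi (m + k) := by
  have h := dress_commutator_neg (B := vop (-2) Jneg) lowNil_theta (locNil_vop_Jpos 2)
    (Jneg_vop_Jpos hk 2) (f := 0)
    (fun l => by rw [(Jneg_commute_theta k l).eq]; simp)
    (fun p => vop_commute (fun i _ => Jneg_commute k i) p) m
  rw [Phi, h]
  norm_num

/-- The matrix elements of `V_+(z) V_-(w)` between functions of the Grassmann times. -/
theorem evalZero_vop_vop {x : SPoly} (hx : ∀ i, Odd i → Jpos i x = 0) (hx' : evalZero x = x)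
    (p q : ℕ) : evalZero (PowerSeries.coeff p (vop 2 Jpos) (PowerSeries.coeff q (vop (-2) Jneg) x)) =
      if p = q then cayley p • x else 0 := by
  induction p using Nat.strong_induction_on generalizing q with
  | _ p ih =>
  by_cases hp : p = 0
  · subst hp
    rw [coeff_zero_vop, Module.End.one_apply]
    by_cases hq : 0 = q
    · subst hq
      rw [coeff_zero_vop, Module.End.one_apply, hx']
      simp [cayley]
    · rw [if_neg hq, ← Module.End.mul_apply,
        mul_vop_eq_zero (fun i j _ _ => Jneg_commute i j) (fun i _ => evalZero_mul_Jneg i)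
          (Ne.symm hq)]
      rfl
  -- Euler recursion for V_+: each current in it commutes with V_+, is moved right onto V_-, lowers
  -- the order of V_- and kills x.
  · have h := congrArg (fun A : Module.End ℂ SPoly =>
      evalZero (A (PowerSeries.coeff q (vop (-2) Jneg) x)))
      (vop_euler (c := 2) (J := Jpos) (fun i j _ _ => Jpos_commute i j) p)
    simp only [LinearMap.smul_apply, LinearMap.sum_apply, map_sum, map_smul] at h
    have key : ∀ r ∈ antidiagonal p, evalZero ((if Odd r.1 then
        (2 : ℂ) • (Jpos r.1 * PowerSeries.coeff r.2 (vop 2 Jpos)) else 0)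
          (PowerSeries.coeff q (vop (-2) Jneg) x)) =
        if p = q then ((2 : ℂ) * if Odd r.1 then cayley r.2 else 0) • x else 0 := by
      intro r hr
      rw [HasAntidiagonal.mem_antidiagonal] at hr
      by_cases hr1 : Odd r.1
      · have hpos := hr1.pos
        have e := congrArg (fun A : Module.End ℂ SPoly => A x) (Jpos_vop_Jneg hr1 (-2) q)
        simp only [LinearMap.sub_apply, Module.End.mul_apply, hx _ hr1, map_zero, sub_zero] at e
        rw [if_pos hr1, if_pos hr1,
          (vop_commute (c := 2) (fun i _ => Jpos_commute r.1 i) r.2).eq,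
          LinearMap.smul_apply, Module.End.mul_apply, e, map_smul]
        by_cases hq : r.1 ≤ q
        · rw [if_pos hq, LinearMap.smul_apply, map_smul, map_smul, ih r.2 (by omega)]
          by_cases hpq : p = q
          · rw [if_pos hpq, if_pos (by omega), smul_smul, smul_smul]
            norm_num
          · rw [if_neg hpq, if_neg (by omega), smul_zero, smul_zero]
        · rw [if_neg hq, if_neg (by omega)]
          simp
      · rw [if_neg hr1, if_neg hr1]
        simp
    rw [Finset.sum_congr rfl key] at h
    have hp' : (p : ℂ) ≠ 0 := by exact_mod_cast hp
    by_cases hpq : p = q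
    · simp only [if_pos hpq] at h ⊢
      rw [← Finset.sum_smul, ← Finset.mul_sum, sum_cayley, mul_comm, mul_smul] at h
      have := smul_right_injective _ hp' h
      rw [this, cayley, if_neg hp]
    · simp only [if_neg hpq, Finset.sum_const_zero] at h ⊢
      exact (smul_eq_zero.mp h).resolve_left hp'

theorem Jpos_theta_xi_one (k : ℕ) (l : ℤ) (α : Finset ℕ) : Jpos k (theta l (xi α 1)) = 0 := by
  rw [← Module.End.mul_apply, (Jpos_commute_theta k l).eq, Module.End.mul_apply, Jpos_one, map_zero]

theorem evalZero_xi_one (α : Finset ℕ) : evalZero (xi α 1) = xi α 1 := by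
  rw [evalZero_xi]; simp

theorem evalZero_theta_xi_one (l : ℤ) (α : Finset ℕ) :
    evalZero (theta l (xi α 1)) = theta l (xi α 1) := by
  rw [← Module.End.mul_apply, (evalZero_commute_theta l).eq, Module.End.mul_apply, evalZero_xi_one]

/-- On vectors annihilated by the positive currents only the negative half of the dressing acts. -/
theorem dress_apply_vacuum {B : PowerSeries (Module.End ℂ SPoly)} {φ : ℤ → Module.End ℂ SPoly}
    (hφ : LowNil φ) (c : ℂ) (m : ℤ) {x : SPoly} (hx : ∀ i, Odd i → Jpos i x = 0) :
    dress B φ (vop c Jpos) m x = ∑ᶠ q : ℕ, PowerSeries.coeff q B (φ (m - q) x) := by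
  rw [dress_apply hφ (locNil_vop_Jpos c)]
  symm
  have h := finsum_of_injective (e := fun q : ℕ => ((0, q) : ℕ × ℕ))
    (fun p q h => by simpa using h)
    (f := fun p : ℕ × ℕ => PowerSeries.coeff p.2 B (φ (m + p.1 - p.2)
      (PowerSeries.coeff p.1 (vop c Jpos) x))) (fun p hp => by
      have h0 : p.1 ≠ 0 := fun h => hp ⟨p.2, by rw [← h]⟩
      rw [vop_apply_eq_zero (fun i j _ _ => Jpos_commute i j) hx h0, map_zero, map_zero])
  rw [← h]
  simp [coeff_zero_vop]

/-- At `t = 0` only the positive half of the dressing acts. -/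
theorem evalZero_dress {A : PowerSeries (Module.End ℂ SPoly)} {φ : ℤ → Module.End ℂ SPoly}
    (hφ : LowNil φ) (hA : LocNil A) (c : ℂ) (m : ℤ) (x : SPoly) :
    evalZero (dress (vop c Jneg) φ A m x) =
      ∑ᶠ p : ℕ, evalZero (φ (m + p) (PowerSeries.coeff p A x)) := by
  rw [dress_apply hφ hA]
  refine (map_finsum evalZero (locFin_dress (B := vop c Jneg) hφ hA m x)).trans ?_
  have h := finsum_of_injective (e := fun p : ℕ => ((p, 0) : ℕ × ℕ))
    (fun p q h => by simpa using h)
    (f := fun p : ℕ × ℕ => evalZero (PowerSeries.coeff p.2 (vop c Jneg) (φ (m + p.1 - p.2)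
      (PowerSeries.coeff p.1 A x)))) (fun p hp => by
      have h0 : p.2 ≠ 0 := fun h => hp ⟨p.1, by rw [← h]⟩
      rw [← Module.End.mul_apply evalZero,
        mul_vop_eq_zero (fun i j _ _ => Jneg_commute i j) (fun i _ => evalZero_mul_Jneg i) h0]
      rfl)
  refine h.symm.trans ?_
  simp [coeff_zero_vop]

/-- The outermost V_- is trivial at t = 0 and the innermost V_+ is trivial on ξ_α. What remains is
V_+ V_- between the two fermions, and its matrix elements are the coefficients of (1+x)/(1-x). -/
theorem evalZero_Phi_Phi (m n : ℤ) (α : Finset ℕ) : evalZero (Phi m (Phi n (xi α 1))) =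
    ∑ᶠ p : ℕ, cayley p • theta (m + p) (theta (n - p) (xi α 1)) := by
  rw [Phi, evalZero_dress lowNil_theta (locNil_vop_Jpos 2),
    dress_apply_vacuum lowNil_theta 2 n fun i _ => Jpos_one i α]
  refine finsum_congr fun p => ?_
  rw [← Module.End.mul_apply evalZero, (evalZero_commute_theta _).eq, Module.End.mul_apply,
    ← map_smul]
  congr 1
  have hfin : (Function.support fun q : ℕ => PowerSeries.coeff q (vop (-2) Jneg)
      (theta (n - q) (xi α 1))).Finite := by
    obtain ⟨N, hN⟩ := lowNil_theta (xi α 1)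
    refine (range (n - N + 1).toNat).finite_toSet.subset fun q hq => ?_
    rw [Finset.mem_coe, mem_range]
    by_contra h
    exact hq (by beta_reduce; rw [hN _ (by omega), map_zero])
  rw [map_finsum (PowerSeries.coeff p (vop 2 Jpos)) hfin, map_finsum evalZero
    (hfin.subset fun q hq h => hq (by simp only at h ⊢; rw [h, map_zero]))]
  rw [finsum_eq_single _ p]
  · rw [evalZero_vop_vop (fun i _ => Jpos_theta_xi_one i _ α) (evalZero_theta_xi_one _ α),
      if_pos rfl]
  · intro q hq
    rw [evalZero_vop_vop (fun i _ => Jpos_theta_xi_one i _ α) (evalZero_theta_xi_one _ α),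
      if_neg (Ne.symm hq)]

/-- The commutator of two modes of the bosonic field. -/
def bosonSign (m n : ℤ) : ℂ := if m + n = -1 then (-1) ^ n else 0

theorem neg_one_zpow_sub_odd {k : ℕ} (hk : Odd k) (n : ℤ) : (-1 : ℂ) ^ (n - k) = -(-1) ^ n := by
  rw [zpow_sub₀ (by norm_num), zpow_natCast, hk.neg_one_pow]
  ring

theorem neg_one_zpow_add_odd {k : ℕ} (hk : Odd k) (n : ℤ) : (-1 : ℂ) ^ (n + k) = -(-1) ^ n := by
  rw [zpow_add₀ (by norm_num), zpow_natCast, hk.neg_one_pow]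
  ring

theorem bosonSign_sub {k : ℕ} (hk : Odd k) (m n : ℤ) :
    bosonSign (m - k) n + bosonSign m (n - k) = 0 := by
  have e : m - k + n = m + (n - k) := by ring
  rw [bosonSign, bosonSign, e, neg_one_zpow_sub_odd hk]
  split_ifs <;> simp

theorem bosonSign_add {k : ℕ} (hk : Odd k) (m n : ℤ) :
    bosonSign (m + k) n + bosonSign m (n + k) = 0 := by
  have e : m + k + n = m + (n + k) := by ring
  rw [bosonSign, bosonSign, e, neg_one_zpow_add_odd hk]
  split_ifs <;> simp

/-- The defects D m n span a space closed under commutators with all currents, so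
`eq_zero_of_currents` reduces the claim to matrix elements at t = 0 on functions of the Grassmann
times. There both products are Cayley-weighted sums of θθ, and `sum_antisymm` applies. -/
theorem Phi_comm (m n : ℤ) : Phi m * Phi n - Phi n * Phi m = bosonSign m n • 1 := by
  obtain ⟨D, hD⟩ : ∃ D : ℤ → ℤ → Module.End ℂ SPoly,
    D = fun m n => Phi m * Phi n - Phi n * Phi m - bosonSign m n • 1 := ⟨_, rfl⟩
  have hpos : ∀ k, Odd k → ∀ m n, Jpos k * D m n - D m n * Jpos k =
      D (m - k) n + D m (n - k) := by
    intro k hk m n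
    have h := bosonSign_sub hk m n
    rw [hD]
    simp only
    rw [← Jpos_Phi hk m, ← Jpos_Phi hk n, eq_neg_of_add_eq_zero_left h, neg_smul,
      mul_sub, sub_mul, mul_smul_comm, smul_mul_assoc, mul_one, one_mul]
    noncomm_ring
  have hneg : ∀ k, Odd k → ∀ m n, Jneg k * D m n - D m n * Jneg k =
      D (m + k) n + D m (n + k) := by
    intro k hk m n
    have h := bosonSign_add hk m n
    rw [hD]
    simp only
    rw [← Jneg_Phi hk m, ← Jneg_Phi hk n, eq_neg_of_add_eq_zero_left h, neg_smul,
      mul_sub, sub_mul, mul_smul_comm, smul_mul_assoc, mul_one, one_mul]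
    noncomm_ring
  have hstable : ∀ (J : Module.End ℂ SPoly) (s : ℤ),
      (∀ m n, J * D m n - D m n * J = D (m + s) n + D m (n + s)) →
      ∀ A ∈ Submodule.span ℂ (Set.range fun p : ℤ × ℤ => D p.1 p.2),
        J * A - A * J ∈ Submodule.span ℂ (Set.range fun p : ℤ × ℤ => D p.1 p.2) := by
    intro J s hJ A hA
    induction hA using Submodule.span_induction with
    | mem A hA =>
      obtain ⟨⟨m, n⟩, rfl⟩ := hA
      simp only
      rw [hJ]
      exact Submodule.add_mem _ (Submodule.subset_span ⟨(m + s, n), rfl⟩)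
        (Submodule.subset_span ⟨(m, n + s), rfl⟩)
    | zero => simp
    | add A B _ _ hA hB =>
      have : J * (A + B) - (A + B) * J = (J * A - A * J) + (J * B - B * J) := by noncomm_ring
      rw [this]
      exact Submodule.add_mem _ hA hB
    | smul c A _ hA =>
      rw [mul_smul_comm, smul_mul_assoc, ← smul_sub]
      exact Submodule.smul_mem _ _ hA
  have h := eq_zero_of_currents
    (X := (Submodule.span ℂ (Set.range fun p : ℤ × ℤ => D p.1 p.2) : Set (Module.End ℂ SPoly)))
    (fun A hA k hk => hstable _ (-k) (fun m n => hpos k hk m n) A hA)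
    (fun A hA k hk => hstable _ k (fun m n => hneg k hk m n) A hA) (fun A hA α => by
      rw [SetLike.mem_coe] at hA
      induction hA using Submodule.span_induction with
      | mem A hA =>
        obtain ⟨⟨m, n⟩, rfl⟩ := hA
        rw [hD]
        simp only [LinearMap.sub_apply, map_sub, Module.End.mul_apply, LinearMap.smul_apply,
          Module.End.one_apply, map_smul]
        obtain ⟨N, hN⟩ := lowNil_theta (xi α 1)
        -- The bound makes the index m + n - a of the inner fermion so low that it kills ξ_α.
        have key := sum_antisymm (F := fun a => theta a (theta (m + n - a) (xi α 1))) (x := xi α 1)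
          (s := m + n) (N := m + n - N + 1) (fun a ha => by
            rw [hN _ (by omega), map_zero]) (fun a => by
            have h := congrArg (fun A : Module.End ℂ SPoly => A (xi α 1))
              (theta_anticomm a (m + n - a))
            simp only [LinearMap.add_apply, Module.End.mul_apply] at h
            have e : m + n - (m + n - a) = a := by ring
            have e' : a + (m + n - a) = m + n := by ring
            rw [e, h, e']
            split_ifs <;> simp) m
        rw [evalZero_Phi_Phi, evalZero_Phi_Phi, evalZero_xi_one, sub_eq_zero]
        have e1 : ∀ p : ℕ, m + n - (m + p) = n - p := fun p => by ring
        have e2 : m + n - m = n := by ring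
        have e3 : ∀ p : ℕ, m + n - (n + p) = m - p := fun p => by ring
        simp only [e1, e2, e3] at key
        exact key
      | zero => simp
      | add A B _ _ hA hB => rw [LinearMap.add_apply, map_add, hA, hB, add_zero]
      | smul c A _ hA => rw [LinearMap.smul_apply, map_smul, hA, smul_zero])
    (A := D m n) (Submodule.subset_span ⟨(m, n), rfl⟩)
  rw [hD] at h
  exact sub_eq_zero.mp h

/-- The fermionic field is recovered from the bosonic field. -/
theorem dress_Phi (l : ℤ) : dress (vop 2 Jneg) Phi (vop (-2) Jpos) l = theta l := by
  have hpos : ∀ k, Odd k → Jpos k * dress (vop 2 Jneg) Phi (vop (-2) Jpos) l -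
      dress (vop 2 Jneg) Phi (vop (-2) Jpos) l * Jpos k = 0 := by
    intro k hk
    rw [dress_commutator_pos (B := vop 2 Jneg) lowNil_Phi (locNil_vop_Jpos (-2))
      (Jpos_vop_Jneg hk 2) (f := 1) (fun l => by rw [Jpos_Phi hk, one_smul])
      (fun p => vop_commute (fun i _ => Jpos_commute k i) p) l]
    norm_num
  have hneg : ∀ k, Odd k → Jneg k * dress (vop 2 Jneg) Phi (vop (-2) Jpos) l -
      dress (vop 2 Jneg) Phi (vop (-2) Jpos) l * Jneg k = 0 := by
    intro k hk
    rw [dress_commutator_neg (B := vop 2 Jneg) lowNil_Phi (locNil_vop_Jpos (-2))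
      (Jneg_vop_Jpos hk (-2)) (f := 1) (fun l => by rw [Jneg_Phi hk, one_smul])
      (fun p => vop_commute (fun i _ => Jneg_commute k i) p) l]
    norm_num
  -- The charge of Φ and that of the inverse dressing cancel, so the defect commutes with all
  -- currents and the set consisting of it and 0 is closed under commutators.
  have h := eq_zero_of_currents
    (X := {0, dress (vop 2 Jneg) Phi (vop (-2) Jpos) l - theta l}) (fun A hA k hk => by
      left
      rcases hA with rfl | rfl
      · simp
      · rw [mul_sub, sub_mul, (Jpos_commute_theta k l).eq, sub_sub_sub_cancel_right, hpos k hk])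
    (fun A hA k hk => by
      left
      rcases hA with rfl | rfl
      · simp
      · rw [mul_sub, sub_mul, (Jneg_commute_theta k l).eq, sub_sub_sub_cancel_right, hneg k hk])
    (fun A hA α => by
      rcases hA with rfl | rfl
      · simp
      · rw [LinearMap.sub_apply, map_sub, evalZero_theta_xi_one,
          evalZero_dress lowNil_Phi (locNil_vop_Jpos (-2)), finsum_eq_single _ 0]
        · rw [coeff_zero_vop, Module.End.one_apply, Phi,
            evalZero_dress lowNil_theta (locNil_vop_Jpos 2), finsum_eq_single _ 0]
          · rw [coeff_zero_vop, Module.End.one_apply, evalZero_theta_xi_one]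
            simp
          · intro p hp
            rw [vop_apply_eq_zero (fun i j _ _ => Jpos_commute i j) (fun i _ => Jpos_one i α) hp,
              map_zero, map_zero]
        · intro p hp
          rw [vop_apply_eq_zero (fun i j _ _ => Jpos_commute i j) (fun i _ => Jpos_one i α) hp,
            map_zero, map_zero])
    (Set.mem_insert_of_mem _ rfl)
  exact sub_eq_zero.mp h

/-- The vacuum vector. -/
def svac : SPoly := xi ∅ 1

theorem Phi_svac {m : ℤ} (hm : m < 0) : Phi m svac = 0 := by
  rw [Phi, svac, dress_apply_vacuum lowNil_theta 2 m fun i _ => Jpos_one i ∅]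
  refine finsum_eq_zero_of_forall_eq_zero fun q => ?_
  obtain ⟨n, hn⟩ : ∃ n : ℕ, m - q = Int.negSucc n := ⟨(-(m - q) - 1).toNat, by
    rw [Int.negSucc_eq]; omega⟩
  rw [hn, theta, LinearMap.smul_apply, anni_xi]
  simp

/-- The vacuum component. -/
def svev : SPoly →ₗ[ℂ] ℂ := MvPolynomial.lcoeff ℂ (0 : ℕ →₀ ℕ) ∘ₗ SPoly.proj ∅

theorem svev_evalZero (s : SPoly) : svev (evalZero s) = svev s := by
  simp [svev, evalZero, proj_liftOp]

theorem svev_theta (n : ℕ) (s : SPoly) : svev (theta n s) = 0 := by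
  rw [← Int.ofNat_eq_natCast, theta, LinearMap.smul_apply, map_smul]
  have : svev ∘ₗ crea n = 0 := SPoly.hom_ext fun α f => by
    rw [LinearMap.comp_apply, crea_xi]
    split_ifs with h
    · simp
    · simp [svev, SPoly.proj_xi]
  rw [← LinearMap.comp_apply, this]
  simp

theorem svev_Phi (n : ℕ) (s : SPoly) : svev (Phi n s) = 0 := by
  rw [← svev_evalZero, Phi, evalZero_dress lowNil_theta (locNil_vop_Jpos 2)]
  have hfin : (Function.support fun p : ℕ =>
      evalZero (theta ((n : ℤ) + p) (PowerSeries.coeff p (vop 2 Jpos) s))).Finite := by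
    obtain ⟨P, hP⟩ := locNil_vop_Jpos 2 s
    refine (range P).finite_toSet.subset fun q hq => ?_
    rw [Finset.mem_coe, mem_range]
    by_contra h
    exact hq (by beta_reduce; rw [hP _ (by omega), map_zero, map_zero])
  rw [map_finsum svev hfin]
  refine finsum_eq_zero_of_forall_eq_zero fun p => ?_
  rw [svev_evalZero]
  exact_mod_cast svev_theta (n + p) _

theorem svev_Jneg (k : ℕ) (s : SPoly) : svev (Jneg k s) = 0 := by
  rw [← svev_evalZero, ← Module.End.mul_apply, evalZero_mul_Jneg]; simp

/-- A vector annihilated by all annihilation operators and without vacuum component is zero. -/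
theorem eq_zero_of_vacuum {x : SPoly} (hJ : ∀ k, Odd k → Jpos k x = 0)
    (hPhi : ∀ m : ℤ, m < 0 → Phi m x = 0) (h0 : svev x = 0) : x = 0 := by
  have htheta : ∀ n : ℕ, anni n x = 0 := by
    intro n
    have h := dress_Phi (Int.negSucc n)
    have h1 : theta (Int.negSucc n) x = 0 := by
      -- The fermion annihilators are recovered from Φ; on a vector killed by the currents they
      -- involve only the modes Φ_m with m < 0.
      rw [← h, dress_apply_vacuum lowNil_Phi (-2) _ hJ]
      refine finsum_eq_zero_of_forall_eq_zero fun q => ?_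
      rw [hPhi _ (by rw [Int.negSucc_eq]; omega), map_zero]
    rw [theta, LinearMap.smul_apply] at h1
    refine (smul_eq_zero.mp h1).resolve_left ?_
    have : (2 * (n : ℂ) + 1) ≠ 0 := by exact_mod_cast Nat.succ_ne_zero (2 * n)
    exact mul_ne_zero (by simp) (div_ne_zero this two_ne_zero)
  have hproj : ∀ (α : Finset ℕ) (n : ℕ), n ∉ α → ∀ s : SPoly,
      SPoly.proj α (anni n s) = sgn n α • SPoly.proj (insert n α) s := by
    intro α n hn s
    induction s using SPoly.induction with
    | h0 => simp
    | hadd s s' hs hs' => rw [map_add, map_add, hs, hs', map_add, smul_add]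
    | hxi β f =>
      rw [anni_xi, SPoly.proj_xi]
      by_cases h : β = insert n α
      · subst h
        rw [if_pos (mem_insert_self _ _), if_pos rfl, map_smul, SPoly.proj_xi, erase_insert hn,
          if_pos rfl, sgn_insert_self]
      · rw [if_neg h, smul_zero]
        split_ifs with h'
        · rw [map_smul, SPoly.proj_xi, if_neg, smul_zero]
          rintro rfl
          exact h (insert_erase h').symm
        · rw [map_zero]
  have hα : ∀ α : Finset ℕ, α ≠ ∅ → SPoly.proj α x = 0 := by
    intro α hα
    obtain ⟨n, hn⟩ := nonempty_iff_ne_empty.mpr hα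
    have h := hproj (α.erase n) n (notMem_erase n α) x
    rw [htheta, map_zero, insert_erase hn] at h
    have h1 : sgn n (α.erase n) ≠ 0 := fun h => by
      have := sgn_mul_self n (α.erase n)
      rw [h] at this
      simp at this
    exact (smul_eq_zero.mp h.symm).resolve_left h1
  refine eq_zero_of_evalZero (Z := {z | z = x ∨ z = 0}) ?_ ?_ (Or.inl rfl)
  · rintro z (rfl | rfl) k hk
    · exact Or.inr (hJ k hk)
    · exact Or.inr (map_zero _)
  · rintro z (rfl | rfl)
    · refine SPoly.ext fun α => ?_
      rw [map_zero, evalZero, proj_liftOp]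
      by_cases h : α = ∅
      · subst h
        have : MvPolynomial.coeff 0 (SPoly.proj ∅ z) = 0 := h0
        simp [this]
      · rw [hα α h, map_zero]
    · exact map_zero _

/-! ### The dual Fock space and the bosonisation map -/

/-- The transpose of `φ_{-i-1/2}` on the space of continuous functionals on the Fock space,
realised as polynomials. -/
def psi : ℤ → Module.End ℂ Poly
  | Int.ofNat k => ((-1 : ℂ) ^ k) • LinearMap.mulLeft ℂ (MvPolynomial.X k : Poly)
  | Int.negSucc k => (MvPolynomial.pderiv k : Derivation ℂ Poly Poly).toLinearMap

theorem psi_natCast (k : ℕ) (p : Poly) : psi k p = ((-1 : ℂ) ^ k) • (MvPolynomial.X k * p) := rfl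

theorem psi_negSucc (k : ℕ) (p : Poly) : psi (Int.negSucc k) p = MvPolynomial.pderiv k p := rfl

theorem X_mul_eq_psi (k : ℕ) (p : Poly) : MvPolynomial.X k * p = ((-1 : ℂ) ^ k) • psi k p := by
  rw [psi_natCast, smul_smul, ← mul_pow]; simp

theorem psi_comm (i j : ℤ) : psi i * psi j - psi j * psi i = bosonSign i j • 1 := by
  rw [bosonSign]
  refine LinearMap.ext fun p => ?_
  rcases i with k | k <;> rcases j with l | l
  · rw [if_neg (by simp; omega)]
    simp only [psi, LinearMap.sub_apply, Module.End.mul_apply, LinearMap.smul_apply,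
      LinearMap.mulLeft_apply, map_smul]
    rw [smul_comm, mul_left_comm]
    simp
  · have e : (Int.ofNat k + Int.negSucc l = -1) ↔ k = l := by
      rw [Int.negSucc_eq]; simp; omega
    simp only [psi, LinearMap.sub_apply, Module.End.mul_apply, LinearMap.smul_apply,
      LinearMap.mulLeft_apply, map_smul, Derivation.coeFn_coe, Derivation.leibniz,
      MvPolynomial.pderiv_X, e]
    by_cases h : k = l
    · subst h
      have : (-1 : ℂ) ^ Int.negSucc k = -(-1) ^ k := by
        rw [zpow_negSucc, pow_succ]
        rcases neg_one_pow_eq_or ℂ k with h | h <;> rw [h] <;> norm_num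
      simp [this]
    · simp [h]
  · have e : (Int.negSucc k + Int.ofNat l = -1) ↔ l = k := by
      rw [Int.negSucc_eq]; simp; omega
    simp only [psi, LinearMap.sub_apply, Module.End.mul_apply, LinearMap.smul_apply,
      LinearMap.mulLeft_apply, map_smul, Derivation.coeFn_coe, Derivation.leibniz,
      MvPolynomial.pderiv_X, e]
    by_cases h : l = k
    · subst h
      simp
    · simp [h]
  · rw [if_neg (by rw [Int.negSucc_eq, Int.negSucc_eq]; omega)]
    simp only [psi, LinearMap.sub_apply, Module.End.mul_apply, Derivation.coeFn_coe]
    rw [pderiv_comm]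
    simp

theorem psi_apply_comm (i j : ℤ) (p : Poly) :
    psi i (psi j p) = psi j (psi i p) + bosonSign i j • p := by
  have h := congrArg (fun A : Module.End ℂ Poly => A p) (psi_comm i j)
  simp only [LinearMap.sub_apply, Module.End.mul_apply, LinearMap.smul_apply,
    Module.End.one_apply] at h
  rw [← h]; abel

theorem lowNil_psi : LowNil psi := by
  intro p
  induction p using MvPolynomial.induction_on with
  | C a =>
    refine ⟨0, fun l hl => ?_⟩
    rcases l with l | l
    · exact absurd hl (by simp)
    · simp [psi]
  | add p q hp hq =>
    obtain ⟨N, hN⟩ := hp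
    obtain ⟨N', hN'⟩ := hq
    refine ⟨min N N', fun l hl => ?_⟩
    rw [map_add, hN l (by omega), hN' l (by omega), add_zero]
  | mul_X p n hp =>
    obtain ⟨N, hN⟩ := hp
    refine ⟨min N (-n - 1), fun l hl => ?_⟩
    rw [mul_comm, X_mul_eq_psi, map_smul, psi_apply_comm, hN l (by omega), bosonSign,
      if_neg (by omega)]
    simp

/-- For large j the inner factor kills the polynomial. For very negative j the factors are
exchanged, at no cost because n ≠ 0 excludes a central term, and then the other one does. -/
theorem locFin_JD {n : ℤ} (hn : Odd n) :
    LocFin fun j : ℤ => (-1 : ℂ) ^ (j + 1) • (psi j * psi (-j - n - 1)) := by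
  intro p
  obtain ⟨N, hN⟩ := lowNil_psi p
  refine (Finset.Icc N (-N - n - 1)).finite_toSet.subset fun j hj => ?_
  rw [Function.mem_support, LinearMap.smul_apply] at hj
  have hj := right_ne_zero_of_smul hj
  rw [Module.End.mul_apply] at hj
  rw [Finset.mem_coe, Finset.mem_Icc]
  constructor
  · by_contra h
    refine hj ?_
    rw [psi_apply_comm, hN j (by omega), bosonSign,
      if_neg (by intro h; rcases hn with ⟨r, hr⟩; omega)]
    simp
  · by_contra h
    exact hj (by rw [hN _ (by omega), map_zero])

/-- The current on the dual Fock space. -/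
def JD (n : ℤ) : Module.End ℂ Poly :=
  (1 / 2 : ℂ) • locSum fun j : ℤ => (-1 : ℂ) ^ (j + 1) • (psi j * psi (-j - n - 1))

theorem JD_apply {n : ℤ} (hn : Odd n) (p : Poly) :
    JD n p = (1 / 2 : ℂ) • ∑ᶠ j : ℤ, (-1 : ℂ) ^ (j + 1) • psi j (psi (-j - n - 1) p) := by
  rw [JD, LinearMap.smul_apply, locSum_apply (locFin_JD hn)]
  rfl

theorem neg_one_zpow_mul_self (m : ℤ) : (-1 : ℂ) ^ m * (-1) ^ m = 1 := by
  rw [← mul_zpow]; simp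

theorem neg_one_zpow_neg (m : ℤ) : (-1 : ℂ) ^ (-m) = (-1) ^ m := by
  rw [zpow_neg]
  exact inv_eq_of_mul_eq_one_right (neg_one_zpow_mul_self m)

theorem neg_one_zpow_succ (m : ℤ) : (-1 : ℂ) ^ (m + 1) = -(-1) ^ m := by
  rw [zpow_add₀ (by norm_num)]; simp

theorem neg_one_zpow_sub_of_odd {n : ℤ} (hn : Odd n) (m : ℤ) :
    (-1 : ℂ) ^ (m - n) = -(-1) ^ m := by
  rw [zpow_sub₀ (by norm_num), hn.neg_one_zpow]
  ring

/-- In the commutator two summands survive, j = m - n and j = -1 - m. For odd n they have equal sign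
and both give ψ_{m-n}, which compensates the factor 1/2. -/
theorem JD_psi {n : ℤ} (hn : Odd n) (m : ℤ) : JD n * psi m - psi m * JD n = psi (m - n) := by
  refine LinearMap.ext fun p => ?_
  have hc : ∀ j, (-1 : ℂ) ^ (j + 1) • psi j (psi (-j - n - 1) (psi m p)) -
      psi m ((-1 : ℂ) ^ (j + 1) • psi j (psi (-j - n - 1) p)) =
      (if j = m - n then psi (m - n) p else 0) + if j = -1 - m then psi (m - n) p else 0 := by
    intro j
    rw [map_smul, ← smul_sub, psi_apply_comm _ m p, map_add, psi_apply_comm j m, map_smul,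
      add_assoc, add_sub_cancel_left, bosonSign, bosonSign, smul_add, add_comm]
    congr 1
    · by_cases h : j = m - n
      · subst h
        rw [if_pos rfl, if_pos (by ring), smul_smul, neg_one_zpow_succ, neg_one_zpow_sub_of_odd hn,
          neg_neg, neg_one_zpow_mul_self, one_smul]
      · rw [if_neg h, if_neg (by omega)]; simp
    · by_cases h : j = -1 - m
      · subst h
        have e1 : -1 - m + 1 = -m := by ring
        have e2 : -(-1 - m) - n - 1 = m - n := by ring
        rw [if_pos rfl, if_pos (by ring), smul_smul, e1, e2, neg_one_zpow_neg,
          neg_one_zpow_mul_self, one_smul]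
      · rw [if_neg h, if_neg (by omega)]; simp
  have hfin := locFin_JD hn
  rw [LinearMap.sub_apply, Module.End.mul_apply, Module.End.mul_apply, JD_apply hn, JD_apply hn,
    map_smul, ← smul_sub]
  have h0 : psi m (∑ᶠ j : ℤ, (-1 : ℂ) ^ (j + 1) • psi j (psi (-j - n - 1) p)) =
      ∑ᶠ j : ℤ, psi m ((-1 : ℂ) ^ (j + 1) • psi j (psi (-j - n - 1) p)) :=
    map_finsum (psi m) (hfin p)
  rw [h0]
  have h1 := finsum_sub_distrib (f := fun j : ℤ => (-1 : ℂ) ^ (j + 1) •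
      psi j (psi (-j - n - 1) (psi m p)))
    (g := fun j : ℤ => psi m ((-1 : ℂ) ^ (j + 1) • psi j (psi (-j - n - 1) p)))
    (hfin (psi m p)) ((hfin p).subset fun j hj h => hj (by
      change (-1 : ℂ) ^ (j + 1) • psi j (psi (-j - n - 1) p) = 0 at h
      beta_reduce
      rw [h, map_zero]))
  refine (congrArg _ h1.symm).trans ?_
  rw [finsum_congr hc, finsum_add_distrib
    ((Set.finite_singleton (m - n)).subset fun j hj => by
      by_contra h; exact hj (if_neg h))
    ((Set.finite_singleton (-1 - m)).subset fun j hj => by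
      by_contra h; exact hj (if_neg h)),
    finsum_eq_single _ (m - n) fun j hj => if_neg hj,
    finsum_eq_single _ (-1 - m) fun j hj => if_neg hj, if_pos rfl, if_pos rfl, ← two_smul ℂ,
    smul_smul]
  norm_num

theorem psi_one {m : ℤ} (hm : m < 0) : psi m 1 = 0 := by
  rcases m with k | k
  · exact absurd hm (by simp)
  · simp [psi]

theorem JD_one {n : ℕ} (hn : Odd n) : JD (n : ℤ) 1 = 0 := by
  rw [JD_apply (by exact_mod_cast hn), finsum_eq_zero_of_forall_eq_zero, smul_zero]
  intro j
  by_cases hj : -j - n - 1 < 0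
  · rw [psi_one hj, map_zero, smul_zero]
  · rw [psi_apply_comm, psi_one (by omega), map_zero, bosonSign,
      if_neg (by intro h; rcases hn with ⟨r, hr⟩; omega)]
    simp

/-- For j < 0 the two factors commute and ψ_j kills 1; for j ≥ n the inner factor does. The infinite
sum thus becomes finite. -/
theorem JD_neg_one {n : ℕ} (hn : Odd n) : JD (-n : ℤ) 1 =
    (1 / 2 : ℂ) • ∑ j ∈ range n, (-1 : ℂ) ^ (j + 1) • psi j (psi (n - 1 - j : ℤ) 1) := by
  rw [JD_apply (Odd.neg (by exact_mod_cast hn))]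
  congr 1
  have h := finsum_of_injective (e := fun j : ℕ => (j : ℤ)) Nat.cast_injective
    (f := fun j : ℤ => (-1 : ℂ) ^ (j + 1) • psi j (psi (-j - -(n : ℤ) - 1) 1)) (fun j hj => by
      have hj0 : j < 0 := by
        by_contra h
        exact hj ⟨j.toNat, by simp; omega⟩
      rw [psi_apply_comm, psi_one hj0, map_zero, bosonSign,
        if_neg (by intro h; rcases hn with ⟨r, hr⟩; omega)]
      simp)
  rw [← h, finsum_eq_sum_of_support_subset (s := range n)]
  · refine Finset.sum_congr rfl fun j _ => ?_
    have e : -(j : ℤ) - -(n : ℤ) - 1 = n - 1 - j := by ring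
    rw [e]
    norm_cast
  · intro j hj
    rw [Finset.mem_coe, mem_range]
    by_contra h'
    refine hj ?_
    beta_reduce
    rw [psi_one (by omega), map_zero, smul_zero]

/-- The central term of the currents, computed on the vacuum. For k < n the two halves of the
Leibniz rule cancel after the shift of j by the odd number k; for k = n there remain n equal
constants; for k > n every term contains an annihilator acting on 1. -/
theorem JD_JD_neg_one {k n : ℕ} (hk : Odd k) (hn : Odd n) :
    JD (k : ℤ) (JD (-n : ℤ) 1) = (if k = n then -(k / 2) else 0 : ℂ) • 1 := by
  have hk' : Odd (k : ℤ) := by exact_mod_cast hk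
  have hJ : ∀ m p, JD (k : ℤ) (psi m p) = psi m (JD (k : ℤ) p) + psi (m - k) p := by
    intro m p
    have h := congrArg (fun A : Module.End ℂ Poly => A p) (JD_psi hk' m)
    simp only [LinearMap.sub_apply, Module.End.mul_apply] at h
    rw [← h]; abel
  rw [JD_neg_one hn, map_smul, map_sum]
  have h1 : ∀ j ∈ range n, JD (k : ℤ) ((-1 : ℂ) ^ (j + 1) • psi j (psi (n - 1 - j : ℤ) 1)) =
      (-1 : ℂ) ^ (j + 1) • psi j (psi (n - 1 - j - k : ℤ) 1) +
      (-1 : ℂ) ^ (j + 1) • psi (j - k : ℤ) (psi (n - 1 - j : ℤ) 1) := by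
    intro j _
    rw [map_smul, hJ, hJ, JD_one hk, map_zero, zero_add, smul_add]
  rw [Finset.sum_congr rfl h1, Finset.sum_add_distrib]
  by_cases hkn : k < n
  · have h2 : ∑ j ∈ range n, (-1 : ℂ) ^ (j + 1) • psi j (psi (n - 1 - j - k : ℤ) 1) =
        ∑ j ∈ range (n - k), (-1 : ℂ) ^ (j + 1) • psi j (psi (n - 1 - j - k : ℤ) 1) := by
      symm
      refine Finset.sum_subset (by simp) fun j hj hj' => ?_
      rw [mem_range] at hj hj'
      rw [psi_one (by omega), map_zero, smul_zero]
    have h3 : ∑ j ∈ range n, (-1 : ℂ) ^ (j + 1) • psi (j - k : ℤ) (psi (n - 1 - j : ℤ) 1) =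
        -∑ j ∈ range (n - k), (-1 : ℂ) ^ (j + 1) • psi j (psi (n - 1 - j - k : ℤ) 1) := by
      have e : n = k + (n - k) := by omega
      conv_lhs => rw [e, Finset.sum_range_add]
      rw [Finset.sum_eq_zero, zero_add, ← Finset.sum_neg_distrib]
      · refine Finset.sum_congr rfl fun j hj => ?_
        rw [mem_range] at hj
        have e1 : ((k + j : ℕ) : ℤ) - k = j := by push_cast; ring
        have e2 : ((k + (n - k) : ℕ) : ℤ) - 1 - (k + j : ℕ) = n - 1 - j - k := by
          rw [← e]; push_cast; ring
        rw [e1, e2, ← neg_smul]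
        congr 1
        rw [add_assoc, pow_add _ k, hk.neg_one_pow]
        ring
      · intro j hj
        rw [mem_range] at hj
        rw [psi_apply_comm, psi_one (by omega), map_zero, bosonSign, if_neg (by omega)]
        simp
    rw [h2, h3, add_neg_cancel, smul_zero, if_neg hkn.ne, zero_smul]
  · rw [Finset.sum_eq_zero, zero_add]
    · by_cases h : k = n
      · subst h
        rw [if_pos rfl]
        have h2 : ∀ j ∈ range k, (-1 : ℂ) ^ (j + 1) • psi (j - k : ℤ) (psi (k - 1 - j : ℤ) 1) =
            (-1 : ℂ) • (1 : Poly) := by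
          intro j hj
          rw [mem_range] at hj
          rw [psi_apply_comm, psi_one (by omega), map_zero, zero_add, bosonSign,
            if_pos (by ring), smul_smul]
          congr 1
          have e : (k : ℤ) - 1 - j = -(j + 1 : ℕ) + k := by push_cast; ring
          rw [e, neg_one_zpow_add_odd hk, neg_one_zpow_neg, zpow_natCast, mul_neg, ← mul_pow]
          simp
        rw [Finset.sum_congr rfl h2, Finset.sum_const, card_range, ← Nat.cast_smul_eq_nsmul ℂ,
          smul_smul, smul_smul]
        congr 1
        ring
      · rw [if_neg h, zero_smul, Finset.sum_eq_zero, smul_zero]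
        intro j hj
        rw [mem_range] at hj
        rw [psi_apply_comm, psi_one (by omega), map_zero, bosonSign, if_neg (by omega)]
        simp
    · intro j hj
      rw [mem_range] at hj
      rw [psi_one (by omega), map_zero, smul_zero]

open scoped IsMulCommutative in
/-- Commuting operators and a vector define a map from polynomials. -/
theorem exists_poly_map {M : Type} [AddCommGroup M] [Module ℂ M] (B : ℕ → Module.End ℂ M)
    (hB : ∀ i j, B i * B j = B j * B i) (v : M) :
    ∃ T : Poly →ₗ[ℂ] M, T 1 = v ∧ ∀ k p, T (MvPolynomial.X k * p) = B k (T p) := by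
  have : IsMulCommutative (Algebra.adjoin ℂ (Set.range B)) := Algebra.isMulCommutative_adjoin ℂ (by
    rintro _ ⟨i, rfl⟩ _ ⟨j, rfl⟩
    exact hB i j)
  let E : Poly →ₐ[ℂ] Algebra.adjoin ℂ (Set.range B) :=
    MvPolynomial.aeval fun k => ⟨B k, Algebra.subset_adjoin ⟨k, rfl⟩⟩
  refine ⟨LinearMap.applyₗ v ∘ₗ (Subalgebra.val _).toLinearMap ∘ₗ E.toLinearMap, ?_, fun k p => ?_⟩
  · simp
  · simp [E]

theorem psi_induction {P : Poly → Prop} (h1 : P 1) (hadd : ∀ p q, P p → P q → P (p + q))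
    (hsmul : ∀ (c : ℂ) p, P p → P (c • p)) (hpsi : ∀ (n : ℕ) p, P p → P (psi n p)) (p : Poly) :
    P p := by
  induction p using MvPolynomial.induction_on with
  | C a =>
    rw [← mul_one (MvPolynomial.C a), ← MvPolynomial.smul_eq_C_mul]
    exact hsmul a 1 h1
  | add p q hp hq => exact hadd p q hp hq
  | mul_X p n hp =>
    rw [mul_comm, X_mul_eq_psi]
    exact hsmul _ _ (hpsi n p hp)

theorem Phi_apply_comm (i j : ℤ) (s : SPoly) :
    Phi i (Phi j s) = Phi j (Phi i s) + bosonSign i j • s := by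
  have h := congrArg (fun A : Module.End ℂ SPoly => A s) (Phi_comm i j)
  simp only [LinearMap.sub_apply, Module.End.mul_apply, LinearMap.smul_apply,
    Module.End.one_apply] at h
  rw [← h]; abel

/-- The modes Φ_k with k ≥ 0 commute, so they can be substituted for the variables; the sign is the
one in `psi`. -/
theorem exists_bos : ∃ T : Poly →ₗ[ℂ] SPoly, T 1 = svac ∧
    ∀ (k : ℕ) (p : Poly), T (MvPolynomial.X k * p) = (((-1 : ℂ) ^ k) • Phi k) (T p) :=
  exists_poly_map (fun k : ℕ => ((-1 : ℂ) ^ k) • Phi k) (fun i j => by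
    have h := Phi_comm i j
    rw [bosonSign, if_neg (by omega), zero_smul, sub_eq_zero] at h
    rw [smul_mul_smul_comm, smul_mul_smul_comm, h, mul_comm]) svac

/-- The bosonisation map from the dual Fock space to polynomial superfunctions. -/
def bos : Poly →ₗ[ℂ] SPoly := exists_bos.choose

theorem bos_one : bos 1 = svac := exists_bos.choose_spec.1

/-- For creation modes this is the construction. For annihilation modes it follows by induction,
since both families satisfy the same commutation relations and kill their vacuum. -/
theorem bos_psi (m : ℤ) (p : Poly) : bos (psi m p) = Phi m (bos p) := by
  have hn : ∀ (n : ℕ) p, bos (psi n p) = Phi n (bos p) := by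
    intro n p
    have h := exists_bos.choose_spec.2 n p
    rw [psi_natCast, map_smul]
    change _ • exists_bos.choose _ = _
    rw [h, LinearMap.smul_apply, smul_smul, ← mul_pow]
    simp
    rfl
  by_cases hm : 0 ≤ m
  · obtain ⟨n, rfl⟩ := Int.eq_ofNat_of_zero_le hm
    exact hn n p
  · push Not at hm
    induction p using psi_induction with
    | h1 => rw [psi_one hm, map_zero, bos_one, Phi_svac hm]
    | hadd p q hp hq => rw [map_add, map_add, map_add, map_add, hp, hq]
    | hsmul c p hp => rw [map_smul, map_smul, map_smul, map_smul, hp]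
    | hpsi n p hp => rw [psi_apply_comm, map_add, hn, hp, map_smul, hn, Phi_apply_comm m]

/-! ### Bijectivity of the bosonisation and transport of currents and fermions -/

theorem svac_ne_zero : svac ≠ 0 := by
  intro h
  have := congrArg svev h
  simp [svev, svac, SPoly.proj_xi] at this

theorem eq_C_of_pderiv_eq_zero {p : Poly} (h : ∀ k, MvPolynomial.pderiv k p = 0) :
    p = MvPolynomial.C (MvPolynomial.coeff 0 p) := by
  ext a
  rw [MvPolynomial.coeff_C]
  split_ifs with ha
  · rw [ha]
  · obtain ⟨n, hn⟩ := Finsupp.support_nonempty_iff.mpr (Ne.symm ha)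
    rw [Finsupp.mem_support_iff] at hn
    have hle : Finsupp.single n 1 ≤ a := by
      rw [Finsupp.single_le_iff]; omega
    obtain ⟨b, rfl⟩ := exists_add_of_le hle
    rw [add_comm]
    have h1 := congrArg (MvPolynomial.coeff b) (h n)
    rw [MvPolynomial.coeff_pderiv, MvPolynomial.coeff_zero] at h1
    have h5 : ((b n : ℂ) + 1) ≠ 0 := by exact_mod_cast Nat.succ_ne_zero (b n)
    exact (mul_eq_zero.mp h1).resolve_right h5

/-- The kernel is stable under all ∂_k, because these are annihilation modes. Induction on the
degree then makes all derivatives of a kernel element zero, so it is a constant, and constants are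
sent to multiples of the nonzero vacuum. -/
theorem bos_injective : Function.Injective bos := by
  rw [injective_iff_map_eq_zero]
  suffices h : ∀ (d : ℕ) (p : Poly), (∀ a : ℕ →₀ ℕ, d ≤ a.degree → MvPolynomial.coeff a p = 0) →
      bos p = 0 → p = 0 from fun p => h (p.totalDegree + 1) p fun a ha =>
        MvPolynomial.coeff_eq_zero_of_totalDegree_lt (by
          simpa [Finsupp.degree_apply] using Nat.lt_of_succ_le ha)
  have hbase : ∀ p : Poly, (∀ k, MvPolynomial.pderiv k p = 0) → bos p = 0 → p = 0 := by
    intro p hp h0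
    have hC := eq_C_of_pderiv_eq_zero hp
    rw [hC, ← mul_one (MvPolynomial.C _), ← MvPolynomial.smul_eq_C_mul, map_smul, bos_one] at h0
    have h1 := (smul_eq_zero.mp h0).resolve_right svac_ne_zero
    rw [hC, h1, map_zero]
  have hker : ∀ (p : Poly) k, bos p = 0 → bos (MvPolynomial.pderiv k p) = 0 := by
    intro p k hp
    rw [← psi_negSucc, bos_psi, hp, map_zero]
  intro d
  induction d with
  | zero =>
    intro p hp _
    ext a
    rw [hp a (Nat.zero_le _), MvPolynomial.coeff_zero]
  | succ d ih =>
    intro p hp h0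
    refine hbase p (fun k => ih _ (fun a ha => ?_) (hker p k h0)) h0
    rw [MvPolynomial.coeff_pderiv, hp _ (by simp; omega), zero_mul]

theorem bos_JD_pos {k : ℕ} (hk : Odd k) (p : Poly) : bos (JD (k : ℤ) p) = Jpos k (bos p) := by
  have hk' : Odd (k : ℤ) := by exact_mod_cast hk
  induction p using psi_induction with
  | h1 => rw [JD_one hk, map_zero, bos_one, svac, Jpos_one]
  | hadd p q hp hq => rw [map_add, map_add, map_add, map_add, hp, hq]
  | hsmul c p hp => rw [map_smul, map_smul, map_smul, map_smul, hp]
  | hpsi n p hp =>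
    have h1 := congrArg (fun A : Module.End ℂ Poly => bos (A p)) (JD_psi hk' n)
    have h2 := congrArg (fun A : Module.End ℂ SPoly => A (bos p)) (Jpos_Phi hk n)
    simp only [LinearMap.sub_apply, Module.End.mul_apply, map_sub, bos_psi, hp] at h1 h2 ⊢
    rw [sub_eq_iff_eq_add.mp h1, sub_eq_iff_eq_add.mp h2]

/-- J_{-k} on the vacuum is quadratic in the bosons on one side and multiplication by a time on the
other, so a direct comparison is hard. The difference, however, is killed by all J_i with i > 0 and
all Φ_m with m < 0 and has no vacuum component, hence vanishes. -/
theorem bos_JD_neg_one {k : ℕ} (hk : Odd k) : bos (JD (-k : ℤ) 1) = Jneg k svac := by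
  have hk' : Odd (-k : ℤ) := Odd.neg (by exact_mod_cast hk)
  rw [← sub_eq_zero]
  refine eq_zero_of_vacuum (fun i hi => ?_) (fun m hm => ?_) ?_
  · have h := congrArg (fun A : Module.End ℂ SPoly => A svac) (Jpos_Jneg hi hk)
    simp only [LinearMap.sub_apply, Module.End.mul_apply] at h
    rw [show Jpos i svac = 0 from Jpos_one i ∅, map_zero, sub_zero] at h
    rw [map_sub, ← bos_JD_pos hi, JD_JD_neg_one hi hk, map_smul, bos_one, h]
    by_cases hik : i = k
    · subst hik; simp
    · rw [if_neg hik, if_neg (Ne.symm hik)]; simp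
  · have h1 := congrArg (fun A : Module.End ℂ Poly => A 1) (JD_psi hk' m)
    have h2 := congrArg (fun A : Module.End ℂ SPoly => A svac) (Jneg_Phi hk m)
    simp only [LinearMap.sub_apply, Module.End.mul_apply, psi_one hm, Phi_svac hm, map_zero,
      zero_sub] at h1 h2
    rw [map_sub, ← bos_psi, ← neg_neg (psi m _), h1, ← neg_neg (Phi m _), h2, sub_neg_eq_add,
      map_neg, bos_psi, bos_one, sub_neg_eq_add, neg_add_cancel]
  · rw [map_sub, svev_Jneg, sub_zero, JD_neg_one hk, map_smul, map_sum, map_smul, map_sum,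
      Finset.sum_eq_zero, smul_zero]
    intro j _
    rw [map_smul, map_smul, bos_psi, svev_Phi, smul_zero]

theorem bos_JD_neg {k : ℕ} (hk : Odd k) (p : Poly) : bos (JD (-k : ℤ) p) = Jneg k (bos p) := by
  have hk' : Odd (-k : ℤ) := Odd.neg (by exact_mod_cast hk)
  induction p using psi_induction with
  | h1 => rw [bos_JD_neg_one hk, bos_one]
  | hadd p q hp hq => rw [map_add, map_add, map_add, map_add, hp, hq]
  | hsmul c p hp => rw [map_smul, map_smul, map_smul, map_smul, hp]
  | hpsi n p hp =>
    have h1 := congrArg (fun A : Module.End ℂ Poly => bos (A p)) (JD_psi hk' n)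
    have h2 := congrArg (fun A : Module.End ℂ SPoly => A (bos p)) (Jneg_Phi hk n)
    simp only [LinearMap.sub_apply, Module.End.mul_apply, map_sub, bos_psi, hp] at h1 h2 ⊢
    rw [sub_eq_iff_eq_add.mp h1, sub_eq_iff_eq_add.mp h2, sub_neg_eq_add]

/-- Vertex operators are compatible with maps intertwining the currents. -/
theorem vop_intertwine {M M' : Type} [AddCommGroup M] [Module ℂ M] [AddCommGroup M'] [Module ℂ M']
    {T : M →ₗ[ℂ] M'} {J : ℕ → Module.End ℂ M} {J' : ℕ → Module.End ℂ M'} {c : ℂ}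
    (h : ∀ k, Odd k → ∀ x, T (J k x) = J' k (T x)) (n : ℕ) (x : M) :
    T (PowerSeries.coeff n (vop c J) x) = PowerSeries.coeff n (vop c J') (T x) := by
  refine fexp_rel (fun (A : Module.End ℂ M) (A' : Module.End ℂ M') => ∀ x, T (A x) = A' (T x))
    (by simp) (by simp) (fun A A' B B' hA hB x => by simp [hA, hB])
    (fun c A A' hA x => by simp [hA]) (fun A A' B B' hA hB x => by simp [hA, hB]) (fun a x => ?_)
    (Finsupp.single () n) x
  have e : a = Finsupp.single () (a ()) := by ext; simp
  rw [e]
  change T (PowerSeries.coeff (a ()) (PowerSeries.mk fun k : ℕ =>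
    if Odd k then (c / k) • J k else 0) x) = PowerSeries.coeff (a ()) (PowerSeries.mk fun k : ℕ =>
    if Odd k then (c / k) • J' k else 0) (T x)
  rw [PowerSeries.coeff_mk, PowerSeries.coeff_mk]
  split_ifs with hk
  · simp [h _ hk]
  · simp

theorem bos_vop_pos (c : ℂ) (n : ℕ) (p : Poly) :
    bos (PowerSeries.coeff n (vop c fun k => JD (k : ℤ)) p) =
      PowerSeries.coeff n (vop c Jpos) (bos p) :=
  vop_intertwine (fun _ hk => bos_JD_pos hk) n p

theorem bos_vop_neg (c : ℂ) (n : ℕ) (p : Poly) :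
    bos (PowerSeries.coeff n (vop c fun k => JD (-k : ℤ)) p) =
      PowerSeries.coeff n (vop c Jneg) (bos p) :=
  vop_intertwine (fun _ hk => bos_JD_neg hk) n p

/-- Pulled back along the injective map `bos`. -/
theorem locNil_vop_JD (c : ℂ) : LocNil (vop c fun k => JD (k : ℤ)) := by
  intro p
  obtain ⟨P, hP⟩ := locNil_vop_Jpos c (bos p)
  refine ⟨P, fun n hn => bos_injective ?_⟩
  rw [bos_vop_pos, hP n hn, map_zero]

/-- The fermionic field on the dual Fock space. -/
def thetaD : ℤ → Module.End ℂ Poly :=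
  dress (vop 2 fun k => JD (-k : ℤ)) psi (vop (-2) fun k => JD (k : ℤ))

/-- `thetaD` is dressed from ψ as θ is recovered from Φ in `dress_Phi`, and `bos` intertwines each
of the three factors. -/
theorem bos_thetaD (l : ℤ) (p : Poly) : bos (thetaD l p) = theta l (bos p) := by
  rw [← dress_Phi, dress_apply lowNil_Phi (locNil_vop_Jpos (-2)), thetaD,
    dress_apply lowNil_psi (locNil_vop_JD (-2))]
  refine (map_finsum bos (locFin_dress (B := vop 2 fun k => JD (-k : ℤ)) lowNil_psi
    (locNil_vop_JD (-2)) l p)).trans (finsum_congr fun q => ?_)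
  rw [Module.End.mul_apply, Module.End.mul_apply, bos_vop_neg, bos_psi, bos_vop_pos]

/-- The range contains the vacuum and is stable under the Grassmann times (through `thetaD`) and
under the even times (through the negative currents). -/
theorem bos_surjective : Function.Surjective bos := by
  rw [← LinearMap.range_eq_top, eq_top_iff]
  have hc : ∀ (n : ℕ) s, s ∈ LinearMap.range bos → crea n s ∈ LinearMap.range bos := by
    rintro n _ ⟨p, rfl⟩
    have h := bos_thetaD n p
    change _ = ((2 : ℂ) • crea n) (bos p) at h
    refine ⟨(2 : ℂ)⁻¹ • thetaD n p, ?_⟩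
    rw [map_smul, h, LinearMap.smul_apply, smul_smul]
    norm_num
  have h1 : ∀ α : Finset ℕ, xi α 1 ∈ LinearMap.range bos := by
    intro α
    induction α using Finset.induction_on with
    | empty => exact ⟨1, bos_one⟩
    | insert n α hn ih =>
      have h := hc n _ ih
      rw [crea_xi, if_neg hn] at h
      have h2 := Submodule.smul_mem _ (sgn n α) h
      rwa [smul_smul, sgn_mul_self, one_smul] at h2
  rintro s -
  induction s using SPoly.induction with
  | h0 => exact Submodule.zero_mem _
  | hadd s s' hs hs' => exact Submodule.add_mem _ hs hs'
  | hxi α f =>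
    induction f using MvPolynomial.induction_on with
    | C a =>
      rw [← mul_one (MvPolynomial.C a), ← MvPolynomial.smul_eq_C_mul, map_smul]
      exact Submodule.smul_mem _ _ (h1 α)
    | add f g hf hg => rw [map_add]; exact Submodule.add_mem _ hf hg
    | mul_X f n hf =>
      obtain ⟨p, hp⟩ := hf
      refine ⟨-JD (-(2 * n + 1 : ℕ) : ℤ) p, ?_⟩
      have h3 : (2 * n + 1) / 2 = n := by omega
      rw [map_neg, bos_JD_neg ⟨n, rfl⟩, hp, Jneg_xi, neg_neg, h3, mul_comm]

/-- The bosonisation map as a linear equivalence. -/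
def bosEquiv : Poly ≃ₗ[ℂ] SPoly := LinearEquiv.ofBijective bos ⟨bos_injective, bos_surjective⟩

theorem bos_symm (s : SPoly) : bos (bosEquiv.symm s) = s := bosEquiv.apply_symm_apply s

theorem bosEquiv_symm_eq {s : SPoly} {p : Poly} (h : bos p = s) : bosEquiv.symm s = p :=
  (LinearEquiv.symm_apply_eq _).mpr h.symm

/-! ### The pairing of polynomials with power series -/

theorem finsupp_nat_induction {P : (ℕ →₀ ℕ) → Prop} (h0 : P 0)
    (hs : ∀ a k, P a → P (a + Finsupp.single k 1)) (a : ℕ →₀ ℕ) : P a := by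
  obtain ⟨d, hd⟩ : ∃ d, d = a.degree := ⟨_, rfl⟩
  induction d generalizing a with
  | zero =>
    rw [(Finsupp.degree_eq_zero_iff a).mp hd.symm]
    exact h0
  | succ d ih =>
    have ha : a ≠ 0 := by rintro rfl; simp at hd
    obtain ⟨n, hn⟩ := Finsupp.support_nonempty_iff.mpr ha
    rw [Finsupp.mem_support_iff] at hn
    have hle : Finsupp.single n 1 ≤ a := by
      rw [Finsupp.single_le_iff]; omega
    obtain ⟨b, rfl⟩ := exists_add_of_le hle
    rw [add_comm] at hd ⊢
    exact hs b n (ih b (by simp at hd; omega))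

/-- The factorial of a multi-index. -/
def fac (a : ℕ →₀ ℕ) : ℂ := a.prod fun _ n => (n.factorial : ℂ)

theorem fac_zero : fac 0 = 1 := Finsupp.prod_zero_index

theorem fac_add_single (a : ℕ →₀ ℕ) (k : ℕ) :
    fac (a + Finsupp.single k 1) = (a k + 1) * fac a := by
  have h1 : fac a = ∏ i ∈ insert k a.support, ((a i).factorial : ℂ) :=
    Finsupp.prod_of_support_subset a (subset_insert _ _) _ (by simp)
  have h2 : fac (a + Finsupp.single k 1) =
      ∏ i ∈ insert k a.support, (((a + Finsupp.single k 1 : ℕ →₀ ℕ) i).factorial : ℂ) :=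
    Finsupp.prod_of_support_subset _ (fun i hi => by
      rw [Finsupp.mem_support_iff] at hi
      rw [mem_insert, Finsupp.mem_support_iff]
      by_contra h
      push Not at h
      exact hi (by simp [h.2, Ne.symm h.1])) _ (by simp)
  rw [h1, h2, ← Finset.mul_prod_erase _ _ (mem_insert_self k a.support),
    ← Finset.mul_prod_erase (a := k) _ _ (mem_insert_self k a.support), ← mul_assoc]
  congr 1
  · simp [Nat.factorial_succ]
  · refine Finset.prod_congr rfl fun i hi => ?_
    have : i ≠ k := (mem_erase.mp hi).1
    simp [Ne.symm this]

theorem fac_ne_zero (a : ℕ →₀ ℕ) : fac a ≠ 0 := by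
  rw [fac, Finsupp.prod, Finset.prod_ne_zero_iff]
  intro i _
  exact_mod_cast (a i).factorial_ne_zero

/-- The pairing `⟨p, f⟩ = (p(∂) f)(0)` of polynomials and power series. -/
def pair : MvPowerSeries ℕ ℂ →ₗ[ℂ] Poly →ₗ[ℂ] ℂ where
  toFun f := (MvPolynomial.basisMonomials ℕ ℂ).constr ℂ fun a => fac a * MvPowerSeries.coeff a f
  map_add' f g := by
    rw [← map_add]
    congr 1
    funext a
    simp [mul_add]
  map_smul' c f := by
    rw [RingHom.id_apply, ← map_smul]
    congr 1
    funext a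
    simp [mul_left_comm]

theorem pair_monomial (f : MvPowerSeries ℕ ℂ) (a : ℕ →₀ ℕ) :
    pair f (MvPolynomial.monomial a 1) = fac a * MvPowerSeries.coeff a f := by
  have h := (MvPolynomial.basisMonomials ℕ ℂ).constr_basis ℂ
    (fun a => fac a * MvPowerSeries.coeff a f) a
  rwa [MvPolynomial.coe_basisMonomials] at h

theorem poly_hom_ext {M : Type*} [AddCommMonoid M] [Module ℂ M] {A B : Poly →ₗ[ℂ] M}
    (h : ∀ a, A (MvPolynomial.monomial a 1) = B (MvPolynomial.monomial a 1)) : A = B :=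
  (MvPolynomial.basisMonomials ℕ ℂ).ext fun a => by
    rw [MvPolynomial.coe_basisMonomials]; exact h a

theorem pair_injective : Function.Injective pair := by
  intro f g h
  ext a
  have h1 := congrArg (fun A => A (MvPolynomial.monomial a 1)) h
  simp only [pair_monomial] at h1
  exact mul_left_cancel₀ (fac_ne_zero a) h1

/-- Every linear functional on polynomials is represented; this is where the completeness of the
Fock space enters the bijectivity of σ. -/
theorem pair_surjective : Function.Surjective pair := by
  intro A
  obtain ⟨f, hf⟩ : ∃ f : MvPowerSeries ℕ ℂ, ∀ a, MvPowerSeries.coeff a f =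
      (fac a)⁻¹ * A (MvPolynomial.monomial a 1) := ⟨fun a => _, fun a => rfl⟩
  refine ⟨f, poly_hom_ext fun a => ?_⟩
  rw [pair_monomial, hf, mul_inv_cancel_left₀ (fac_ne_zero a)]

theorem pair_X_mul (k : ℕ) (f : MvPowerSeries ℕ ℂ) (p : Poly) :
    pair (MvPowerSeries.X k * f) p = pair f (MvPolynomial.pderiv k p) := by
  suffices h : pair (MvPowerSeries.X k * f) =
      pair f ∘ₗ (MvPolynomial.pderiv k : Derivation ℂ Poly Poly).toLinearMap by rw [h]; rfl
  refine poly_hom_ext fun a => ?_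
  rw [pair_monomial, LinearMap.comp_apply, Derivation.coeFn_coe, MvPolynomial.pderiv_monomial,
    MvPowerSeries.X, MvPowerSeries.coeff_monomial_mul]
  split_ifs with h
  · obtain ⟨b, rfl⟩ := exists_add_of_le h
    have e : Finsupp.single k 1 + b - Finsupp.single k 1 = b := by
      rw [add_tsub_cancel_left]
    rw [e, add_comm _ b, fac_add_single]
    have : MvPolynomial.monomial b ((1 : ℂ) * ((b + Finsupp.single k 1 : ℕ →₀ ℕ) k : ℕ)) =
        ((b k + 1 : ℂ)) • MvPolynomial.monomial b (1 : ℂ) := by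
      rw [MvPolynomial.smul_monomial]; simp
    rw [this, map_smul, pair_monomial, smul_eq_mul]
    ring
  · have : a k = 0 := by
      by_contra h'
      exact h (by rw [Finsupp.single_le_iff]; omega)
    simp [this]

theorem pair_pderiv (k : ℕ) (f : MvPowerSeries ℕ ℂ) (p : Poly) :
    pair (MvPowerSeries.pderiv ℂ k f) p = pair f (MvPolynomial.X k * p) := by
  suffices h : pair (MvPowerSeries.pderiv ℂ k f) =
      pair f ∘ₗ LinearMap.mulLeft ℂ (MvPolynomial.X k) by rw [h]; rfl
  refine poly_hom_ext fun a => ?_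
  rw [pair_monomial, LinearMap.comp_apply, LinearMap.mulLeft_apply, MvPolynomial.X,
    MvPolynomial.monomial_mul, mul_one, pair_monomial, MvPowerSeries.coeff_pderiv, add_comm _ a,
    fac_add_single]
  ring

theorem pair_phi (m : ℤ) (f : Fock) (p : Poly) : pair (phi m f) p = pair f (psi (-1 - m) p) := by
  rcases m with k | k
  · have e : -1 - Int.ofNat k = Int.negSucc k := by rw [Int.negSucc_eq]; simp; ring
    rw [e, psi_negSucc, ← pair_X_mul]
    rfl
  · have e : -1 - Int.negSucc k = (k : ℤ) := by rw [Int.negSucc_eq]; ring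
    rw [e, psi_natCast, map_smul, ← pair_pderiv, phi, LinearMap.smul_apply, map_smul]
    rfl

/-- Transposition reverses the two bosons; the substitution j ↦ j + n restores the form of the
current and, n being odd, contributes the minus sign. -/
theorem pair_J {n : ℤ} (hn : Odd n) (f : Fock) (p : Poly) :
    pair (J n f) p = -pair f (JD (-n) p) := by
  suffices h : pair (J n f) = -(pair f ∘ₗ JD (-n)) by rw [h]; rfl
  refine poly_hom_ext fun a => ?_
  have h1 : MvPowerSeries.coeff a (J n f) = (1 / 2 : ℂ) * ∑ᶠ j : ℤ, (-1 : ℂ) ^ (j + 1) *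
      MvPowerSeries.coeff a (phi j (phi (-j - n - 1) f)) := by
    rw [J, dif_pos hn]
    rfl
  rw [pair_monomial, h1, LinearMap.neg_apply, LinearMap.comp_apply, JD_apply hn.neg, map_smul,
    smul_eq_mul, mul_left_comm, ← mul_neg]
  congr 1
  rw [← smul_eq_mul (fac a), smul_finsum' _ (finite_support_current n hn f a)]
  have hfin := locFin_JD hn.neg (MvPolynomial.monomial a 1)
  have h2 : pair f (∑ᶠ j : ℤ, (-1 : ℂ) ^ (j + 1) •
      psi j (psi (-j - -n - 1) (MvPolynomial.monomial a 1))) = _ := map_finsum (pair f) hfin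
  rw [h2, ← finsum_neg_distrib, ← finsum_comp_equiv (Equiv.addRight n) (f := fun j : ℤ =>
    -pair f ((-1 : ℂ) ^ (j + 1) • psi j (psi (-j - -n - 1) (MvPolynomial.monomial a 1))))]
  refine finsum_congr fun j => ?_
  rw [map_smul, smul_eq_mul, smul_eq_mul, mul_left_comm, ← pair_monomial, pair_phi, pair_phi]
  simp only [Equiv.coe_addRight]
  have e1 : -1 - (-j - n - 1) = j + n := by ring
  have e2 : -(j + n) - -n - 1 = -1 - j := by ring
  have e3 : (-1 : ℂ) ^ (j + n + 1) = -(-1) ^ (j + 1) := by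
    have : j + n + 1 = j + 1 - (-n) := by ring
    rw [this, neg_one_zpow_sub_of_odd hn.neg]
  rw [e1, e2, e3]
  ring

/-- Formal exponentials of transposed operators are transposed. -/
theorem pair_fexp {σ : Type} {A : MvPowerSeries σ (Module.End ℂ (MvPowerSeries ℕ ℂ))}
    {B : MvPowerSeries σ (Module.End ℂ Poly)}
    (h : ∀ a f p, pair (MvPowerSeries.coeff a A f) p = pair f (MvPowerSeries.coeff a B p))
    (a : σ →₀ ℕ) (f : MvPowerSeries ℕ ℂ) (p : Poly) :
    pair (MvPowerSeries.coeff a (fexp A) f) p = pair f (MvPowerSeries.coeff a (fexp B) p) :=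
  fexp_rel_anti (fun (A : Module.End ℂ (MvPowerSeries ℕ ℂ)) (B : Module.End ℂ Poly) =>
      ∀ f p, pair (A f) p = pair f (B p)) (by simp) (by simp)
    (fun A A' B B' hA hB f p => by simp [hA, hB]) (fun c A A' hA f p => by simp [hA])
    (fun A A' B B' hA hB f p => by simp [hA, hB]) h a f p

theorem pair_fexp_mk {A : ℕ → Module.End ℂ (MvPowerSeries ℕ ℂ)} {B : ℕ → Module.End ℂ Poly}
    (h : ∀ k f p, pair (A k f) p = pair f (B k p))
    (n : ℕ) (f : MvPowerSeries ℕ ℂ) (p : Poly) :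
    pair (PowerSeries.coeff n (fexp (PowerSeries.mk A)) f) p =
      pair f (PowerSeries.coeff n (fexp (PowerSeries.mk B)) p) := by
  refine pair_fexp (fun a f p => ?_) _ f p
  have e : a = Finsupp.single () (a ()) := by ext; simp
  rw [e]
  change pair (PowerSeries.coeff (a ()) (PowerSeries.mk A) f) p =
    pair f (PowerSeries.coeff (a ()) (PowerSeries.mk B) p)
  rw [PowerSeries.coeff_mk, PowerSeries.coeff_mk, h]

theorem pair_VplusInv (n : ℕ) (f : Fock) (p : Poly) :
    pair (PowerSeries.coeff n VplusInv f) p =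
      pair f (PowerSeries.coeff n (vop 2 fun k => JD (-k : ℤ)) p) := by
  refine pair_fexp_mk (fun k f p => ?_) n f p
  split_ifs with hk
  · rw [LinearMap.smul_apply, map_smul, LinearMap.smul_apply, pair_J (by exact_mod_cast hk),
      LinearMap.smul_apply, map_smul, smul_eq_mul, smul_eq_mul]
    ring
  · simp

theorem pair_VminusInv (n : ℕ) (f : Fock) (p : Poly) :
    pair (PowerSeries.coeff n VminusInv f) p =
      pair f (PowerSeries.coeff n (vop (-2) fun k => JD (k : ℤ)) p) := by
  refine pair_fexp_mk (fun k f p => ?_) n f p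
  split_ifs with hk
  · rw [LinearMap.smul_apply, map_smul, LinearMap.smul_apply,
      pair_J (Odd.neg (by exact_mod_cast hk)), neg_neg,
      LinearMap.smul_apply, map_smul, smul_eq_mul, smul_eq_mul]
    ring
  · simp

/-- Transposition exchanges the two vertex operators, and thereby the two summation indices, and
turns V_+⁻¹ and V_-⁻¹ into the dressing factors of `thetaD`. -/
theorem pair_Jhalf (m : ℤ) (f : Fock) (p : Poly) :
    pair (Jhalf m f) p = (1 / 2 : ℂ) * pair f (thetaD m p) := by
  suffices h : pair (Jhalf m f) = (1 / 2 : ℂ) • (pair f ∘ₗ thetaD m) by rw [h]; rfl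
  refine poly_hom_ext fun a => ?_
  rw [pair_monomial, MvPowerSeries.coeff_apply, Jhalf, LinearMap.smul_apply, LinearMap.comp_apply,
    smul_eq_mul, mul_left_comm]
  congr 1
  rw [thetaD, dress_apply lowNil_psi (locNil_vop_JD (-2))]
  have hfin := locFin_dress (B := vop 2 fun k => JD (-k : ℤ)) lowNil_psi
    (locNil_vop_JD (-2)) m (MvPolynomial.monomial a 1)
  have h2 : pair f (∑ᶠ p : ℕ × ℕ, PowerSeries.coeff p.2 (vop 2 fun k => JD (-k : ℤ))
      (psi (m + p.1 - p.2) (PowerSeries.coeff p.1 (vop (-2) fun k => JD (k : ℤ))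
        (MvPolynomial.monomial a 1)))) = _ := map_finsum (pair f) hfin
  have h3 : ∀ p : ℕ × ℕ, fac a * MvPowerSeries.coeff a (PowerSeries.coeff p.2 VminusInv
      (phi (-m - 1 + p.1 - p.2) (PowerSeries.coeff p.1 VplusInv f))) =
      pair f (PowerSeries.coeff p.1 (vop 2 fun k => JD (-k : ℤ)) (psi (m + p.2 - p.1)
        (PowerSeries.coeff p.2 (vop (-2) fun k => JD (k : ℤ)) (MvPolynomial.monomial a 1)))) := by
    intro p
    have e : -1 - (-m - 1 + p.1 - p.2) = m + p.2 - p.1 := by ring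
    rw [← pair_monomial, pair_VminusInv, pair_phi, pair_VplusInv, e]
  have h4 : fac a * ∑ᶠ p : ℕ × ℕ, MvPowerSeries.coeff a (PowerSeries.coeff p.2 VminusInv
      (phi (-m - 1 + p.1 - p.2) (PowerSeries.coeff p.1 VplusInv f))) =
      ∑ᶠ p : ℕ × ℕ, fac a * MvPowerSeries.coeff a (PowerSeries.coeff p.2 VminusInv
      (phi (-m - 1 + p.1 - p.2) (PowerSeries.coeff p.1 VplusInv f))) := by
    refine smul_finsum' (fac a) ?_
    refine ((hfin.preimage (Equiv.prodComm ℕ ℕ).injective.injOn)).subset fun p hp => ?_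
    intro h0
    refine hp ((mul_eq_zero.mp ((h3 p).trans ?_)).resolve_left (fac_ne_zero a))
    have h0' : PowerSeries.coeff p.1 (vop 2 fun k => JD (-k : ℤ)) (psi (m + p.2 - p.1)
        (PowerSeries.coeff p.2 (vop (-2) fun k => JD (k : ℤ)) (MvPolynomial.monomial a 1))) = 0 :=
      h0
    rw [h0', map_zero]
  rw [h2, h4, finsum_congr h3, ← finsum_comp_equiv (Equiv.prodComm ℕ ℕ)]
  rfl

/-! ### Exponentials of linear forms in the even times -/

/-- The generator `∑_k t_k L_k`. -/
def linGen {R : Type} [Ring R] (L : ℕ → R) : MvPowerSeries ℕ R :=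
  fun a => ∑ k ∈ a.support, if a = Finsupp.single k 1 then L k else 0

theorem coeff_linGen_single {R : Type} [Ring R] (L : ℕ → R) (k : ℕ) :
    MvPowerSeries.coeff (Finsupp.single k 1) (linGen L) = L k := by
  change ∑ j ∈ (Finsupp.single k 1).support,
    (if Finsupp.single k 1 = Finsupp.single j 1 then L j else 0) = L k
  rw [Finsupp.support_single _ one_ne_zero, sum_singleton, if_pos rfl]

theorem coeff_linGen_of_ne {R : Type} [Ring R] (L : ℕ → R) {a : ℕ →₀ ℕ}
    (h : ∀ k, a ≠ Finsupp.single k 1) : MvPowerSeries.coeff a (linGen L) = 0 := by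
  change ∑ j ∈ a.support, (if a = Finsupp.single j 1 then L j else 0) = 0
  exact Finset.sum_eq_zero fun k _ => if_neg (h k)

theorem linGen_rel {R R' : Type} [Ring R] [Ring R'] {r : R → R' → Prop} (h0 : r 0 0)
    {L : ℕ → R} {L' : ℕ → R'} (h : ∀ k, r (L k) (L' k)) (a : ℕ →₀ ℕ) :
    r (MvPowerSeries.coeff a (linGen L)) (MvPowerSeries.coeff a (linGen L')) := by
  by_cases ha : ∃ k, a = Finsupp.single k 1
  · obtain ⟨k, rfl⟩ := ha
    rw [coeff_linGen_single, coeff_linGen_single]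
    exact h k
  · push Not at ha
    rw [coeff_linGen_of_ne L ha, coeff_linGen_of_ne L' ha]
    exact h0

theorem coeff_zero_linGen {R : Type} [Ring R] (L : ℕ → R) :
    MvPowerSeries.coeff 0 (linGen L) = 0 :=
  coeff_linGen_of_ne L fun k h => by
    have := congrArg (fun a => a k) h
    simp at this

/-- The differential equation ∂/∂t_k e^H = L_k e^H in coefficients. It is obtained from the Euler
operator t_k ∂/∂t_k, for which the chain rule is available. -/
theorem coeff_fexp_linGen_add {R : Type} [Ring R] [Algebra ℂ R] {L : ℕ → R}
    (hL : ∀ i j, Commute (L i) (L j)) (a : ℕ →₀ ℕ) (k : ℕ) :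
    ((a k : ℂ) + 1) • MvPowerSeries.coeff (a + Finsupp.single k 1) (fexp (linGen L)) =
      L k * MvPowerSeries.coeff a (fexp (linGen L)) := by
  classical
  have hd : mapDeriv (fun a => ((a k : ℕ) : ℂ) • LinearMap.id) (linGen L) =
      MvPowerSeries.monomial (Finsupp.single k 1) (L k) := by
    ext b
    rw [coeff_mapDeriv, MvPowerSeries.coeff_monomial, LinearMap.smul_apply, LinearMap.id_apply]
    by_cases hb : ∃ j, b = Finsupp.single j 1
    · obtain ⟨j, rfl⟩ := hb
      rw [coeff_linGen_single]
      by_cases h : j = k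
      · subst h; simp
      · rw [if_neg fun h' => h (Finsupp.single_left_injective one_ne_zero h')]
        simp [Ne.symm h]
    · push Not at hb
      rw [coeff_linGen_of_ne L hb, if_neg (hb k), smul_zero]
  have hc : ∀ a b, Commute (MvPowerSeries.coeff a (linGen L))
      (MvPowerSeries.coeff b (linGen L)) := by
    intro a b
    by_cases ha : ∃ j, a = Finsupp.single j 1
    · obtain ⟨j, rfl⟩ := ha
      by_cases hb : ∃ j, b = Finsupp.single j 1
      · obtain ⟨i, rfl⟩ := hb
        rw [coeff_linGen_single, coeff_linGen_single]
        exact hL j i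
      · push Not at hb
        rw [coeff_linGen_of_ne L hb]
        exact Commute.zero_right _
    · push Not at ha
      rw [coeff_linGen_of_ne L ha]
      exact Commute.zero_left _
  have h := mapDeriv_fexp (δ := fun a => ((a k : ℕ) : ℂ) • LinearMap.id) (A := linGen L)
    (fun a b x y => by simp [add_smul]) (coeff_zero_linGen L)
    (commute_of_coeff fun a b => by
      rw [coeff_mapDeriv]
      exact (hc a b).smul_left _)
  have h1 := congrArg (MvPowerSeries.coeff (Finsupp.single k 1 + a)) h
  rw [hd, MvPowerSeries.coeff_add_monomial_mul, coeff_mapDeriv, add_comm _ a] at h1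
  rw [← h1]
  simp

/-- The time evolution on polynomial superfunctions generates all monomials. -/
theorem fexp_mulLeft_xi_one (α : Finset ℕ) (a : ℕ →₀ ℕ) :
    fac a • MvPowerSeries.coeff a (fexp (linGen fun k =>
      liftOp (LinearMap.mulLeft ℂ (MvPolynomial.X k : Poly)))) (xi α 1) =
      xi α (MvPolynomial.monomial a 1) := by
  induction a using finsupp_nat_induction with
  | h0 =>
    rw [fac_zero, one_smul, coeff_zero_fexp (coeff_zero_linGen _)]
    rfl
  | hs a k ih =>
    have h := congrArg (fun A : Module.End ℂ SPoly => A (xi α 1)) (coeff_fexp_linGen_add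
      (L := fun k => liftOp (LinearMap.mulLeft ℂ (MvPolynomial.X k : Poly))) (fun i j =>
        SPoly.end_ext fun α f => by
          simp only [Module.End.mul_apply, liftOp_xi, LinearMap.mulLeft_apply]
          rw [mul_left_comm]) a k)
    simp only [LinearMap.smul_apply, Module.End.mul_apply] at h
    rw [fac_add_single, mul_comm, mul_smul, h, ← map_smul, ih, liftOp_xi, LinearMap.mulLeft_apply,
      MvPolynomial.X, MvPolynomial.monomial_mul, mul_one, add_comm]

/-! ### The super tau function -/

theorem pair_expH (a : ℕ →₀ ℕ) (f : Fock) (p : Poly) :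
    pair (MvPowerSeries.coeff a expH f) p =
      pair f (MvPowerSeries.coeff a (fexp (linGen fun k => -JD (-(2 * k + 1 : ℕ) : ℤ))) p) := by
  refine pair_fexp (A := linGen fun k => J (2 * k + 1)) (fun a => ?_) a f p
  refine linGen_rel (r := fun (A : Module.End ℂ (MvPowerSeries ℕ ℂ)) (B : Module.End ℂ Poly) =>
    ∀ f p, pair (A f) p = pair f (B p)) (by simp) (fun k f p => ?_) a
  rw [pair_J ⟨k, rfl⟩, LinearMap.neg_apply, map_neg]
  push_cast
  rfl

theorem bos_fexp_linGen (a : ℕ →₀ ℕ) (p : Poly) :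
    bos (MvPowerSeries.coeff a (fexp (linGen fun k => -JD (-(2 * k + 1 : ℕ) : ℤ))) p) =
      MvPowerSeries.coeff a (fexp (linGen fun k =>
        liftOp (LinearMap.mulLeft ℂ (MvPolynomial.X k : Poly)))) (bos p) := by
  refine fexp_rel (fun (A : Module.End ℂ Poly) (A' : Module.End ℂ SPoly) =>
    ∀ x, bos (A x) = A' (bos x))
    (by simp) (by simp) (fun A A' B B' hA hB x => by simp [hA, hB])
    (fun c A A' hA x => by simp [hA]) (fun A A' B B' hA hB x => by simp [hA, hB]) (fun a => ?_) a p
  refine linGen_rel (r := fun (A : Module.End ℂ Poly) (A' : Module.End ℂ SPoly) =>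
    ∀ x, bos (A x) = A' (bos x)) (by simp) (fun k p => ?_) a
  have h3 : (2 * k + 1) / 2 = k := by omega
  rw [LinearMap.neg_apply, map_neg, bos_JD_neg ⟨k, rfl⟩, Jneg, h3, LinearMap.neg_apply, neg_neg]

theorem pair_one_right (f : Fock) : pair f 1 = vev f := by
  have h := pair_monomial f 0
  rw [fac_zero, one_mul] at h
  exact h

/-- The fold in `bra` runs over a list of integers obtained by coercing the sorted list of parts;
this rewrites the coercion as a map. -/
theorem bind_pure_natCast (l : List ℕ) :
    (do let a ← l; pure (a : ℤ) : List ℤ) = l.map fun n : ℕ => (n : ℤ) := by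
  induction l with
  | nil => rfl
  | cons n l ih => simpa using ih

theorem pair_foldl (l : List ℤ) (f : Fock) (p : Poly) :
    pair (l.foldl (fun x n => Jhalf n x) f) p =
      pair f (l.foldr (fun n p => (1 / 2 : ℂ) • thetaD n p) p) := by
  induction l generalizing f with
  | nil => rfl
  | cons n l ih =>
    rw [List.foldl_cons, ih, pair_Jhalf, List.foldr_cons, map_smul, smul_eq_mul]

/-- The smallest part is created first, so each new part exceeds those already present and enters
with sign 1; the factor 1/2 cancels the 2 in θ. -/
theorem bos_foldr {l : List ℕ} (hl : l.Pairwise (· > ·)) :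
    bos ((l.map fun n : ℕ => (n : ℤ)).foldr (fun n p => (1 / 2 : ℂ) • thetaD n p) 1) = xi l.toFinset 1 := by
  induction l with
  | nil => exact bos_one
  | cons n l ih =>
    rw [List.pairwise_cons] at hl
    rw [List.map_cons, List.foldr_cons, map_smul, bos_thetaD, ih hl.2, ← Int.ofNat_eq_natCast, theta,
      LinearMap.smul_apply, smul_smul, crea_xi, if_neg, List.toFinset_cons]
    · have : sgn n l.toFinset = 1 := by
        unfold sgn
        rw [filter_eq_empty_iff.mpr]
        · simp
        · intro m hm
          exact (hl.1 m (List.mem_toFinset.mp hm)).not_gt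
      rw [this]
      norm_num
    · intro h
      exact lt_irrefl n (hl.1 n (List.mem_toFinset.mp h))

/-- The functional on polynomial superfunctions that is dual to `σ(f)`. -/
def sig (f : Fock) : SPoly →ₗ[ℂ] ℂ := pair f ∘ₗ bosEquiv.symm.toLinearMap

theorem sig_apply (f : Fock) (s : SPoly) : sig f s = pair f (bosEquiv.symm s) := rfl

theorem sig_bos (f : Fock) (p : Poly) : sig f (bos p) = pair f p := by
  rw [sig_apply, bosEquiv_symm_eq rfl]

/-- The key formula: σ is the transpose of the inverse of `bos`. Transposed, the coefficient of t^a
in e^H multiplies by t^a / a!, and the product of fermionic modes in ⟨α| creates ξ_α from the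
vacuum. -/
theorem pair_sigma (f : Fock) (α : Finset ℕ) (q : Poly) : pair (sigma f α) q = sig f (xi α q) := by
  suffices h : pair (sigma f α) = sig f ∘ₗ xi α by rw [h]; rfl
  refine poly_hom_ext fun a => ?_
  have hs : (α.sort (· ≥ ·)).Pairwise (· > ·) := Finset.sortedGT_sort α |>.pairwise
  have h := bos_foldr hs
  rw [Finset.sort_toFinset] at h
  rw [pair_monomial, MvPowerSeries.coeff_apply, sigma, bra, bind_pure_natCast, ← pair_one_right, pair_foldl,
    pair_expH, LinearMap.comp_apply, ← fexp_mulLeft_xi_one, ← h, ← bos_fexp_linGen, map_smul,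
    sig_bos, smul_eq_mul]

theorem sig_J_pos (k : ℕ) (f : Fock) (s : SPoly) :
    sig (J (2 * k + 1) f) s = -sig f (Jneg (2 * k + 1) s) := by
  obtain ⟨p, rfl⟩ := bos_surjective s
  rw [sig_bos, pair_J ⟨k, rfl⟩, ← bos_JD_neg ⟨k, rfl⟩, sig_bos]
  push_cast
  rfl

theorem sig_J_neg (k : ℕ) (f : Fock) (s : SPoly) :
    sig (J (-(2 * k + 1)) f) s = -sig f (Jpos (2 * k + 1) s) := by
  obtain ⟨p, rfl⟩ := bos_surjective s
  rw [sig_bos, pair_J (Odd.neg ⟨k, rfl⟩), ← bos_JD_pos ⟨k, rfl⟩, sig_bos]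
  push_cast
  rw [neg_neg]

theorem sig_Jhalf (m : ℤ) (f : Fock) (s : SPoly) :
    sig (Jhalf m f) s = (1 / 2 : ℂ) * sig f (theta m s) := by
  obtain ⟨p, rfl⟩ := bos_surjective s
  rw [sig_bos, pair_Jhalf, ← bos_thetaD, sig_bos]

theorem sig_phi (m : ℤ) (f : Fock) (s : SPoly) : sig (phi m f) s = sig f (Phi (-1 - m) s) := by
  obtain ⟨p, rfl⟩ := bos_surjective s
  rw [sig_bos, pair_phi, ← bos_psi, sig_bos]

theorem eq_of_pair {f g : MvPowerSeries ℕ ℂ} (h : ∀ q, pair f q = pair g q) : f = g :=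
  pair_injective (LinearMap.ext h)

theorem pair_one_left (q : Poly) : pair 1 q = MvPolynomial.coeff 0 q := by
  suffices h : pair 1 = MvPolynomial.lcoeff ℂ (0 : ℕ →₀ ℕ) by rw [h]; rfl
  classical
  refine poly_hom_ext fun a => ?_
  rw [pair_monomial, MvPowerSeries.coeff_one, MvPolynomial.lcoeff_apply, MvPolynomial.coeff_monomial]
  split_ifs with h
  · rw [h, fac_zero, mul_one]
  · rw [mul_zero]

theorem svev_bos (p : Poly) : svev (bos p) = pair vac p := by
  induction p using psi_induction with
  | h1 =>
    rw [bos_one, svac, vac, pair_one_left]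
    simp [svev, SPoly.proj_xi]
  | hadd p q hp hq => rw [map_add, map_add, map_add, hp, hq]
  | hsmul c p hp => rw [map_smul, map_smul, map_smul, hp]
  | hpsi n p hp =>
    have h := pair_phi (Int.negSucc n) vac p
    have e : -1 - Int.negSucc n = (n : ℤ) := by rw [Int.negSucc_eq]; ring
    rw [phi_vac, map_zero, LinearMap.zero_apply, e] at h
    rw [bos_psi, svev_Phi, ← h]

/-- Each field is the transpose of a property of `bos`: derivatives and multiplications by times,
for even as for Grassmann times, are transposed to each other. -/
theorem isBoseFermi_sigma : IsBoseFermi sigma where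
  linear := by
    refine ⟨fun f g => funext fun α => eq_of_pair fun q => ?_,
      fun c f => funext fun α => eq_of_pair fun q => ?_⟩
    · rw [pair_sigma, Pi.add_apply, map_add, LinearMap.add_apply, pair_sigma, pair_sigma, sig_apply,
        map_add]
      rfl
    · rw [pair_sigma, Pi.smul_apply, map_smul, LinearMap.smul_apply, pair_sigma, sig_apply, map_smul]
      rfl
  bijective := by
    constructor
    · intro f g h
      have h1 : sig f = sig g := SPoly.hom_ext fun α q => by
        rw [← pair_sigma, ← pair_sigma, h]
      refine eq_of_pair fun p => ?_
      rw [← sig_bos, h1, sig_bos]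
    · intro F
      -- The family F defines a functional on superfunctions; f represents its pullback to
      -- polynomials.
      obtain ⟨f, hf⟩ := pair_surjective (SPoly.lift (fun α => pair (F α)) ∘ₗ bos)
      refine ⟨f, funext fun α => eq_of_pair fun q => ?_⟩
      rw [pair_sigma, sig_apply, hf, LinearMap.comp_apply, bos_symm, SPoly.lift_xi]
  vacuum := funext fun α => eq_of_pair fun q => by
    rw [pair_sigma]
    obtain ⟨p, hp⟩ := bos_surjective (xi α q)
    rw [← hp, sig_bos, ← svev_bos, hp, svev, LinearMap.comp_apply, SPoly.proj_xi]
    split_ifs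
    · rw [pair_one_left]; rfl
    · simp
  even_pos k f α := eq_of_pair fun q => by
    have h3 : (2 * k + 1) / 2 = k := by omega
    rw [pair_sigma, sig_J_pos, Jneg_xi, map_neg, neg_neg, h3, ← pair_sigma, ← pair_pderiv]
  even_neg k f α := eq_of_pair fun q => by
    have h3 : (2 * k + 1) / 2 = k := by omega
    rw [pair_sigma, sig_J_neg, Jpos_xi, map_smul, h3, ← pair_sigma, ← pair_X_mul, map_smul,
      LinearMap.smul_apply, smul_eq_mul, smul_eq_mul]
    push_cast
    ring
  odd_pos k f := funext fun α => eq_of_pair fun q => by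
    rw [pair_sigma, sig_Jhalf, ← Int.ofNat_eq_natCast, theta, LinearMap.smul_apply, map_smul,
      smul_eq_mul, crea_xi, dOdd]
    split_ifs
    · simp
    · rw [map_smul, map_smul, LinearMap.smul_apply, pair_sigma]
      ring
  odd_neg k f := funext fun α => eq_of_pair fun q => by
    have e : (-k - 1 : ℤ) = Int.negSucc k := by rw [Int.negSucc_eq]; ring
    rw [pair_sigma, sig_Jhalf, e, theta, LinearMap.smul_apply, map_smul,
      smul_eq_mul, anni_xi, Pi.smul_apply, mOdd]
    split_ifs
    · rw [map_smul, map_smul, map_smul, LinearMap.smul_apply, LinearMap.smul_apply, pair_sigma]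
      simp only [smul_eq_mul]
      ring
    · simp

/-! ### Parity -/

/-- The parity operator on polynomial superfunctions. -/
def parS : Module.End ℂ SPoly := SPoly.lift fun α => ((-1 : ℂ) ^ α.card) • xi α

theorem parS_xi (α : Finset ℕ) (q : Poly) : parS (xi α q) = ((-1 : ℂ) ^ α.card) • xi α q := by
  rw [parS, SPoly.lift_xi]; rfl

theorem parS_commute_liftOp (A : Module.End ℂ Poly) : Commute parS (liftOp A) :=
  SPoly.end_ext fun α f => by
    rw [Module.End.mul_apply, Module.End.mul_apply, liftOp_xi, parS_xi, parS_xi, map_smul,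
      liftOp_xi]

theorem parS_theta (l : ℤ) (s : SPoly) : parS (theta l s) = -theta l (parS s) := by
  suffices h : parS * theta l = -(theta l * parS) from
    congrArg (fun A : Module.End ℂ SPoly => A s) h
  refine SPoly.end_ext fun α f => ?_
  rw [LinearMap.neg_apply, Module.End.mul_apply, Module.End.mul_apply, parS_xi, map_smul]
  rcases l with n | n
  · rw [theta, LinearMap.smul_apply, map_smul, crea_xi]
    split_ifs with h
    · simp
    · rw [map_smul, parS_xi, card_insert_of_notMem h, pow_succ]
      simp only [smul_smul, ← neg_smul]
      congr 1; ring
  · rw [theta, LinearMap.smul_apply, map_smul, anni_xi]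
    split_ifs with h
    · rw [map_smul, parS_xi]
      simp only [smul_smul, ← neg_smul]
      rw [← card_erase_add_one h, pow_succ]
      congr 1; ring
    · simp

theorem parS_Phi (m : ℤ) (s : SPoly) : parS (Phi m s) = -Phi m (parS s) := by
  have h1 : ∀ c n, Commute parS (PowerSeries.coeff n (vop c Jpos)) := fun c n =>
    vop_commute (fun i _ => (parS_commute_liftOp _).smul_right _) n
  have h2 : ∀ c n, Commute parS (PowerSeries.coeff n (vop c Jneg)) := fun c n =>
    vop_commute (fun i _ => (parS_commute_liftOp _).neg_right) n
  rw [Phi, dress_apply lowNil_theta (locNil_vop_Jpos 2),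
    dress_apply lowNil_theta (locNil_vop_Jpos 2), ← finsum_neg_distrib]
  refine (map_finsum parS (locFin_dress (B := vop (-2) Jneg) lowNil_theta
    (locNil_vop_Jpos 2) m s)).trans (finsum_congr fun q => ?_)
  rw [Module.End.mul_apply, Module.End.mul_apply, ← Module.End.mul_apply parS, (h2 _ _).eq,
    Module.End.mul_apply, parS_theta, ← Module.End.mul_apply parS, (h1 _ _).eq,
    Module.End.mul_apply, map_neg]

/-- The parity operator on polynomials. -/
def parD : Module.End ℂ Poly := (MvPolynomial.basisMonomials ℕ ℂ).constr ℂ fun a =>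
  ((-1 : ℂ) ^ a.degree) • MvPolynomial.monomial a (1 : ℂ)

theorem parD_monomial (a : ℕ →₀ ℕ) : parD (MvPolynomial.monomial a 1) =
    ((-1 : ℂ) ^ a.degree) • MvPolynomial.monomial a (1 : ℂ) := by
  have h := (MvPolynomial.basisMonomials ℕ ℂ).constr_basis ℂ
    (fun a => ((-1 : ℂ) ^ a.degree) • MvPolynomial.monomial a (1 : ℂ)) a
  rwa [MvPolynomial.coe_basisMonomials] at h

theorem parD_psi (n : ℕ) (p : Poly) : parD (psi n p) = -psi n (parD p) := by
  suffices h : parD ∘ₗ psi n = -(psi n ∘ₗ parD) from congrArg (fun A : Poly →ₗ[ℂ] Poly => A p) h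
  refine poly_hom_ext fun a => ?_
  have hX : MvPolynomial.X n * MvPolynomial.monomial a (1 : ℂ) =
      MvPolynomial.monomial (Finsupp.single n 1 + a) 1 := by
    rw [MvPolynomial.X, MvPolynomial.monomial_mul, mul_one]
  rw [LinearMap.comp_apply, LinearMap.neg_apply, LinearMap.comp_apply, psi_natCast, parD_monomial,
    psi_natCast, map_smul, mul_smul_comm, hX, parD_monomial, map_add, Finsupp.degree_single, pow_add, pow_one, neg_one_mul, neg_smul,
    smul_neg]

/-- Both parity operators fix the vacuum and anticommute with the creation modes. -/
theorem bos_parD (p : Poly) : bos (parD p) = parS (bos p) := by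
  induction p using psi_induction with
  | h1 =>
    have h := parD_monomial 0
    rw [map_zero, pow_zero, one_smul] at h
    have h' : parD 1 = 1 := h
    rw [h', bos_one, svac, parS_xi]
    simp
  | hadd p q hp hq => rw [map_add, map_add, map_add, map_add, hp, hq]
  | hsmul c p hp => rw [map_smul, map_smul, map_smul, map_smul, hp]
  | hpsi n p hp => rw [parD_psi, map_neg, bos_psi, hp, bos_psi, parS_Phi]

/-- An even vector pairs to zero with polynomials of odd degree, hence is fixed by the transpose of
`parD`. This forces the components of σ(v) with an odd number of parts, and those of σ(φ(z)v) with
an even number, to equal their own negatives. -/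
theorem sig_parS {v : Fock} (hv : IsEven v) (s : SPoly) : sig v (parS s) = sig v s := by
  obtain ⟨p, rfl⟩ := bos_surjective s
  rw [← bos_parD, sig_bos, sig_bos]
  suffices h : pair v ∘ₗ parD = pair v from congrArg (fun A : Poly →ₗ[ℂ] ℂ => A p) h
  refine poly_hom_ext fun a => ?_
  rw [LinearMap.comp_apply, parD_monomial, map_smul, pair_monomial]
  rcases Nat.even_or_odd a.degree with h | h
  · rw [h.neg_one_pow, one_smul]
  · rw [hv a h]; simp

theorem tau_eq_zero {v : Fock} (hv : IsEven v) {α : Finset ℕ} (hα : Odd α.card) :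
    tau v α = 0 := eq_of_pair fun q => by
  have h := sig_parS hv (xi α q)
  rw [parS_xi, hα.neg_one_pow, neg_smul, one_smul, map_neg, neg_eq_self] at h
  rw [tau, pair_sigma, h]
  simp

theorem pair_g (v : Fock) (α : Finset ℕ) (m : ℤ) (q : Poly) :
    pair (g v α m) q = sig v (Phi (-1 - m) (xi α q)) := by
  rw [g, pair_sigma, sig_phi]

theorem g_eq_zero {v : Fock} (hv : IsEven v) {α : Finset ℕ} (hα : Even α.card) (m : ℤ) :
    g v α m = 0 := eq_of_pair fun q => by
  have h := sig_parS hv (Phi (-1 - m) (xi α q))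
  rw [parS_Phi, parS_xi, hα.neg_one_pow, one_smul, map_neg, neg_eq_self] at h
  rw [pair_g, h]
  simp

/-! ### The Hirota equation in components -/

/-- The bilinear form expressing the Hirota equation on polynomial superfunctions. -/
def hirotaForm (v : Fock) (s s' : SPoly) : ℂ :=
  ∑ᶠ m : ℤ, (-1 : ℂ) ^ (-1 - m) * (sig v (Phi (-1 - m) s) * sig v (Phi m s'))

theorem finite_hirotaForm (v : Fock) (s s' : SPoly) :
    (Function.support fun m : ℤ => sig v (Phi (-1 - m) s) * sig v (Phi m s')).Finite := by
  obtain ⟨N, hN⟩ := lowNil_Phi s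
  obtain ⟨N', hN'⟩ := lowNil_Phi s'
  refine (Set.finite_Icc N' (-1 - N)).subset fun m hm => ?_
  rw [Set.mem_Icc]
  by_contra h
  apply hm
  by_cases h1 : m < N'
  · simp [hN' m h1]
  · simp [hN (-1 - m) (by omega)]

theorem finite_hirotaForm' (v : Fock) (s s' : SPoly) :
    (Function.support fun m : ℤ => (-1 : ℂ) ^ (-1 - m) *
      (sig v (Phi (-1 - m) s) * sig v (Phi m s'))).Finite :=
  (finite_hirotaForm v s s').subset fun m hm h => hm (by simp only at h ⊢; rw [h, mul_zero])

theorem hirotaForm_add_left (v : Fock) (s₁ s₂ s' : SPoly) :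
    hirotaForm v (s₁ + s₂) s' = hirotaForm v s₁ s' + hirotaForm v s₂ s' := by
  rw [hirotaForm, hirotaForm, hirotaForm,
    ← finsum_add_distrib (finite_hirotaForm' v s₁ s') (finite_hirotaForm' v s₂ s')]
  exact finsum_congr fun m => by rw [map_add, map_add]; ring

theorem hirotaForm_add_right (v : Fock) (s s₁ s₂ : SPoly) :
    hirotaForm v s (s₁ + s₂) = hirotaForm v s s₁ + hirotaForm v s s₂ := by
  rw [hirotaForm, hirotaForm, hirotaForm,
    ← finsum_add_distrib (finite_hirotaForm' v s s₁) (finite_hirotaForm' v s s₂)]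
  exact finsum_congr fun m => by rw [map_add, map_add]; ring

theorem hirotaForm_smul_left (v : Fock) (c : ℂ) (s s' : SPoly) :
    hirotaForm v (c • s) s' = c * hirotaForm v s s' := by
  rw [hirotaForm, hirotaForm, ← smul_eq_mul c, smul_finsum' c (finite_hirotaForm' v s s')]
  exact finsum_congr fun m => by rw [map_smul, map_smul, smul_eq_mul, smul_eq_mul]; ring

theorem hirotaForm_smul_right (v : Fock) (c : ℂ) (s s' : SPoly) :
    hirotaForm v s (c • s') = c * hirotaForm v s s' := by
  rw [hirotaForm, hirotaForm, ← smul_eq_mul c, smul_finsum' c (finite_hirotaForm' v s s')]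
  exact finsum_congr fun m => by rw [map_smul, map_smul, smul_eq_mul, smul_eq_mul]; ring

/-- The Hirota equation as a bilinear map. -/
def hirotaMap (v : Fock) : SPoly →ₗ[ℂ] SPoly →ₗ[ℂ] ℂ :=
  LinearMap.mk₂ ℂ (hirotaForm v) (hirotaForm_add_left v) (hirotaForm_smul_left v)
    (hirotaForm_add_right v) (hirotaForm_smul_right v)

section Residues

variable {v : Fock} {A B : Poly →ₗ[ℂ] SPoly} {u w : ℤ → MvPowerSeries ℕ ℂ}

/-- A common format for the fields applied to v: with `bos` in place of `A` the series is φ(z)v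
itself, with `xi α` it is g_α. The Hirota equation and its components thus become values of the same
bilinear form. -/
theorem coeff_mul_coeff_eq_sig (hu : ∀ m q, pair (u m) q = sig v (Phi (-1 - m) (A q)))
    (hw : ∀ m q, pair (w m) q = sig v (Phi (-1 - m) (B q))) (a b : ℕ →₀ ℕ) (m : ℤ) :
    fac a * fac b * (MvPowerSeries.coeff a (u m) * MvPowerSeries.coeff b (w (-1 - m))) =
      sig v (Phi (-1 - m) (A (MvPolynomial.monomial a 1))) *
        sig v (Phi m (B (MvPolynomial.monomial b 1))) := by
  have e : -1 - (-1 - m) = m := by ring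
  rw [← hu, pair_monomial]
  have := hw (-1 - m) (MvPolynomial.monomial b 1)
  rw [e, pair_monomial] at this
  rw [← this]
  ring

theorem fac_mul_fac_ne_zero (a b : ℕ →₀ ℕ) : fac a * fac b ≠ 0 :=
  mul_ne_zero (fac_ne_zero a) (fac_ne_zero b)

/-- Residues of fields acting on `v` exist. -/
theorem finite_res (hu : ∀ m q, pair (u m) q = sig v (Phi (-1 - m) (A q)))
    (hw : ∀ m q, pair (w m) q = sig v (Phi (-1 - m) (B q))) (a b : ℕ →₀ ℕ) :
    (Function.support fun m : ℤ =>
      MvPowerSeries.coeff a (u m) * MvPowerSeries.coeff b (w (-1 - m))).Finite :=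
  (finite_hirotaForm v (A (MvPolynomial.monomial a 1))
    (B (MvPolynomial.monomial b 1))).subset fun m hm h => hm (by
      have h' := (coeff_mul_coeff_eq_sig hu hw a b m).trans h
      exact (mul_eq_zero.mp h').resolve_left (fac_mul_fac_ne_zero a b))

/-- Residues of fields acting on `v`, as values of a bilinear form. -/
theorem resZero_iff_hirotaMap (hu : ∀ m q, pair (u m) q = sig v (Phi (-1 - m) (A q)))
    (hw : ∀ m q, pair (w m) q = sig v (Phi (-1 - m) (B q))) :
    ResZero u w ↔ ∀ p q, hirotaMap v (A p) (B q) = 0 := by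
  have hres : ∀ a b : ℕ →₀ ℕ, fac a * fac b * res u w a b = hirotaMap v
      (A (MvPolynomial.monomial a 1)) (B (MvPolynomial.monomial b 1)) := by
    intro a b
    rw [res, ← smul_eq_mul (fac a * fac b), smul_finsum' _ ((finite_res hu hw a b).subset
      fun m hm h => hm (by simp only at h ⊢; rw [h, mul_zero]))]
    refine finsum_congr fun m => ?_
    rw [← coeff_mul_coeff_eq_sig hu hw, smul_eq_mul]
    ring
  constructor
  · intro h p q
    have h1 : ∀ a, hirotaMap v (A (MvPolynomial.monomial a 1)) ∘ₗ B = 0 := fun a =>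
      poly_hom_ext fun b => by
        rw [LinearMap.comp_apply, ← hres, (h a b).2, mul_zero]; rfl
    have h2 : (hirotaMap v).flip (B q) ∘ₗ A = 0 := poly_hom_ext fun a => by
      rw [LinearMap.comp_apply, LinearMap.flip_apply, ← LinearMap.comp_apply, h1]; rfl
    rw [← LinearMap.flip_apply, ← LinearMap.comp_apply, h2]; rfl
  · intro h a b
    refine ⟨finite_res hu hw a b, ?_⟩
    have := hres a b
    rw [h] at this
    exact (mul_eq_zero.mp this).resolve_left (fac_mul_fac_ne_zero a b)

end Residues

theorem hirota_iff_hirotaMap (v : Fock) : Hirota v ↔ hirotaMap v = 0 := by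
  rw [Hirota, resZero_iff_hirotaMap (v := v) (A := bos) (B := bos)
    (fun m q => by rw [← sig_bos, sig_phi]) (fun m q => by rw [← sig_bos, sig_phi])]
  constructor
  · intro h
    ext s s'
    obtain ⟨p, rfl⟩ := bos_surjective s
    obtain ⟨q, rfl⟩ := bos_surjective s'
    exact h p q
  · intro h p q
    rw [h]; rfl

theorem resZero_g_iff (v : Fock) (α β : Finset ℕ) :
    ResZero (g v α) (g v β) ↔ ∀ p q, hirotaMap v (xi α p) (xi β q) = 0 :=
  resZero_iff_hirotaMap (fun m q => pair_g v α m q) (fun m q => pair_g v β m q)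

theorem resZero_of_eq_zero {u w : ℤ → MvPowerSeries ℕ ℂ} (h : (∀ m, u m = 0) ∨ ∀ m, w m = 0) :
    ResZero u w := by
  intro a b
  have h0 : ∀ m, MvPowerSeries.coeff a (u m) * MvPowerSeries.coeff b (w (-1 - m)) = 0 := by
    intro m
    rcases h with h | h
    · rw [h, map_zero, zero_mul]
    · rw [h, map_zero, mul_zero]
  refine ⟨?_, ?_⟩
  · simp only [h0]
    simp
  · rw [res]
    exact finsum_eq_zero_of_forall_eq_zero fun m => by rw [h0, mul_zero]

/-- Since `bos` is onto, the Hirota equation says that the bilinear form vanishes on all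
superfunctions, and it suffices to test it on the ξ_α q. Partitions with an even number of parts
contribute nothing, as their g_α vanish. -/
theorem hirota_iff_resZero_g {v : Fock} (hv : IsEven v) : Hirota v ↔
    ∀ α β : Finset ℕ, Odd α.card → Odd β.card → ResZero (g v α) (g v β) := by
  rw [hirota_iff_hirotaMap]
  constructor
  · intro h α β _ _
    rw [resZero_g_iff, h]
    exact fun _ _ => rfl
  · intro h
    have h1 : ∀ α β p q, hirotaMap v (xi α p) (xi β q) = 0 := by
      intro α β
      rw [← resZero_g_iff]
      rcases Nat.even_or_odd α.card with hα | hα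
      · exact resZero_of_eq_zero (Or.inl (g_eq_zero hv hα))
      · rcases Nat.even_or_odd β.card with hβ | hβ
        · exact resZero_of_eq_zero (Or.inr (g_eq_zero hv hβ))
        · exact h α β hα hβ
    refine SPoly.hom_ext fun α p => SPoly.hom_ext fun β q => ?_
    rw [h1]; rfl

/-! ### The functions `g_α` in terms of tau functions -/

theorem coeff_powerSeriesMk {R : Type} [Semiring R] (A : ℕ → R) (a : Unit →₀ ℕ) :
    MvPowerSeries.coeff a (PowerSeries.mk A) = A (a ()) := by
  obtain ⟨k, rfl⟩ : ∃ k, a = Finsupp.single () k := ⟨a (), by ext; simp⟩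
  rw [Finsupp.single_eq_same]
  exact PowerSeries.coeff_mk (R := R) k A

/-- The transpose of multiplication by a time is a derivative, so e^{cφ} is transposed to an
exponential of derivatives; for c = 1 this is V_+ by `vop_Jpos_xi`. -/
theorem pair_expVarphi_mul (c : ℂ) (n : ℕ) (f : Times) (q : Poly) :
    pair (PowerSeries.coeff n (expVarphi c) * f) q =
      pair f (PowerSeries.coeff n (fexp (PowerSeries.mk fun k : ℕ => if Odd k then
        c • (MvPolynomial.pderiv (k / 2) : Derivation ℂ Poly Poly).toLinearMap else 0)) q) := by
  have h : ∀ (a : Unit →₀ ℕ) (f : Times) (q : Poly),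
      pair (MvPowerSeries.coeff a (expVarphi c) * f) q =
      pair f (MvPowerSeries.coeff a (fexp (PowerSeries.mk fun k : ℕ => if Odd k then
        c • (MvPolynomial.pderiv (k / 2) : Derivation ℂ Poly Poly).toLinearMap else 0)) q) := by
    refine fexp_rel_anti (fun (A : Times) (B : Module.End ℂ Poly) =>
      ∀ f q, pair (A * f) q = pair f (B q)) (by simp) (by simp)
      (fun A A' B B' hA hB f p => by simp [hA, hB, add_mul]) (fun c A A' hA f p => by simp [hA])
      (fun A A' B B' hA hB f p => by rw [mul_assoc, hA, hB]; rfl) fun a f q => ?_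
    rw [coeff_powerSeriesMk, coeff_powerSeriesMk]
    generalize a () = k
    split_ifs
    · rw [smul_mul_assoc, map_smul, LinearMap.smul_apply, pair_X_mul, LinearMap.smul_apply,
        map_smul]
      rfl
    · simp
  exact h _ f q

theorem vop_Jpos_xi (n : ℕ) (α : Finset ℕ) (q : Poly) :
    PowerSeries.coeff n (vop 2 Jpos) (xi α q) =
      xi α (PowerSeries.coeff n (fexp (PowerSeries.mk fun k : ℕ => if Odd k then
        (1 : ℂ) • (MvPolynomial.pderiv (k / 2) : Derivation ℂ Poly Poly).toLinearMap else 0)) q) := by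
  have h : ∀ (a : Unit →₀ ℕ) (q : Poly),
      MvPowerSeries.coeff a (vop 2 Jpos) (xi α q) =
      xi α (MvPowerSeries.coeff a (fexp (PowerSeries.mk fun k : ℕ => if Odd k then
        (1 : ℂ) • (MvPolynomial.pderiv (k / 2) : Derivation ℂ Poly Poly).toLinearMap else 0)) q) := by
    refine fexp_rel (fun (A : Module.End ℂ SPoly) (B : Module.End ℂ Poly) =>
      ∀ q, A (xi α q) = xi α (B q)) (by simp) (by simp)
      (fun A A' B B' hA hB p => by simp [hA, hB]) (fun c A A' hA p => by simp [hA])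
      (fun A A' B B' hA hB p => by simp [hA, hB]) fun a q => ?_
    rw [coeff_powerSeriesMk, coeff_powerSeriesMk]
    generalize a () = k
    split_ifs with hk
    · have : (k : ℂ) ≠ 0 := by exact_mod_cast hk.pos.ne'
      rw [LinearMap.smul_apply, Jpos_xi, smul_smul, one_smul]
      have e : (2 / k * (k / 2) : ℂ) = 1 := by field_simp
      rw [e, one_smul]
      rfl
    · simp
  exact h _ q

/-- V_- multiplies by exp ∑ (2/k) t_k z^k, whose transpose is the shift of the times. -/
theorem sig_vop_Jneg (f : Fock) (n : ℕ) (β : Finset ℕ) (q : Poly) :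
    sig f (PowerSeries.coeff n (vop (-2) Jneg) (xi β q)) =
      pair (PowerSeries.coeff n shift (sigma f β)) q := by
  have h1 : ∀ (a : Unit →₀ ℕ) (q : Poly),
      MvPowerSeries.coeff a (vop (-2) Jneg) (xi β q) =
      xi β (MvPowerSeries.coeff a (fexp (PowerSeries.mk fun k : ℕ => if Odd k then
        (2 / k : ℂ) • LinearMap.mulLeft ℂ (MvPolynomial.X (k / 2) : Poly) else 0)) q) := by
    refine fexp_rel (fun (A : Module.End ℂ SPoly) (B : Module.End ℂ Poly) =>
      ∀ q, A (xi β q) = xi β (B q)) (by simp) (by simp)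
      (fun A A' B B' hA hB p => by simp [hA, hB]) (fun c A A' hA p => by simp [hA])
      (fun A A' B B' hA hB p => by simp [hA, hB]) fun a q => ?_
    rw [coeff_powerSeriesMk, coeff_powerSeriesMk]
    generalize a () = k
    split_ifs with hk
    · rw [LinearMap.smul_apply, Jneg_xi, LinearMap.smul_apply, map_smul, smul_neg, ← neg_smul]
      congr 1
      ring
    · simp
  have h2 := pair_fexp_mk (A := fun k : ℕ => if Odd k then
    (2 / k : ℂ) • (MvPowerSeries.pderiv ℂ (k / 2) : Derivation ℂ Times Times).toLinearMap else 0)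
    (B := fun k : ℕ => if Odd k then
        (2 / k : ℂ) • LinearMap.mulLeft ℂ (MvPolynomial.X (k / 2) : Poly) else 0)
    (fun k f p => by
      split_ifs
      · rw [LinearMap.smul_apply, map_smul, LinearMap.smul_apply, LinearMap.smul_apply, map_smul,
          LinearMap.mulLeft_apply, ← pair_pderiv]
        rfl
      · simp) n (sigma f β) q
  have h3 := h1 (Finsupp.single () n) q
  rw [PowerSeries.coeff, h3, ← pair_sigma]
  exact h2.symm

theorem sig_vop_theta (v : Fock) (n : ℕ) (l : ℤ) (α : Finset ℕ) (q : Poly) :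
    sig v (PowerSeries.coeff n (vop (-2) Jneg) (theta l (xi α q))) =
      pair (PowerSeries.coeff n shift (bracket v α (-1 - l))) q := by
  rcases l with k | k
  · have e : -1 - Int.ofNat k = Int.negSucc k := by rw [Int.negSucc_eq]; simp; ring
    rw [e, theta, LinearMap.smul_apply, crea_xi, bracket]
    split_ifs
    · simp
    · rw [smul_smul, map_smul, map_smul, sig_vop_Jneg, map_smul, map_smul, LinearMap.smul_apply]
      rfl
  · have e : -1 - Int.negSucc k = Int.ofNat k := by rw [Int.negSucc_eq]; simp
    rw [e, theta, LinearMap.smul_apply, anni_xi, bracket]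
    split_ifs
    · rw [smul_smul, map_smul, map_smul, sig_vop_Jneg, map_smul, map_smul, LinearMap.smul_apply, tau]
      congr 1
      ring
    · simp

theorem bracket_eq_zero (v : Fock) (α : Finset ℕ) {m : ℤ} (hm : (top α : ℤ) < m) :
    bracket v α m = 0 := by
  obtain ⟨n, rfl⟩ := Int.eq_ofNat_of_zero_le (by omega : 0 ≤ m)
  rw [← Int.ofNat_eq_natCast, bracket, if_neg]
  intro hn
  have : n ≤ top α := Finset.le_sup (f := id) hn
  omega

theorem applyShift_eq {u : ℤ → Times} {M : ℤ} (hu : ∀ m, M < m → u m = 0) {m : ℤ} {N : ℕ}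
    (hN : M < m + N) :
    applyShift u m = ∑ n ∈ range N, PowerSeries.coeff n shift (u (m + n)) := by
  ext a
  rw [MvPowerSeries.coeff_apply, applyShift, map_sum]
  refine finsum_eq_sum_of_support_subset _ fun n hn => ?_
  rw [Finset.mem_coe, mem_range]
  by_contra h
  exact hn (by beta_reduce; rw [hu _ (by omega), map_zero, map_zero])

/-- Transpose of Φ = V_- θ V_+ on ξ_α q, factor by factor: V_+ gives e^φ, V_- the shift, and θ the
bracket, with creation modes yielding τ_{α∪ν} and annihilation modes τ_{α∖α_i}. -/
theorem g_eq (v : Fock) (α : Finset ℕ) : g v α = mulExp 1 (applyShift (bracket v α)) := by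
  funext m
  ext a
  have hfin := locFin_dress (B := vop (-2) Jneg) lowNil_theta (locNil_vop_Jpos 2) (-1 - m)
    (xi α (MvPolynomial.monomial a 1))
  have h1 : sig v (Phi (-1 - m) (xi α (MvPolynomial.monomial a 1))) = _ :=
    (congrArg (sig v) (dress_apply lowNil_theta (locNil_vop_Jpos 2) _ _)).trans
      (map_finsum (sig v) hfin)
  have h2 : ∀ p : ℕ × ℕ, sig v (PowerSeries.coeff p.2 (vop (-2) Jneg)
      (theta (-1 - m + p.1 - p.2) (PowerSeries.coeff p.1 (vop 2 Jpos)
        (xi α (MvPolynomial.monomial a 1))))) =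
      fac a * MvPowerSeries.coeff a (PowerSeries.coeff p.1 (expVarphi 1) *
        PowerSeries.coeff p.2 shift (bracket v α (m - p.1 + p.2))) := by
    intro p
    have e : -1 - (-1 - m + p.1 - p.2) = m - p.1 + p.2 := by ring
    rw [vop_Jpos_xi, sig_vop_theta, e,
      ← pair_expVarphi_mul, pair_monomial]
  have hfin' : (Function.support fun p : ℕ × ℕ =>
      MvPowerSeries.coeff a (PowerSeries.coeff p.1 (expVarphi 1) *
        PowerSeries.coeff p.2 shift (bracket v α (m - p.1 + p.2)))).Finite :=
    hfin.subset fun p hp h => hp (by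
      have := h2 p
      simp only [Module.End.mul_apply] at h
      rw [h, map_zero] at this
      exact (mul_eq_zero.mp this.symm).resolve_left (fac_ne_zero a))
  refine mul_left_cancel₀ (fac_ne_zero a) ?_
  rw [← pair_monomial, pair_g, h1, MvPowerSeries.coeff_apply, mulExp, finsum_congr h2]
  have h3 := smul_finsum' (fac a) hfin'
  simp only [smul_eq_mul] at h3
  -- The double sum over the orders of V_+ and V_- is finite, so it may be iterated; the inner sum
  -- is the shift applied to the bracket.
  rw [← h3, finsum_curry _ hfin']
  congr 1
  refine finsum_congr fun p => ?_
  obtain ⟨N, hN⟩ : ∃ N : ℕ, (top α : ℤ) < m - p + N := ⟨(top α - m + p + 1).toNat, by omega⟩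
  rw [applyShift_eq (fun m hm => bracket_eq_zero v α hm) hN, Finset.mul_sum, map_sum]
  refine finsum_eq_sum_of_support_subset _ fun n hn => ?_
  rw [Finset.mem_coe, mem_range]
  by_contra h
  exact hn (by beta_reduce; rw [bracket_eq_zero v α (by simp only; omega), map_zero, mul_zero,
    map_zero])

/-! ### Multiplication by `e^{cφ(t,z)}` -/

/-- The weight of a monomial in the even times, `t_{2k+1}` having weight `2k+1`. -/
def wt : (ℕ →₀ ℕ) →+ ℕ := Finsupp.weight fun k => 2 * k + 1

theorem wt_single (k : ℕ) : wt (Finsupp.single k 1) = 2 * k + 1 := by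
  simp [wt, Finsupp.weight_single]

theorem coeff_zero_varphi (c : ℂ) : MvPowerSeries.coeff 0 (PowerSeries.mk fun k : ℕ =>
    if Odd k then c • (MvPowerSeries.X (k / 2) : Times) else 0) = 0 := by
  rw [coeff_powerSeriesMk]; simp

theorem coeff_zero_expVarphi (c : ℂ) : PowerSeries.coeff 0 (expVarphi c) = 1 := by
  rw [PowerSeries.coeff, Finsupp.single_zero]
  exact coeff_zero_fexp (coeff_zero_varphi c)

theorem expVarphi_euler (c : ℂ) (n : ℕ) : (n : ℂ) • PowerSeries.coeff n (expVarphi c) =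
    ∑ p ∈ antidiagonal n, ((p.1 : ℂ) • if Odd p.1 then c • (MvPowerSeries.X (p.1 / 2) : Times)
      else 0) * PowerSeries.coeff p.2 (expVarphi c) := by
  have h := fexp_euler (A := PowerSeries.mk fun k : ℕ =>
    if Odd k then c • (MvPowerSeries.X (k / 2) : Times) else 0) (by simp)
    (fun i j => Commute.all _ _) n
  simp only [PowerSeries.coeff_mk] at h
  exact h

/-- The coefficient of `z^n` in `e^{cφ}` is homogeneous of weight `n`. -/
theorem coeff_expVarphi_eq_zero (c : ℂ) (n : ℕ) {a : ℕ →₀ ℕ} (h : wt a ≠ n) :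
    MvPowerSeries.coeff a (PowerSeries.coeff n (expVarphi c)) = 0 := by
  classical
  induction n using Nat.strong_induction_on generalizing a with
  | _ n ih =>
  by_cases hn : n = 0
  · subst hn
    rw [coeff_zero_expVarphi, MvPowerSeries.coeff_one, if_neg]
    rintro rfl
    exact h (map_zero _)
  have h1 := congrArg (MvPowerSeries.coeff a) (expVarphi_euler c n)
  rw [map_smul, map_sum, Finset.sum_eq_zero] at h1
  · exact (smul_eq_zero.mp h1).resolve_left (by exact_mod_cast hn)
  · intro p hp
    rw [HasAntidiagonal.mem_antidiagonal] at hp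
    split_ifs with ho
    · rw [smul_smul, smul_mul_assoc, map_smul, MvPowerSeries.X, MvPowerSeries.coeff_monomial_mul]
      split_ifs with hle
      · obtain ⟨b, rfl⟩ := exists_add_of_le hle
        have e : Finsupp.single (p.1 / 2) 1 + b - Finsupp.single (p.1 / 2) 1 = b := by
          rw [add_tsub_cancel_left]
        rw [map_add, wt_single] at h
        have := ho.pos
        obtain ⟨r, hr⟩ := ho
        rw [e, ih p.2 (by omega) (by omega), mul_zero, smul_zero]
      · exact smul_zero _
    · simp

theorem coeff_mul_eq_zero_of_wt {f g : Times} {n : ℕ} (hf : ∀ a, wt a < n →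
    MvPowerSeries.coeff a f = 0) {a : ℕ →₀ ℕ} (ha : wt a < n) :
    MvPowerSeries.coeff a (f * g) = 0 := by
  classical
  rw [MvPowerSeries.coeff_mul]
  refine Finset.sum_eq_zero fun p hp => ?_
  rw [HasAntidiagonal.mem_antidiagonal] at hp
  rw [hf, zero_mul]
  rw [← hp, map_add] at ha
  omega

theorem coeff_expVarphi_mul_eq_zero (c : ℂ) {n : ℕ} (f : Times) {a : ℕ →₀ ℕ} (h : wt a < n) :
    MvPowerSeries.coeff a (PowerSeries.coeff n (expVarphi c) * f) = 0 :=
  coeff_mul_eq_zero_of_wt (fun _ hb => coeff_expVarphi_eq_zero c n hb.ne) h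

theorem coeff_expVarphi_mul_mul_eq_zero (c c' : ℂ) {n k : ℕ} (f : Times) {a : ℕ →₀ ℕ}
    (h : wt a < n + k) : MvPowerSeries.coeff a (PowerSeries.coeff n (expVarphi c) *
      (PowerSeries.coeff k (expVarphi c') * f)) = 0 := by
  classical
  rw [MvPowerSeries.coeff_mul]
  refine Finset.sum_eq_zero fun p hp => ?_
  rw [HasAntidiagonal.mem_antidiagonal] at hp
  rw [← hp, map_add] at h
  by_cases h1 : wt p.1 = n
  · rw [coeff_expVarphi_mul_eq_zero c' f (by omega), mul_zero]
  · rw [coeff_expVarphi_eq_zero c n h1, zero_mul]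

/-- By homogeneity only orders n ≤ wt a contribute at the monomial a. All manipulations of `mulExp`
thus take place in finite sums, with an arbitrary bound beyond the weight. -/
theorem coeff_mulExp (c : ℂ) (u : ℤ → Times) (m : ℤ) {a : ℕ →₀ ℕ} {L : ℕ} (h : wt a < L) :
    MvPowerSeries.coeff a (mulExp c u m) = ∑ n ∈ range L,
      MvPowerSeries.coeff a (PowerSeries.coeff n (expVarphi c) * u (m - n)) := by
  rw [MvPowerSeries.coeff_apply, mulExp]
  refine finsum_eq_sum_of_support_subset _ fun n hn => ?_
  rw [Finset.mem_coe, mem_range]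
  by_contra h'
  exact hn (coeff_expVarphi_mul_eq_zero c _ (by omega))

theorem coeff_mul_mulExp (f : Times) (c : ℂ) (u : ℤ → Times) (m : ℤ) {a : ℕ →₀ ℕ} {L : ℕ}
    (h : wt a < L) : MvPowerSeries.coeff a (f * mulExp c u m) = ∑ n ∈ range L,
      MvPowerSeries.coeff a (f * (PowerSeries.coeff n (expVarphi c) * u (m - n))) := by
  classical
  simp only [MvPowerSeries.coeff_mul (φ := f)]
  rw [Finset.sum_comm]
  refine Finset.sum_congr rfl fun p hp => ?_
  rw [HasAntidiagonal.mem_antidiagonal] at hp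
  rw [coeff_mulExp c u m (L := L) (by rw [← hp, map_add] at h; omega), Finset.mul_sum]

theorem mulExp_congr_coeff {c : ℂ} {u : ℤ → Times} {w : ℤ → Times}
    (h : ∀ m a L, wt a < L → MvPowerSeries.coeff a (w m) = ∑ n ∈ range L,
      MvPowerSeries.coeff a (PowerSeries.coeff n (expVarphi c) * u (m - n))) :
    mulExp c u = w := by
  funext m
  ext a
  rw [coeff_mulExp c u m (Nat.lt_succ_self _), h m a _ (Nat.lt_succ_self _)]

theorem mulExp_add (c : ℂ) (u w : ℤ → Times) :
    mulExp c (fun m => u m + w m) = fun m => mulExp c u m + mulExp c w m :=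
  mulExp_congr_coeff fun m a L h => by
    rw [map_add, coeff_mulExp c u m h, coeff_mulExp c w m h, ← Finset.sum_add_distrib]
    exact Finset.sum_congr rfl fun n _ => by rw [mul_add, map_add]

theorem mulExp_mul (c : ℂ) (f : Times) (u : ℤ → Times) :
    mulExp c (fun m => f * u m) = fun m => f * mulExp c u m :=
  mulExp_congr_coeff fun m a L h => by
    rw [coeff_mul_mulExp f c u m h]
    exact Finset.sum_congr rfl fun n _ => by rw [mul_left_comm]

theorem mulExp_smul (c r : ℂ) (u : ℤ → Times) :
    mulExp c (fun m => r • u m) = fun m => r • mulExp c u m := by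
  have h := mulExp_mul c (MvPowerSeries.C r) u
  simp only [← MvPowerSeries.smul_eq_C_mul] at h
  exact h

theorem sum_range_range_eq_sum_antidiagonal {M : Type*} [AddCommMonoid M] {F : ℕ → ℕ → M} {L : ℕ}
    (h : ∀ n k, L ≤ n + k → F n k = 0) : ∑ n ∈ range L, ∑ k ∈ range L, F n k =
      ∑ j ∈ range L, ∑ p ∈ antidiagonal j, F p.1 p.2 := by
  rw [← Finset.sum_product', ← Finset.sum_filter_of_ne (p := fun p : ℕ × ℕ => p.1 + p.2 < L)
    (fun p _ hp => by by_contra h'; exact hp (h _ _ (by omega)))]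
  rw [← Finset.sum_fiberwise_of_maps_to (g := fun p : ℕ × ℕ => p.1 + p.2) (t := range L)
    (fun p hp => by rw [mem_range]; exact (mem_filter.mp hp).2)]
  refine Finset.sum_congr rfl fun j hj => Finset.sum_congr ?_ fun _ _ => rfl
  rw [mem_range] at hj
  ext p
  simp only [mem_filter, mem_product, mem_range, HasAntidiagonal.mem_antidiagonal]
  omega

theorem expVarphi_mul_neg (c : ℂ) : expVarphi c * expVarphi (-c) = 1 := by
  have h := fexp_mul_fexp_neg (coeff_zero_varphi c)
  have e : -(PowerSeries.mk fun k : ℕ => if Odd k then c • (MvPowerSeries.X (k / 2) : Times)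
      else 0) = PowerSeries.mk fun k : ℕ => if Odd k then (-c) • (MvPowerSeries.X (k / 2) : Times)
      else 0 := by
    ext1 k
    rw [map_neg, PowerSeries.coeff_mk, PowerSeries.coeff_mk]
    split_ifs
    · rw [neg_smul]
    · exact neg_zero
  rw [expVarphi, expVarphi, ← e]
  exact h

theorem mulExp_mulExp_neg (c : ℂ) (u : ℤ → Times) : mulExp c (mulExp (-c) u) = u := by
  refine mulExp_congr_coeff fun m a L h => ?_
  have h1 : ∀ n ∈ range L, MvPowerSeries.coeff a (PowerSeries.coeff n (expVarphi c) *
      mulExp (-c) u (m - n)) = ∑ k ∈ range L, MvPowerSeries.coeff a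
        (PowerSeries.coeff n (expVarphi c) * (PowerSeries.coeff k (expVarphi (-c)) *
          u (m - (n + k : ℕ)))) := fun n _ => by
    rw [coeff_mul_mulExp _ _ u _ h]
    refine Finset.sum_congr rfl fun k _ => ?_
    push_cast
    rw [sub_sub]
  rw [Finset.sum_congr rfl h1, sum_range_range_eq_sum_antidiagonal fun n k hnk =>
    coeff_expVarphi_mul_mul_eq_zero c (-c) _ (by omega)]
  have h2 : ∀ j ∈ range L, ∑ p ∈ antidiagonal j, MvPowerSeries.coeff a
        (PowerSeries.coeff p.1 (expVarphi c) * (PowerSeries.coeff p.2 (expVarphi (-c)) *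
          u (m - (p.1 + p.2 : ℕ)))) = if j = 0 then MvPowerSeries.coeff a (u m) else 0 := by
    intro j _
    have h3 := congrArg (PowerSeries.coeff j) (expVarphi_mul_neg c)
    rw [PowerSeries.coeff_mul, PowerSeries.coeff_one] at h3
    have h4 : ∑ p ∈ antidiagonal j, MvPowerSeries.coeff a
        (PowerSeries.coeff p.1 (expVarphi c) * (PowerSeries.coeff p.2 (expVarphi (-c)) *
          u (m - (p.1 + p.2 : ℕ)))) = MvPowerSeries.coeff a ((∑ p ∈ antidiagonal j,
        PowerSeries.coeff p.1 (expVarphi c) * PowerSeries.coeff p.2 (expVarphi (-c))) *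
          u (m - j)) := by
      rw [Finset.sum_mul, map_sum]
      refine Finset.sum_congr rfl fun p hp => ?_
      rw [HasAntidiagonal.mem_antidiagonal.mp hp, mul_assoc]
    rw [h4, h3]
    split_ifs with hj
    · subst hj; simp
    · simp
  rw [Finset.sum_congr rfl h2, Finset.sum_ite_eq', if_pos (mem_range.mpr (by omega))]

/-- φ(t,z) is odd in z, so e^{-cφ(t,z)} = e^{cφ(t,-z)}. -/
theorem expVarphi_neg (c : ℂ) (n : ℕ) : PowerSeries.coeff n (expVarphi (-c)) =
    ((-1 : ℂ) ^ n) • PowerSeries.coeff n (expVarphi c) := by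
  induction n using Nat.strong_induction_on with
  | _ n ih =>
  by_cases hn : n = 0
  · subst hn; simp [coeff_zero_expVarphi]
  have hn' : (n : ℂ) ≠ 0 := by exact_mod_cast hn
  refine smul_right_injective _ hn' ?_
  simp only
  rw [expVarphi_euler, smul_comm, expVarphi_euler, Finset.smul_sum]
  refine Finset.sum_congr rfl fun p hp => ?_
  rw [HasAntidiagonal.mem_antidiagonal] at hp
  split_ifs with ho
  · rw [ih p.2 (by have := ho.pos; omega), ← hp, pow_add, ho.neg_one_pow]
    simp only [smul_smul, smul_mul_assoc, mul_smul_comm]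
    congr 1
    ring
  · simp

/-- `∑_i (-1)^{-1-i} u_i w_{-1-i}`, the residue of `u(t,z) w(t,-z)`. -/
def diagRes (u w : ℤ → Times) : Times := ∑ᶠ i : ℤ, ((-1 : ℂ) ^ (-1 - i)) • (u i * w (-1 - i))

theorem finite_mul_of_bdd {M : Type*} [MulZeroClass M] {h h' : ℤ → M} {N N' : ℤ}
    (hh : ∀ m, N < m → h m = 0) (hh' : ∀ m, N' < m → h' m = 0) (s : ℤ) :
    (Function.support fun i : ℤ => h i * h' (s - i)).Finite := by
  refine (Set.finite_Icc (s - N') N).subset fun i hi => ?_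
  rw [Set.mem_Icc]
  by_contra h1
  apply hi
  by_cases h2 : N < i
  · simp [hh i h2]
  · simp [hh' (s - i) (by omega)]

/-- The exponential factors do not contribute to the residue on the diagonal. -/
theorem diagRes_eq_zero {h h' : ℤ → Times} {N N' : ℤ} (hh : ∀ m, N < m → h m = 0)
    (hh' : ∀ m, N' < m → h' m = 0) (hr : ResZero (mulExp 1 h) (mulExp 1 h')) :
    diagRes h h' = 0 := by
  classical
  ext a
  obtain ⟨L, hL⟩ : ∃ L, wt a < L := ⟨_, Nat.lt_succ_self _⟩
  have hfin0 := finite_mul_of_bdd hh hh'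
  -- Restriction to s = t: the coefficient at a of the diagonal is the sum of the coefficients at
  -- all pairs (p, q) with p + q = a.
  have h0 : ∑ᶠ m : ℤ, (-1 : ℂ) ^ (-1 - m) *
      MvPowerSeries.coeff a (mulExp 1 h m * mulExp 1 h' (-1 - m)) = 0 := by
    simp only [MvPowerSeries.coeff_mul, Finset.mul_sum]
    rw [finsum_sum_comm]
    · refine Finset.sum_eq_zero fun p _ => ?_
      exact (hr p.1 p.2).2
    · intro p _
      exact (hr p.1 p.2).1.subset fun m hm h => hm (by simp only at h ⊢; rw [h, mul_zero])
  have hterm : ∀ m : ℤ, MvPowerSeries.coeff a (mulExp 1 h m * mulExp 1 h' (-1 - m)) =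
      ∑ n ∈ range L, ∑ k ∈ range L, MvPowerSeries.coeff a (PowerSeries.coeff n (expVarphi 1) *
        (PowerSeries.coeff k (expVarphi 1) * (h (m - n) * h' (-1 - m - k)))) := by
    intro m
    rw [mul_comm, coeff_mul_mulExp _ _ _ _ hL]
    refine Finset.sum_congr rfl fun n _ => ?_
    rw [mul_comm, coeff_mul_mulExp _ _ _ _ hL]
    refine Finset.sum_congr rfl fun k _ => ?_
    congr 1
    ring
  have hfin : ∀ n k : ℕ, (Function.support fun m : ℤ => (-1 : ℂ) ^ (-1 - m) *
      MvPowerSeries.coeff a (PowerSeries.coeff n (expVarphi 1) *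
        (PowerSeries.coeff k (expVarphi 1) * (h (m - n) * h' (-1 - m - k))))).Finite := by
    intro n k
    refine ((hfin0 (-1 - n - k)).preimage (f := fun m : ℤ => m - n)
      (sub_left_injective.injOn)).subset fun m hm h1 => hm ?_
    have e : (-1 - n - k - (m - n) : ℤ) = -1 - m - k := by ring
    simp only [e] at h1 ⊢
    rw [h1]
    simp
  -- The shift m = i + n produces a sign (-1)^n, which turns the coefficient of e^φ into that of
  -- e^{-φ}.
  have hshift : ∀ n k : ℕ, ∑ᶠ m : ℤ, (-1 : ℂ) ^ (-1 - m) *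
      MvPowerSeries.coeff a (PowerSeries.coeff n (expVarphi 1) *
        (PowerSeries.coeff k (expVarphi 1) * (h (m - n) * h' (-1 - m - k)))) =
      MvPowerSeries.coeff a (PowerSeries.coeff n (expVarphi (-1)) *
        (PowerSeries.coeff k (expVarphi 1) * ∑ᶠ i : ℤ, ((-1 : ℂ) ^ (-1 - i)) • (h i *
          h' (-1 - (n + k : ℕ) - i)))) := by
    intro n k
    have hf1 : (Function.support fun i : ℤ => ((-1 : ℂ) ^ (-1 - i)) • (h i *
          h' (-1 - (n + k : ℕ) - i))).Finite :=
      (hfin0 (-1 - (n + k : ℕ))).subset fun m hm h => hm (by simp only at h ⊢; rw [h, smul_zero])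
    have hlin : MvPowerSeries.coeff a (PowerSeries.coeff n (expVarphi (-1)) *
        (PowerSeries.coeff k (expVarphi 1) * ∑ᶠ i : ℤ, ((-1 : ℂ) ^ (-1 - i)) • (h i *
          h' (-1 - (n + k : ℕ) - i)))) = (MvPowerSeries.coeff a ∘ₗ
        LinearMap.mulLeft ℂ (PowerSeries.coeff n (expVarphi (-1))) ∘ₗ
        LinearMap.mulLeft ℂ (PowerSeries.coeff k (expVarphi 1))) (∑ᶠ i : ℤ,
          ((-1 : ℂ) ^ (-1 - i)) • (h i * h' (-1 - (n + k : ℕ) - i))) := rfl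
    rw [hlin, map_finsum _ hf1, ← finsum_comp_equiv (Equiv.addRight (n : ℤ))]
    refine finsum_congr fun i => ?_
    have e1 : (-1 - (i + n) - k : ℤ) = -1 - (n + k : ℕ) - i := by push_cast; ring
    have e2 : (-1 : ℂ) ^ (-1 - (i + n) : ℤ) = (-1) ^ n * (-1) ^ (-1 - i) := by
      rw [← zpow_natCast, ← zpow_add₀ (by norm_num)]
      have : (-1 - (i + n) : ℤ) = n + (-1 - i) - 2 * n := by ring
      rw [this, zpow_sub₀ (by norm_num), zpow_mul]
      simp
    rw [map_smul, Equiv.coe_addRight, add_sub_cancel_right, e1, e2, smul_eq_mul, mul_comm (_ ^ n),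
      mul_assoc]
    congr 1
    simp only [LinearMap.comp_apply, LinearMap.mulLeft_apply, expVarphi_neg, smul_mul_assoc,
      map_smul, smul_eq_mul]
  rw [finsum_congr fun m => by rw [hterm m, Finset.mul_sum], finsum_sum_comm] at h0
  swap
  · intro n _
    refine (Set.Finite.biUnion (range L).finite_toSet fun k _ => hfin n k).subset fun m hm => ?_
    rw [Function.mem_support, Finset.mul_sum] at hm
    obtain ⟨k, hk, hk'⟩ := Finset.exists_ne_zero_of_sum_ne_zero hm
    exact Set.mem_biUnion (Finset.mem_coe.mpr hk) hk'
  have h1 : ∑ n ∈ range L, ∑ k ∈ range L, MvPowerSeries.coeff a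
      (PowerSeries.coeff n (expVarphi (-1)) * (PowerSeries.coeff k (expVarphi 1) *
        ∑ᶠ i : ℤ, ((-1 : ℂ) ^ (-1 - i)) • (h i * h' (-1 - (n + k : ℕ) - i)))) = 0 := by
    rw [← h0]
    refine Finset.sum_congr rfl fun n _ => ?_
    rw [finsum_congr fun m => by rw [Finset.mul_sum], finsum_sum_comm _ _ fun k _ => hfin n k]
    exact Finset.sum_congr rfl fun k _ => (hshift n k).symm
  rw [sum_range_range_eq_sum_antidiagonal fun n k hnk =>
    coeff_expVarphi_mul_mul_eq_zero _ _ _ (by omega)] at h1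
  rw [map_zero, ← h1]
  have h2 : ∀ j ∈ range L, ∑ p ∈ antidiagonal j, MvPowerSeries.coeff a
      (PowerSeries.coeff p.1 (expVarphi (-1)) * (PowerSeries.coeff p.2 (expVarphi 1) *
        ∑ᶠ i : ℤ, ((-1 : ℂ) ^ (-1 - i)) • (h i * h' (-1 - (p.1 + p.2 : ℕ) - i)))) =
      if j = 0 then MvPowerSeries.coeff a (diagRes h h') else 0 := by
    intro j _
    -- Since e^{-φ} e^φ = 1, only the order j = 0 survives, and it is the residue of the bare
    -- symbols.
    have h3 := congrArg (PowerSeries.coeff j) (expVarphi_mul_neg (-1))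
    rw [PowerSeries.coeff_mul, PowerSeries.coeff_one, neg_neg] at h3
    have h4 : ∑ p ∈ antidiagonal j, MvPowerSeries.coeff a
      (PowerSeries.coeff p.1 (expVarphi (-1)) * (PowerSeries.coeff p.2 (expVarphi 1) *
        ∑ᶠ i : ℤ, ((-1 : ℂ) ^ (-1 - i)) • (h i * h' (-1 - (p.1 + p.2 : ℕ) - i)))) =
        MvPowerSeries.coeff a ((∑ p ∈ antidiagonal j,
        PowerSeries.coeff p.1 (expVarphi (-1)) * PowerSeries.coeff p.2 (expVarphi 1)) *
          ∑ᶠ i : ℤ, ((-1 : ℂ) ^ (-1 - i)) • (h i * h' (-1 - j - i))) := by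
      rw [Finset.sum_mul, map_sum]
      refine Finset.sum_congr rfl fun p hp => ?_
      rw [HasAntidiagonal.mem_antidiagonal.mp hp, mul_assoc]
    rw [h4, h3]
    split_ifs with hj
    · subst hj; simp [diagRes]
    · simp
  rw [Finset.sum_congr rfl h2, Finset.sum_ite_eq', if_pos (mem_range.mpr (by omega))]

/-! ### Derivatives and products inside residues -/

theorem pderiv_expVarphi (k n : ℕ) :
    MvPowerSeries.pderiv ℂ k (PowerSeries.coeff n (expVarphi 1)) =
      if 2 * k + 1 ≤ n then PowerSeries.coeff (n - (2 * k + 1)) (expVarphi 1) else 0 := by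
  have hd : mapDeriv (fun _ => (MvPowerSeries.pderiv ℂ k : Derivation ℂ Times Times).toLinearMap)
      (PowerSeries.mk fun k : ℕ => if Odd k then (1 : ℂ) • (MvPowerSeries.X (k / 2) : Times)
        else 0) = (PowerSeries.X : PowerSeries Times) ^ (2 * k + 1) := by
    refine MvPowerSeries.ext fun a => ?_
    obtain ⟨j, rfl⟩ : ∃ k, a = Finsupp.single () k := ⟨a (), by ext; simp⟩
    rw [coeff_mapDeriv, coeff_powerSeriesMk, Finsupp.single_eq_same]
    refine Eq.trans ?_ (PowerSeries.coeff_X_pow (R := Times) j (2 * k + 1)).symm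
    rw [Derivation.coeFn_coe]
    split_ifs with h1 h2 h2
    · subst h2
      have h3 : (2 * k + 1) / 2 = k := by omega
      rw [one_smul, h3, MvPowerSeries.pderiv_X_self]
    · have h3 : j / 2 ≠ k := by rcases h1 with ⟨r, rfl⟩; omega
      rw [one_smul, MvPowerSeries.pderiv_X_of_ne h3]
    · exact absurd ⟨k, h2⟩ h1
    · exact map_zero _
  have h := mapDeriv_fexp
    (δ := fun _ => (MvPowerSeries.pderiv ℂ k : Derivation ℂ Times Times).toLinearMap)
    (fun _ _ x y => by
      rw [Derivation.coeFn_coe, Derivation.leibniz, smul_eq_mul, smul_eq_mul]; ring)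
    (coeff_zero_varphi 1) (Commute.all _ _)
  rw [hd] at h
  have h1 := congrArg (PowerSeries.coeff n) h
  rw [← PowerSeries.coeff_X_pow_mul']
  exact h1

/-- Conjugation by e^φ replaces ∂/∂t_{2k+1} by ∂/∂t_{2k+1} + z^{2k+1}. -/
theorem pderiv_mulExp (k : ℕ) (u : ℤ → Times) (m : ℤ) :
    MvPowerSeries.pderiv ℂ k (mulExp 1 u m) =
      mulExp 1 (fun m => MvPowerSeries.pderiv ℂ k (u m) + u (m - (2 * k + 1 : ℕ))) m := by
  ext a
  obtain ⟨L, hL⟩ : ∃ L, wt a < L := ⟨_, Nat.lt_succ_self _⟩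
  -- Differentiation reads off a coefficient whose weight is higher by 2k + 1, hence the longer
  -- truncation on both sides.
  rw [coeff_mulExp 1 _ m (L := L + (2 * k + 1)) (by omega), MvPowerSeries.coeff_pderiv,
    coeff_mulExp 1 u m (L := L + (2 * k + 1)) (by rw [map_add, wt_single]; omega), Finset.sum_mul]
  have h1 : ∀ n : ℕ, MvPowerSeries.coeff (a + Finsupp.single k 1)
      (PowerSeries.coeff n (expVarphi 1) * u (m - n)) * (a k + 1) =
      MvPowerSeries.coeff a (PowerSeries.coeff n (expVarphi 1) *
        MvPowerSeries.pderiv ℂ k (u (m - n))) + MvPowerSeries.coeff a ((if 2 * k + 1 ≤ n then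
          PowerSeries.coeff (n - (2 * k + 1)) (expVarphi 1) else 0) * u (m - n)) := by
    intro n
    rw [← MvPowerSeries.coeff_pderiv, Derivation.leibniz, map_add, smul_eq_mul, smul_eq_mul,
      pderiv_expVarphi, mul_comm (u (m - n))]
  simp only [h1, mul_add, map_add]
  rw [Finset.sum_add_distrib, Finset.sum_add_distrib]
  congr 1
  rw [add_comm L, Finset.sum_range_add, Finset.sum_eq_zero, zero_add, add_comm (2 * k + 1),
    Finset.sum_range_add]
  · have h2 : ∑ x ∈ range (2 * k + 1), MvPowerSeries.coeff a (PowerSeries.coeff (L + x)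
        (expVarphi 1) * u (m - (L + x : ℕ) - (2 * k + 1 : ℕ))) = 0 :=
      Finset.sum_eq_zero fun x _ => coeff_expVarphi_mul_eq_zero _ _ (by omega)
    rw [h2, add_zero]
    refine Finset.sum_congr rfl fun n _ => ?_
    rw [if_pos (by omega), add_tsub_cancel_left]
    congr 3
    push_cast
    ring
  · intro n hn
    rw [mem_range] at hn
    rw [if_neg (by omega), zero_mul, map_zero]

/-- The residue `Res_z u(z) ⊗ w(-z)` exists. -/
def ResFin (u w : ℤ → MvPowerSeries ℕ ℂ) : Prop :=
  ∀ a b : ℕ →₀ ℕ, (Function.support fun m : ℤ =>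
      MvPowerSeries.coeff a (u m) * MvPowerSeries.coeff b (w (-1 - m))).Finite

theorem ResZero.resFin {u w : ℤ → MvPowerSeries ℕ ℂ} (h : ResZero u w) : ResFin u w :=
  fun a b => (h a b).1

theorem ResFin.symm {u w : ℤ → MvPowerSeries ℕ ℂ} (h : ResFin u w) : ResFin w u := by
  intro a b
  refine ((h b a).preimage (f := fun m : ℤ => -1 - m) sub_right_injective.injOn).subset
    fun m hm h => hm ?_
  have e : -1 - (-1 - m) = m := by ring
  simp only [e] at h ⊢
  rw [mul_comm, h]

/-- The substitution z ↦ -z exchanges the two series and changes the sign of the residue. -/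
theorem ResZero.symm {u w : ℤ → MvPowerSeries ℕ ℂ} (h : ResZero u w) : ResZero w u := by
  intro a b
  refine ⟨h.resFin.symm a b, ?_⟩
  rw [← neg_eq_zero, ← (h b a).2, res, res, ← finsum_neg_distrib,
    ← finsum_comp_equiv (Equiv.subLeft (-1 : ℤ))]
  refine finsum_congr fun m => ?_
  have e : -1 - (-1 - m) = m := by ring
  have e' : (-1 : ℂ) ^ m = -(-1) ^ (-1 - m) := by
    rw [zpow_sub₀ (by norm_num)]
    rcases Int.even_or_odd m with h | h
    · rw [h.neg_one_zpow]; norm_num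
    · rw [h.neg_one_zpow]; norm_num
  rw [Equiv.subLeft_apply, e, e']
  ring

theorem ResFin.finite_smul {u w : ℤ → MvPowerSeries ℕ ℂ} (h : ResFin u w) (a b : ℕ →₀ ℕ) :
    (Function.support fun m : ℤ => (-1 : ℂ) ^ (-1 - m) *
      (MvPowerSeries.coeff a (u m) * MvPowerSeries.coeff b (w (-1 - m)))).Finite :=
  (h a b).subset fun m hm h => hm (by simp only at h ⊢; rw [h, mul_zero])

theorem ResFin.mul_left {u w : ℤ → MvPowerSeries ℕ ℂ} (h : ResFin u w) (f : MvPowerSeries ℕ ℂ) :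
    ResFin (fun m => f * u m) w := by
  classical
  intro a b
  refine (Set.Finite.biUnion (antidiagonal a).finite_toSet fun p _ => h p.2 b).subset fun m hm => ?_
  rw [Function.mem_support, MvPowerSeries.coeff_mul, Finset.sum_mul] at hm
  obtain ⟨p, hp, hp'⟩ := Finset.exists_ne_zero_of_sum_ne_zero hm
  rw [mul_assoc] at hp'
  exact Set.mem_biUnion (Finset.mem_coe.mpr hp) (right_ne_zero_of_mul hp')

/-- The residue as a power series in the first set of variables. -/
theorem exists_res_series (u w : ℤ → MvPowerSeries ℕ ℂ) (b : ℕ →₀ ℕ) :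
    ∃ R : MvPowerSeries ℕ ℂ, ∀ a, MvPowerSeries.coeff a R = res u w a b :=
  ⟨fun a => res u w a b, fun _ => rfl⟩

theorem coeff_mul_res {u w : ℤ → MvPowerSeries ℕ ℂ} (h : ResFin u w) (f : MvPowerSeries ℕ ℂ)
    {b : ℕ →₀ ℕ} {R : MvPowerSeries ℕ ℂ} (hR : ∀ a, MvPowerSeries.coeff a R = res u w a b)
    (a : ℕ →₀ ℕ) : MvPowerSeries.coeff a (f * R) = res (fun m => f * u m) w a b := by
  classical
  rw [MvPowerSeries.coeff_mul, res]
  simp only [MvPowerSeries.coeff_mul, Finset.sum_mul, Finset.mul_sum]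
  rw [finsum_sum_comm]
  · refine Finset.sum_congr rfl fun p _ => ?_
    rw [hR, res, ← smul_eq_mul (MvPowerSeries.coeff p.1 f), smul_finsum' _ (h.finite_smul p.2 b)]
    exact finsum_congr fun m => by rw [smul_eq_mul]; ring
  · intro p _
    refine (h p.2 b).subset fun m hm h => hm ?_
    simp only at h ⊢
    rw [mul_assoc, h, mul_zero, mul_zero]

theorem ResZero.mul_left {u w : ℤ → MvPowerSeries ℕ ℂ} (h : ResZero u w)
    (f : MvPowerSeries ℕ ℂ) : ResZero (fun m => f * u m) w := by
  intro a b
  refine ⟨h.resFin.mul_left f a b, ?_⟩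
  rw [← coeff_mul_res h.resFin f (R := 0) (fun a => by rw [(h a b).2, map_zero]), mul_zero,
    map_zero]

theorem ResZero.mul_right {u w : ℤ → MvPowerSeries ℕ ℂ} (h : ResZero u w)
    (f : MvPowerSeries ℕ ℂ) : ResZero u (fun m => f * w m) :=
  (h.symm.mul_left f).symm

/-- For a fixed monomial in the second variables the residue is a power series R in the first ones,
and f R = 0 in a domain. Existence of the residue is a separate hypothesis because it does not
follow from that of the multiple. -/
theorem ResZero.of_mul_left {u w : ℤ → MvPowerSeries ℕ ℂ} (hf : ResFin u w)
    {f : MvPowerSeries ℕ ℂ} (hf0 : f ≠ 0) (h : ResZero (fun m => f * u m) w) : ResZero u w := by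
  intro a b
  refine ⟨hf a b, ?_⟩
  obtain ⟨R, hR⟩ := exists_res_series u w b
  have h1 : f * R = 0 := by
    ext a
    rw [coeff_mul_res hf f hR, (h a b).2, map_zero]
  rw [← hR, (mul_eq_zero.mp h1).resolve_left hf0, map_zero]

theorem ResZero.of_mul_right {u w : ℤ → MvPowerSeries ℕ ℂ} (hf : ResFin u w)
    {f : MvPowerSeries ℕ ℂ} (hf0 : f ≠ 0) (h : ResZero u (fun m => f * w m)) : ResZero u w :=
  (ResZero.of_mul_left hf.symm hf0 h.symm).symm

theorem ResZero.pderiv_left {u w : ℤ → MvPowerSeries ℕ ℂ} (h : ResZero u w) (k : ℕ) :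
    ResZero (fun m => MvPowerSeries.pderiv ℂ k (u m)) w := by
  intro a b
  have h1 := h (a + Finsupp.single k 1) b
  constructor
  · refine h1.1.subset fun m hm h => hm ?_
    simp only at h ⊢
    rw [MvPowerSeries.coeff_pderiv, mul_right_comm, h, zero_mul]
  · have h2 := congrArg (fun c => ((a k : ℂ) + 1) • c) h1.2
    simp only [res] at h2
    rw [smul_finsum' _ (h.resFin.finite_smul _ b), smul_zero] at h2
    rw [res, ← h2]
    refine finsum_congr fun m => ?_
    rw [MvPowerSeries.coeff_pderiv, smul_eq_mul]
    ring

theorem ResZero.pderiv_right {u w : ℤ → MvPowerSeries ℕ ℂ} (h : ResZero u w) (k : ℕ) :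
    ResZero u (fun m => MvPowerSeries.pderiv ℂ k (w m)) :=
  (h.symm.pderiv_left k).symm

theorem resFin_g (v : Fock) (α β : Finset ℕ) : ResFin (g v α) (g v β) :=
  finite_res (fun m q => pair_g v α m q) (fun m q => pair_g v β m q)

/-! ### Wave functions -/

/-- The series `g_α e^{-φ}`. -/
def symb (v : Fock) (α : Finset ℕ) : ℤ → Times := applyShift (bracket v α)

theorem mulExp_symb (v : Fock) (α : Finset ℕ) : mulExp 1 (symb v α) = g v α := (g_eq v α).symm

theorem mulExp_neg_g (v : Fock) (α : Finset ℕ) : mulExp (-1) (g v α) = symb v α := by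
  have h := mulExp_mulExp_neg (-1) (symb v α)
  rwa [neg_neg, mulExp_symb] at h

theorem symb_eq_zero (v : Fock) (α : Finset ℕ) {m : ℤ} (hm : (top α : ℤ) < m) :
    symb v α m = 0 := by
  rw [symb, applyShift_eq (fun m hm => bracket_eq_zero v α hm) (N := 0) (by simpa using hm)]
  simp

/-- The denominator `(α_1/2) τ_{α∖α_1}`. -/
def den (v : Fock) (α : Finset ℕ) : Times := (((2 * top α + 1) / 2) : ℂ) • tauTop v α

theorem top_mem {α : Finset ℕ} (hα : α.Nonempty) : top α ∈ α := by
  obtain ⟨n, hn, h⟩ := Finset.exists_mem_eq_sup α hα id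
  rw [top, h]
  exact hn

/-- Only the order 0 of the shift and the largest part of α reach this power of z, and the largest
part carries the sign 1. -/
theorem symb_top (v : Fock) {α : Finset ℕ} (hα : α.Nonempty) :
    symb v α (top α) = ((-1 : ℂ) ^ top α) • den v α := by
  rw [symb, applyShift_eq (fun m hm => bracket_eq_zero v α hm) (N := 1) (by simp)]
  rw [Finset.sum_range_one, Nat.cast_zero, add_zero, ← Int.ofNat_eq_natCast, bracket,
    if_pos (top_mem hα)]
  have h1 : sgn (top α) α = 1 := by
    unfold sgn
    rw [filter_eq_empty_iff.mpr]
    · simp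
    · intro n hn
      exact (Finset.le_sup (f := id) hn : n ≤ top α).not_gt
  have h2 : PowerSeries.coeff 0 shift = 1 := by
    rw [PowerSeries.coeff, Finsupp.single_zero]
    refine coeff_zero_fexp ?_
    rw [coeff_powerSeriesMk]
    simp
  rw [h1, h2, Module.End.one_apply, den, tauTop, smul_smul]
  congr 1
  ring

theorem half_ne_zero (n : ℕ) : ((2 * n + 1) / 2 : ℂ) ≠ 0 := by
  have : (2 * (n : ℂ) + 1) ≠ 0 := by exact_mod_cast Nat.succ_ne_zero (2 * n)
  exact div_ne_zero this two_ne_zero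

theorem den_ne_zero {v : Fock} {α : Finset ℕ} (h : tauTop v α ≠ 0) : den v α ≠ 0 :=
  smul_ne_zero (half_ne_zero _) h

theorem algebraMap_ne_zero {f : Times} (h : f ≠ 0) : algebraMap Times K f ≠ 0 :=
  fun h' => h (IsFractionRing.injective Times K (by rw [h', map_zero]))

theorem hatw_eq (v : Fock) (α : Finset ℕ) (m : ℤ) : hatw v α m =
    algebraMap Times K ((-1 : ℂ) ^ top α • symb v α (m + top α)) / algebraMap Times K (den v α) := by
  rw [hatw, mulExp_neg_g]; rfl

theorem neg_one_pow_mul_self (n : ℕ) : ((-1 : ℂ) ^ n) * (-1) ^ n = 1 := by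
  rw [← mul_pow]; simp

theorem wave_eq {v : Fock} {α : Finset ℕ} (h : tauTop v α ≠ 0) (m : ℤ) : wave v α m =
    algebraMap Times K ((-1 : ℂ) ^ top α • g v α m) / algebraMap Times K (den v α) := by
  have h1 : (((-1 : ℂ) ^ top α * ((2 * top α + 1) / 2)) • tauTop v α) ≠ 0 :=
    smul_ne_zero (mul_ne_zero (by simp) (half_ne_zero _)) h
  rw [wave, div_eq_div_iff (algebraMap_ne_zero h1) (algebraMap_ne_zero (den_ne_zero h)),
    ← map_mul, ← map_mul, den, smul_mul_smul_comm, ← mul_assoc, neg_one_pow_mul_self, one_mul,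
    mul_smul_comm]

theorem fracMulExp_wave {v : Fock} {α : Finset ℕ} (h : tauTop v α ≠ 0) :
    FracMulExp (hatw v α) (top α) (wave v α) := by
  refine ⟨den v α, fun m => (-1 : ℂ) ^ top α • symb v α (m + top α), den_ne_zero h,
    hatw_eq v α, fun m => ?_⟩
  rw [wave_eq h]
  simp only [sub_add_cancel]
  rw [mulExp_smul, mulExp_symb]

theorem hatw_zero {v : Fock} {α : Finset ℕ} (hα : α.Nonempty) (h : tauTop v α ≠ 0) :
    hatw v α 0 = 1 := by
  rw [hatw_eq, zero_add, symb_top v hα, smul_smul, neg_one_pow_mul_self, one_smul,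
    div_self (algebraMap_ne_zero (den_ne_zero h))]

theorem hatw_pos (v : Fock) (α : Finset ℕ) {m : ℤ} (hm : 0 < m) : hatw v α m = 0 := by
  rw [hatw_eq, symb_eq_zero v α (by omega), smul_zero, map_zero, zero_div]

theorem resZero_iff_fracResZero {v : Fock} {α β : Finset ℕ} (hα : tauTop v α ≠ 0)
    (hβ : tauTop v β ≠ 0) :
    ResZero (g v α) (g v β) ↔ FracResZero (wave v α) (wave v β) := by
  have hne : ∀ {α : Finset ℕ}, tauTop v α ≠ 0 →
      (((-1 : ℂ) ^ top α * ((2 * top α + 1) / 2)) • tauTop v α) ≠ 0 := fun h =>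
    smul_ne_zero (mul_ne_zero (by simp) (half_ne_zero _)) h
  constructor
  · intro h
    exact ⟨_, _, g v α, g v β, hne hα, hne hβ, fun m => rfl, fun m => rfl, h⟩
  · rintro ⟨d, e, U, W, hd, he, hU, hW, h⟩
    -- Any representation of the wave function with a common denominator is proportional to g_γ;
    -- cross-multiplication transfers the identity, and the nonzero factors are then cancelled.
    have key : ∀ {γ : Finset ℕ} (hγ : tauTop v γ ≠ 0) {d : Times} {U : ℤ → Times}, d ≠ 0 →
        (∀ m, wave v γ m = algebraMap Times K (U m) / algebraMap Times K d) →
        ∀ m, (((-1 : ℂ) ^ top γ * ((2 * top γ + 1) / 2)) • tauTop v γ) * U m = d * g v γ m := by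
      intro γ hγ d U hd hU m
      have h1 := hU m
      rw [wave, div_eq_div_iff (algebraMap_ne_zero (hne hγ)) (algebraMap_ne_zero hd), ← map_mul,
        ← map_mul] at h1
      have h2 := IsFractionRing.injective Times K h1
      rw [mul_comm, ← h2, mul_comm]
    have h1 := (h.mul_left (((-1 : ℂ) ^ top α * ((2 * top α + 1) / 2)) • tauTop v α)).mul_right
      (((-1 : ℂ) ^ top β * ((2 * top β + 1) / 2)) • tauTop v β)
    simp only [key hα hd hU, key hβ he hW] at h1
    have h2 := ResZero.of_mul_right ((resFin_g v α β).mul_left d) he h1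
    exact ResZero.of_mul_left (resFin_g v α β) hd h2

/-! ### Derivations of the field of fractions -/

theorem exists_eq_div (x : K) : ∃ a b : Times, b ≠ 0 ∧
    x = algebraMap Times K a / algebraMap Times K b := by
  obtain ⟨a, b, hb, h⟩ := IsFractionRing.div_surjective (A := Times) x
  exact ⟨a, b, nonZeroDivisors.ne_zero hb, h.symm⟩

theorem tderiv_div (k : ℕ) (a : Times) {b : Times} (hb : b ≠ 0) :
    tderiv k (algebraMap Times K a / algebraMap Times K b) =
      (algebraMap Times K (MvPowerSeries.pderiv ℂ k a) * algebraMap Times K b -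
        algebraMap Times K a * algebraMap Times K (MvPowerSeries.pderiv ℂ k b)) /
          algebraMap Times K b ^ 2 :=
  fracDeriv_div _ a b hb

theorem tderiv_add (k : ℕ) (x y : K) : tderiv k (x + y) = tderiv k x + tderiv k y := by
  obtain ⟨a, b, hb, rfl⟩ := exists_eq_div x
  obtain ⟨c, d, hd, rfl⟩ := exists_eq_div y
  have hb' := algebraMap_ne_zero hb
  have hd' := algebraMap_ne_zero hd
  rw [div_add_div _ _ hb' hd', ← map_mul, ← map_mul, ← map_mul, ← map_add,
    tderiv_div k _ (mul_ne_zero hb hd), tderiv_div k _ hb, tderiv_div k _ hd]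
  simp only [map_add, map_mul, Derivation.leibniz, smul_eq_mul]
  field_simp
  ring

theorem tderiv_mul (k : ℕ) (x y : K) : tderiv k (x * y) = x * tderiv k y + y * tderiv k x := by
  obtain ⟨a, b, hb, rfl⟩ := exists_eq_div x
  obtain ⟨c, d, hd, rfl⟩ := exists_eq_div y
  have hb' := algebraMap_ne_zero hb
  have hd' := algebraMap_ne_zero hd
  rw [div_mul_div_comm, ← map_mul, ← map_mul,
    tderiv_div k _ (mul_ne_zero hb hd), tderiv_div k _ hb, tderiv_div k _ hd]
  simp only [map_add, map_mul, Derivation.leibniz, smul_eq_mul]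
  field_simp
  ring

theorem tderiv_algebraMap (k : ℕ) (a : Times) :
    tderiv k (algebraMap Times K a) = algebraMap Times K (MvPowerSeries.pderiv ℂ k a) := by
  have h := tderiv_div k a one_ne_zero
  simpa using h

/-- The derivation `∂/∂t_{2k+1}` of the field of fractions as an additive map. -/
def tder (k : ℕ) : K →+ K := AddMonoidHom.mk' (tderiv k) (tderiv_add k)

theorem tder_apply (k : ℕ) (x : K) : tder k x = tderiv k x := rfl

/-- Transposed, this is commutativity of multiplication by two variables. -/
theorem pderiv_pderiv_comm (k l : ℕ) (f : Times) : MvPowerSeries.pderiv ℂ k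
    (MvPowerSeries.pderiv ℂ l f) = MvPowerSeries.pderiv ℂ l (MvPowerSeries.pderiv ℂ k f) :=
  eq_of_pair fun q => by
    rw [pair_pderiv, pair_pderiv, pair_pderiv, pair_pderiv, mul_left_comm]

/-- Both mixed derivatives are applied to x b = a; the cross terms are symmetric, so b can be
cancelled, and the quotient rule need not be iterated. -/
theorem tderiv_comm (k l : ℕ) (x : K) : tderiv k (tderiv l x) = tderiv l (tderiv k x) := by
  obtain ⟨a, b, hb, hx⟩ := exists_eq_div x
  have hb' := algebraMap_ne_zero hb
  have h0 : x * algebraMap Times K b = algebraMap Times K a := by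
    rw [hx, div_mul_cancel₀ _ hb']
  have h1 := congrArg (fun y => tderiv k (tderiv l y)) h0
  have h2 := congrArg (fun y => tderiv l (tderiv k y)) h0
  simp only [tderiv_mul, tderiv_add, tderiv_algebraMap] at h1 h2
  rw [pderiv_pderiv_comm l k] at h2
  refine mul_right_cancel₀ hb' ?_
  rw [pderiv_pderiv_comm l k a] at h2
  linear_combination h1 - h2

theorem tderiv_one (k : ℕ) : tderiv k 1 = 0 := by
  have h := tderiv_algebraMap k 1
  simpa using h

theorem tderiv_intCast (k : ℕ) (z : ℤ) : tderiv k (z : K) = 0 := by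
  have h := map_zsmul (tder k) z 1
  rw [tder_apply, tder_apply, tderiv_one, zsmul_zero, zsmul_eq_mul, mul_one] at h
  exact h

/-- The powers of `∂` on fractions, as additive maps. -/
def dIter (n : ℕ) : K →+ K := AddMonoidHom.mk' (tderiv 0)^[n] (iterate_map_add (tder 0) n)

theorem dIter_apply (n : ℕ) (x : K) : dIter n x = (tderiv 0)^[n] x := rfl

theorem dIter_succ (n : ℕ) (x : K) : dIter (n + 1) x = tderiv 0 (dIter n x) := by
  rw [dIter_apply, dIter_apply, Function.iterate_succ_apply']

theorem dIter_zero (x : K) : dIter 0 x = x := rfl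

theorem tderiv_dIter (k n : ℕ) (x : K) : tderiv k (dIter n x) = dIter n (tderiv k x) := by
  induction n with
  | zero => rfl
  | succ n ih => rw [dIter_succ, dIter_succ, tderiv_comm, ih]

theorem dIter_one {n : ℕ} (hn : n ≠ 0) : dIter n 1 = 0 := by
  obtain ⟨n, rfl⟩ := Nat.exists_eq_succ_of_ne_zero hn
  rw [dIter_apply, Function.iterate_succ_apply, tderiv_one, ← dIter_apply, map_zero]

/-! ### The additive structure of pseudodifferential operators -/

namespace PsiDO

theorem coeff_zero (m : ℤ) : (0 : PsiDO).coeff m = 0 := rfl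

theorem coeff_neg (P : PsiDO) (m : ℤ) : (-P).coeff m = -P.coeff m := rfl

theorem coeff_sub (P Q : PsiDO) (m : ℤ) : (P - Q).coeff m = P.coeff m - Q.coeff m := rfl

theorem coeff_dpow (n m : ℤ) : (dpow n).coeff m = if m = n then 1 else 0 := rfl

/-- The sum of pseudodifferential operators. -/
def add (P Q : PsiDO) : PsiDO := ⟨fun m => P.coeff m + Q.coeff m, by
  obtain ⟨N, h⟩ := P.bdd
  obtain ⟨N', h'⟩ := Q.bdd
  exact ⟨max N N', fun m hm => by
    simp [h m (lt_of_le_of_lt (le_max_left _ _) hm), h' m (lt_of_le_of_lt (le_max_right _ _) hm)]⟩⟩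

/-- The additive group of pseudodifferential operators. -/
@[reducible] def addCommGroup : AddCommGroup PsiDO :=
  letI : Add PsiDO := ⟨add⟩
  { add := add
    zero := 0
    neg := fun P => -P
    sub := fun P Q => P - Q
    nsmul := nsmulRec
    zsmul := zsmulRec
    add_assoc := fun P Q R => PsiDO.ext (funext fun _ => add_assoc _ _ _)
    zero_add := fun P => PsiDO.ext (funext fun _ => zero_add _)
    add_zero := fun P => PsiDO.ext (funext fun _ => add_zero _)
    add_comm := fun P Q => PsiDO.ext (funext fun _ => add_comm _ _)
    neg_add_cancel := fun P => PsiDO.ext (funext fun _ => neg_add_cancel _)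
    sub_eq_add_neg := fun P Q => PsiDO.ext (funext fun _ => sub_eq_add_neg _ _) }

/-- `P` has order at most `L`. -/
def HasOrd (P : PsiDO) (L : ℤ) : Prop := ∀ m, L < m → P.coeff m = 0

theorem exists_hasOrd (P : PsiDO) : ∃ L, P.HasOrd L := P.bdd

theorem HasOrd.mono {P : PsiDO} {L L' : ℤ} (h : P.HasOrd L) (hL : L ≤ L') : P.HasOrd L' :=
  fun m hm => h m (lt_of_le_of_lt hL hm)

theorem coeff_mul (P Q : PsiDO) (N : ℤ) : (P * Q).coeff N = ∑ᶠ p : ℤ × ℕ,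
    ((Ring.choose p.1 p.2 : ℤ) : K) * (P.coeff p.1 * dIter p.2 (Q.coeff (N - p.1 + p.2))) := by
  simp only [dIter_apply, ← zsmul_eq_mul]; rfl

theorem finite_mul {P Q : PsiDO} (N : ℤ) : (Function.support fun p : ℤ × ℕ =>
    ((Ring.choose p.1 p.2 : ℤ) : K) *
      (P.coeff p.1 * dIter p.2 (Q.coeff (N - p.1 + p.2)))).Finite := by
  obtain ⟨L, hL⟩ := P.exists_hasOrd
  obtain ⟨M, hM⟩ := Q.exists_hasOrd
  refine ((Set.finite_Icc (N - M) L).prod (range (M - N + L + 1).toNat).finite_toSet).subset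
    fun p hp => ?_
  have h1 : p.1 ≤ L := by
    by_contra h
    exact hp (by simp only; rw [hL _ (by omega), zero_mul, mul_zero])
  have h2 : N - p.1 + p.2 ≤ M := by
    by_contra h
    exact hp (by simp only; rw [hM _ (by omega), map_zero, mul_zero, mul_zero])
  rw [Set.mem_prod, Set.mem_Icc, Finset.mem_coe, mem_range]
  omega

theorem HasOrd.mul {P Q : PsiDO} {L M : ℤ} (hP : P.HasOrd L) (hQ : Q.HasOrd M) :
    (P * Q).HasOrd (L + M) := by
  intro N hN
  rw [coeff_mul]
  refine finsum_eq_zero_of_forall_eq_zero fun p => ?_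
  by_cases hp : L < p.1
  · rw [hP _ hp, zero_mul, mul_zero]
  · rw [hQ _ (by omega), map_zero, mul_zero, mul_zero]

theorem hasOrd_dpow (n : ℤ) : (dpow n).HasOrd n := fun _ h => if_neg h.ne'

theorem coeff_dpow_mul (n : ℤ) (Q : PsiDO) (N : ℤ) : (dpow n * Q).coeff N =
    ∑ᶠ k : ℕ, ((Ring.choose n k : ℤ) : K) * dIter k (Q.coeff (N - n + k)) := by
  rw [coeff_mul, finsum_curry _ (finite_mul N), finsum_eq_single _ n]
  · simp only [coeff_dpow, if_true, one_mul]
  · intro m hm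
    simp [coeff_dpow, hm]

theorem finite_dpow_mul (n : ℤ) (Q : PsiDO) (N : ℤ) : (Function.support fun k : ℕ =>
    ((Ring.choose n k : ℤ) : K) * dIter k (Q.coeff (N - n + k))).Finite := by
  obtain ⟨M, hM⟩ := Q.exists_hasOrd
  refine (range (M - N + n + 1).toNat).finite_toSet.subset fun k hk => ?_
  rw [Finset.mem_coe, mem_range]
  by_contra h
  exact hk (by simp only; rw [hM _ (by omega), map_zero, mul_zero])

theorem finite_coeff_mul (P Q : PsiDO) (N : ℤ) : (Function.support fun i : ℤ =>
    P.coeff i * (dpow i * Q).coeff N).Finite := by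
  obtain ⟨L, hL⟩ := P.exists_hasOrd
  obtain ⟨M, hM⟩ := Q.exists_hasOrd
  refine (Set.finite_Icc (N - M) L).subset fun i hi => ?_
  rw [Set.mem_Icc]
  by_contra h
  apply hi
  by_cases h1 : L < i
  · simp only; rw [hL i h1, zero_mul]
  · simp only; rw [(hasOrd_dpow i).mul hM N (by omega), mul_zero]

/-- A product is the sum of the products with powers of `∂`. -/
theorem coeff_mul_eq (P Q : PsiDO) (N : ℤ) : (P * Q).coeff N =
    ∑ᶠ i : ℤ, P.coeff i * (dpow i * Q).coeff N := by
  rw [coeff_mul, finsum_curry _ (finite_mul N)]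
  refine finsum_congr fun i => ?_
  rw [coeff_dpow_mul, ← smul_eq_mul (P.coeff i), smul_finsum' _ (finite_dpow_mul i Q N)]
  exact finsum_congr fun k => by rw [smul_eq_mul, mul_left_comm]

theorem coeff_mul_top {P Q : PsiDO} {L M : ℤ} (hP : P.HasOrd L) (hQ : Q.HasOrd M) :
    (P * Q).coeff (L + M) = P.coeff L * Q.coeff M := by
  rw [coeff_mul_eq, finsum_eq_single _ L, coeff_dpow_mul, finsum_eq_single _ 0]
  · rw [Ring.choose_zero_right, Int.cast_one, one_mul, dIter_zero]
    congr 2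
    push_cast
    ring
  · intro k hk
    rw [hQ _ (by omega), map_zero, mul_zero]
  · intro i hi
    by_cases h1 : L < i
    · rw [hP i h1, zero_mul]
    · rw [(hasOrd_dpow i).mul hQ _ (by omega), mul_zero]

attribute [local instance] addCommGroup

theorem coeff_add (P Q : PsiDO) (m : ℤ) : (P + Q).coeff m = P.coeff m + Q.coeff m := rfl

theorem mul_add' (P Q R : PsiDO) : P * (Q + R) = P * Q + P * R := by
  ext N
  rw [coeff_add, coeff_mul, coeff_mul, coeff_mul, ← finsum_add_distrib (finite_mul N) (finite_mul N)]
  exact finsum_congr fun p => by rw [coeff_add, map_add, mul_add, mul_add]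

theorem add_mul' (P Q R : PsiDO) : (P + Q) * R = P * R + Q * R := by
  ext N
  rw [coeff_add, coeff_mul, coeff_mul, coeff_mul, ← finsum_add_distrib (finite_mul N) (finite_mul N)]
  exact finsum_congr fun p => by rw [coeff_add, add_mul, mul_add]

theorem one_mul' (P : PsiDO) : 1 * P = P := by
  ext N
  change (dpow 0 * P).coeff N = _
  rw [coeff_dpow_mul, finsum_eq_single _ 0]
  · rw [Ring.choose_zero_right, Int.cast_one, one_mul, dIter_zero]
    congr 1
    push_cast
    ring
  · intro k hk
    rw [Ring.choose_zero_pos ℤ (Nat.pos_of_ne_zero hk), Int.cast_zero, zero_mul]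

theorem dpow_mul_dpow (m n : ℤ) : dpow m * dpow n = dpow (m + n) := by
  ext N
  rw [coeff_dpow_mul, finsum_eq_single _ 0]
  · rw [Ring.choose_zero_right, Int.cast_one, one_mul, dIter_zero, coeff_dpow, coeff_dpow]
    congr 1
    rw [eq_iff_iff]
    push_cast
    omega
  · intro k hk
    rw [coeff_dpow]
    split_ifs
    · rw [dIter_one hk, mul_zero]
    · rw [map_zero, mul_zero]

theorem coeff_mul_dpow (P : PsiDO) (n N : ℤ) : (P * dpow n).coeff N = P.coeff (N - n) := by
  rw [coeff_mul_eq, finsum_eq_single _ (N - n)]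
  · rw [dpow_mul_dpow, coeff_dpow, if_pos (by ring), mul_one]
  · intro i hi
    rw [dpow_mul_dpow, coeff_dpow, if_neg (by omega), mul_zero]

theorem mul_one' (P : PsiDO) : P * 1 = P := by
  ext N
  change (P * dpow 0).coeff N = _
  rw [coeff_mul_dpow, sub_zero]

theorem coeff_dpow_one_mul (P : PsiDO) (N : ℤ) :
    (dpow 1 * P).coeff N = tderiv 0 (P.coeff N) + P.coeff (N - 1) := by
  rw [coeff_dpow_mul, finsum_eq_sum_of_support_subset (s := range 2)]
  · have e1 : N - 1 + ((0 : ℕ) : ℤ) = N - 1 := by simp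
    have e2 : N - 1 + ((1 : ℕ) : ℤ) = N := by simp
    rw [Finset.sum_range_succ, Finset.sum_range_one, Ring.choose_zero_right, Ring.choose_one_right,
      Int.cast_one, one_mul, one_mul, dIter_zero, dIter_succ, dIter_zero, e1, e2, add_comm]
  · intro k hk
    rw [Finset.mem_coe, mem_range]
    by_contra h
    apply hk
    have : Ring.choose (1 : ℤ) k = 0 := by
      have h1 := Ring.choose_natCast (R := ℤ) 1 k
      rw [Nat.choose_eq_zero_of_lt (by omega)] at h1
      simpa using h1
    simp only
    rw [this, Int.cast_zero, zero_mul]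

/-- Pascal's rule for the generalised binomial coefficients; it holds for negative n as well. -/
theorem dpow_succ_mul (n : ℤ) (P : PsiDO) : dpow (n + 1) * P = dpow 1 * (dpow n * P) := by
  ext N
  obtain ⟨M, hM⟩ := P.exists_hasOrd
  obtain ⟨T, hT⟩ : ∃ T : ℕ, M < N - n - 1 + T := ⟨(M - N + n + 2).toNat, by omega⟩
  have key : ∀ (n N : ℤ) (T : ℕ), M < N - n + T → (dpow n * P).coeff N =
      ∑ k ∈ range T, ((Ring.choose n k : ℤ) : K) * dIter k (P.coeff (N - n + k)) := by
    intro n N T hT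
    rw [coeff_dpow_mul]
    refine finsum_eq_sum_of_support_subset _ fun k hk => ?_
    rw [Finset.mem_coe, mem_range]
    by_contra h
    exact hk (by simp only; rw [hM _ (by omega), map_zero, mul_zero])
  rw [coeff_dpow_one_mul, key (n + 1) N (T + 1) (by push_cast; omega),
    key n (N - 1) (T + 1) (by push_cast; omega), key n N T (by omega), Finset.sum_range_succ',
    Finset.sum_range_succ' _ T]
  have h1 : tderiv 0 (∑ k ∈ range T, ((Ring.choose n k : ℤ) : K) * dIter k (P.coeff (N - n + k))) =
      ∑ k ∈ range T, ((Ring.choose n k : ℤ) : K) * dIter (k + 1) (P.coeff (N - n + k)) := by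
    rw [← tder_apply, map_sum]
    refine Finset.sum_congr rfl fun k _ => ?_
    rw [dIter_succ, tder_apply, tderiv_mul, tderiv_intCast, mul_zero, add_zero]
  have e1 : ∀ k : ℕ, N - (n + 1) + (k + 1 : ℕ) = N - n + k := fun k => by push_cast; ring
  have e2 : ∀ k : ℕ, N - 1 - n + (k + 1 : ℕ) = N - n + k := fun k => by push_cast; ring
  have e3 : N - (n + 1) = N - 1 - n := by ring
  simp only [e1, e2, Ring.choose_succ_succ, Int.cast_add, add_mul, Ring.choose_zero_right]
  rw [h1, Finset.sum_add_distrib, e3]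
  abel

/-- Coefficientwise derivation by `t_{2k+1}` is additive and satisfies the Leibniz rule. -/
theorem timeDeriv_mul (k : ℕ) (P Q : PsiDO) :
    (P * Q).timeDeriv k = P.timeDeriv k * Q + P * Q.timeDeriv k := by
  ext N
  change tder k ((P * Q).coeff N) = _
  have h1 := finite_mul (P := P) (Q := Q) N
  rw [coeff_add, coeff_mul, coeff_mul, coeff_mul, ← finsum_add_distrib (finite_mul N)
    (finite_mul N)]
  refine (AddMonoidHom.map_finsum (tder k) h1).trans (finsum_congr fun p => ?_)
  rw [tder_apply, tderiv_mul, tderiv_intCast, tderiv_mul, tderiv_dIter]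
  change _ = _ * (tderiv k (P.coeff p.1) * _) + _ * (_ * dIter p.2 (tderiv k (Q.coeff _)))
  ring

theorem dpow_one_mul_eq (P : PsiDO) : dpow 1 * P = P.timeDeriv 0 + P * dpow 1 := by
  ext N
  rw [coeff_dpow_one_mul, coeff_add, coeff_mul_dpow]
  rfl

end PsiDO

namespace PsiDO

attribute [local instance] addCommGroup

/-! ### The ring of pseudodifferential operators -/

/-- The coefficient of ∂P one place above the order bound of P is the leading coefficient of P, so
the bound can be lowered indefinitely. -/
theorem eq_zero_of_dpow_one_mul {P : PsiDO} (h : dpow 1 * P = 0) : P = 0 := by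
  obtain ⟨L, hL⟩ := P.exists_hasOrd
  have h1 : ∀ n : ℕ, P.HasOrd (L - n) := by
    intro n
    induction n with
    | zero => simpa using hL
    | succ n ih =>
      intro m hm
      by_cases hm' : L - n < m
      · exact ih m hm'
      · have h2 := congrArg (fun Q => Q.coeff (m + 1)) h
        simp only [coeff_dpow_one_mul, coeff_zero] at h2
        rw [ih (m + 1) (by push_cast at hm; omega), tderiv_zero, zero_add,
          add_sub_cancel_right] at h2
        exact h2
  ext m
  exact h1 (L - m + 1).toNat m (by omega)

theorem dpow_one_mul_injective {P Q : PsiDO} (h : dpow 1 * P = dpow 1 * Q) : P = Q := by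
  rw [← sub_eq_zero]
  refine eq_zero_of_dpow_one_mul ?_
  have h1 : dpow 1 * (P - Q) + dpow 1 * Q = dpow 1 * P := by rw [← mul_add', sub_add_cancel]
  rw [← h] at h1
  exact add_eq_right.mp h1

/-- Both sides equal Q'R + ∑ q_i ∂^{i+1} R, by the Leibniz rule for ∂ on q_i (∂^i R). -/
theorem dpow_one_mul_assoc (Q R : PsiDO) : dpow 1 * Q * R = dpow 1 * (Q * R) := by
  have h1 : ∀ N, (dpow 1 * (Q * R)).coeff N = (Q.timeDeriv 0 * R).coeff N +
      ∑ᶠ i : ℤ, Q.coeff i * (dpow (i + 1) * R).coeff N := by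
    intro N
    have h2 := coeff_mul_eq (Q.timeDeriv 0) R N
    rw [h2, coeff_dpow_one_mul, ← tder_apply, coeff_mul_eq, coeff_mul_eq,
      AddMonoidHom.map_finsum (tder 0) (finite_coeff_mul Q R N),
      ← finsum_add_distrib ((finite_coeff_mul Q R N).subset fun i hi h => hi (by
        simp only at h ⊢; rw [h, map_zero])) (finite_coeff_mul Q R (N - 1)),
      ← finsum_add_distrib (finite_coeff_mul _ R N)]
    · refine finsum_congr fun i => ?_
      rw [dpow_succ_mul, coeff_dpow_one_mul, tder_apply, tderiv_mul]
      change _ = tderiv 0 (Q.coeff i) * _ + _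
      ring
    · obtain ⟨L, hL⟩ := Q.exists_hasOrd
      obtain ⟨M, hM⟩ := R.exists_hasOrd
      refine (Set.finite_Icc (N - M - 1) L).subset fun i hi => ?_
      rw [Set.mem_Icc]
      by_contra h
      apply hi
      by_cases h1 : L < i
      · simp only; rw [hL i h1, zero_mul]
      · simp only; rw [(hasOrd_dpow (i + 1)).mul hM N (by omega), mul_zero]
  ext N
  rw [h1, dpow_one_mul_eq, add_mul', coeff_add, coeff_mul_eq (Q * dpow 1)]
  congr 1
  rw [← finsum_comp_equiv (Equiv.addRight (1 : ℤ))]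
  refine finsum_congr fun i => ?_
  rw [Equiv.coe_addRight, coeff_mul_dpow, add_sub_cancel_right]

/-- For negative exponents the identity is multiplied by ∂ from the left, which is injective and
leads back to the preceding case. -/
theorem dpow_mul_assoc (m : ℤ) (Q R : PsiDO) : dpow m * Q * R = dpow m * (Q * R) := by
  induction m using Int.induction_on with
  | zero =>
    change 1 * Q * R = 1 * (Q * R)
    rw [one_mul', one_mul']
  | succ m ih => rw [dpow_succ_mul, dpow_one_mul_assoc, ih, ← dpow_succ_mul]
  | pred m ih =>
    refine dpow_one_mul_injective ?_
    rw [← dpow_one_mul_assoc, ← dpow_succ_mul, ← dpow_succ_mul, sub_add_cancel, ih]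

/-- Once powers of ∂ associate, both sides are the same double sum over powers in P and in ∂^i Q,
taken in the two orders; the order bounds make it finite. -/
theorem mul_assoc' (P Q R : PsiDO) : P * Q * R = P * (Q * R) := by
  ext N
  obtain ⟨L, hL⟩ := P.exists_hasOrd
  obtain ⟨M, hM⟩ := Q.exists_hasOrd
  obtain ⟨T, hT⟩ := R.exists_hasOrd
  have hfin : (Function.support fun p : ℤ × ℤ => P.coeff p.1 * (dpow p.1 * Q).coeff p.2 *
      (dpow p.2 * R).coeff N).Finite := by
    refine ((Set.finite_Icc (N - T - M) L).prod (Set.finite_Icc (N - T) (L + M))).subset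
      fun p hp => ?_
    have h1 : p.1 ≤ L := by
      by_contra h
      exact hp (by simp only; rw [hL _ (by omega), zero_mul, zero_mul])
    have h2 : p.2 ≤ p.1 + M := by
      by_contra h
      exact hp (by
        simp only; rw [(hasOrd_dpow p.1).mul hM _ (by omega), mul_zero, zero_mul])
    have h3 : N ≤ p.2 + T := by
      by_contra h
      exact hp (by simp only; rw [(hasOrd_dpow p.2).mul hT _ (by omega), mul_zero])
    rw [Set.mem_prod, Set.mem_Icc, Set.mem_Icc]
    omega
  have h1 : (P * Q * R).coeff N = ∑ᶠ j : ℤ, ∑ᶠ i : ℤ, P.coeff i * (dpow i * Q).coeff j *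
      (dpow j * R).coeff N := by
    rw [coeff_mul_eq]
    refine finsum_congr fun j => ?_
    rw [coeff_mul_eq P Q, mul_comm, ← smul_eq_mul, smul_finsum' _ (finite_coeff_mul P Q j)]
    exact finsum_congr fun i => by rw [smul_eq_mul, mul_comm]
  have h2 : (P * (Q * R)).coeff N = ∑ᶠ i : ℤ, ∑ᶠ j : ℤ, P.coeff i * (dpow i * Q).coeff j *
      (dpow j * R).coeff N := by
    rw [coeff_mul_eq]
    refine finsum_congr fun i => ?_
    rw [← dpow_mul_assoc, coeff_mul_eq (dpow i * Q), ← smul_eq_mul,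
      smul_finsum' _ (finite_coeff_mul _ R N)]
    exact finsum_congr fun j => by rw [smul_eq_mul, mul_assoc]
  rw [h1, h2, ← finsum_curry _ hfin, ← finsum_comp_equiv (Equiv.prodComm ℤ ℤ),
    finsum_curry]
  · rfl
  · exact hfin.preimage (Equiv.prodComm ℤ ℤ).injective.injOn

/-- The ring of pseudodifferential operators. -/
@[reducible] def ring : Ring PsiDO :=
  { addCommGroup with
    mul := fun P Q => P * Q
    one := 1
    npow := fun n P => P ^ n
    mul_assoc := mul_assoc'
    one_mul := one_mul'
    mul_one := mul_one'
    left_distrib := mul_add'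
    right_distrib := add_mul'
    zero_mul := fun P => by
      have h := add_mul' 0 0 P
      rw [add_zero] at h
      exact left_eq_add.mp h
    mul_zero := fun P => by
      have h := mul_add' P 0 0
      rw [add_zero] at h
      exact left_eq_add.mp h }

end PsiDO

namespace PsiDO

attribute [local instance 50] ring

/-! ### The formal adjoint -/

/-- Multiplication by a function. -/
def fn (a : K) : PsiDO := ⟨fun m => if m = 0 then a else 0, 0, fun _ h => if_neg h.ne'⟩

theorem coeff_fn (a : K) (m : ℤ) : (fn a).coeff m = if m = 0 then a else 0 := rfl

theorem hasOrd_fn (a : K) : (fn a).HasOrd 0 := fun _ h => if_neg h.ne'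

theorem coeff_fn_mul (a : K) (P : PsiDO) (N : ℤ) : (fn a * P).coeff N = a * P.coeff N := by
  rw [coeff_mul_eq, finsum_eq_single _ 0]
  · change a * (1 * P).coeff N = _
    rw [one_mul']
  · intro i hi
    rw [coeff_fn, if_neg hi, zero_mul]

theorem fn_one : fn 1 = 1 := rfl

theorem fn_mul_fn (a b : K) : fn a * fn b = fn (a * b) := by
  ext N
  rw [coeff_fn_mul, coeff_fn, coeff_fn, mul_ite, mul_zero]

theorem coeff_fn_mul_dpow (a : K) (m N : ℤ) :
    (fn a * dpow m).coeff N = if N = m then a else 0 := by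
  rw [coeff_fn_mul, coeff_dpow, mul_ite, mul_one, mul_zero]

theorem timeDeriv_fn (k : ℕ) (a : K) : (fn a).timeDeriv k = fn (tderiv k a) := by
  ext N
  change tderiv k ((fn a).coeff N) = _
  rw [coeff_fn, coeff_fn]
  split_ifs
  · rfl
  · exact tderiv_zero k

theorem dpow_one_mul_fn (a : K) : dpow 1 * fn a = fn (tderiv 0 a) + fn a * dpow 1 := by
  rw [dpow_one_mul_eq, timeDeriv_fn]

/-- The coefficients, as additive maps. -/
def coeffHom (m : ℤ) : PsiDO →+ K where
  toFun P := P.coeff m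
  map_zero' := rfl
  map_add' _ _ := rfl

theorem coeff_zsmul (z : ℤ) (P : PsiDO) (m : ℤ) : (z • P).coeff m = z * P.coeff m := by
  rw [← zsmul_eq_mul]
  exact map_zsmul (coeffHom m) z P

/-- Additive maps of bounded order are determined by their values on the operators `a ∂^m`. -/
theorem eq_of_mono {S T : PsiDO → PsiDO} (hS : ∀ P Q, S (P + Q) = S P + S Q)
    (hT : ∀ P Q, T (P + Q) = T P + T Q) {c : ℤ}
    (hS' : ∀ P L, HasOrd P L → (S P).HasOrd (L + c))
    (hT' : ∀ P L, HasOrd P L → (T P).HasOrd (L + c))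
    (h : ∀ a m, S (fn a * dpow m) = T (fn a * dpow m)) (P : PsiDO) : S P = T P := by
  ext N
  -- Operators of order below N - c do not reach the coefficient N; otherwise the leading term is
  -- split off and the order drops by one.
  have key : ∀ (n : ℕ) (P : PsiDO), P.HasOrd (N - c - 1 + n) → (S P).coeff N = (T P).coeff N := by
    intro n
    induction n with
    | zero =>
      intro P hP
      rw [hS' P _ hP N (by push_cast; omega), hT' P _ hP N (by push_cast; omega)]
    | succ n ih =>
      intro P hP
      obtain ⟨M, hM⟩ : ∃ M, M = N - c - 1 + (n + 1 : ℕ) := ⟨_, rfl⟩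
      rw [← hM] at hP
      have e : P = fn (P.coeff M) * dpow M + (P - fn (P.coeff M) * dpow M) := by abel
      rw [e, hS, hT, coeff_add, coeff_add, h, ih]
      intro m hm
      rw [coeff_sub, coeff_fn_mul_dpow]
      by_cases hmM : m = M
      · rw [if_pos hmM, hmM, sub_self]
      · rw [if_neg hmM, hP m (by push_cast at hM; omega), sub_zero]
  obtain ⟨L, hL⟩ := P.exists_hasOrd
  exact key (L - (N - c - 1)).toNat P (hL.mono (by omega))

/-- The sign `(-1)^m`. -/
def sg (m : ℤ) : ℤ := ((-1 : ℤˣ) ^ m : ℤˣ)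

theorem sg_add (m n : ℤ) : sg (m + n) = sg m * sg n := by
  rw [sg, zpow_add]; rfl

theorem sg_one : sg 1 = -1 := rfl

theorem sg_zero : sg 0 = 1 := rfl

theorem sg_mul_self (m : ℤ) : sg m * sg m = 1 := by
  rw [sg, ← Units.val_mul, ← mul_zpow]; simp

theorem sg_neg (m : ℤ) : sg (-m) = sg m := by
  rw [sg, zpow_neg, Int.units_inv_eq_self]; rfl

theorem coeff_adj (P : PsiDO) (N : ℤ) : P.adj.coeff N = ∑ᶠ k : ℕ, (sg (N + k) : K) *
    (((Ring.choose (N + k) k : ℤ) : K) * dIter k (P.coeff (N + k))) := by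
  simp only [dIter_apply, ← zsmul_eq_mul]; rfl

theorem finite_adj (P : PsiDO) (N : ℤ) : (Function.support fun k : ℕ => (sg (N + k) : K) *
    (((Ring.choose (N + k) k : ℤ) : K) * dIter k (P.coeff (N + k)))).Finite := by
  obtain ⟨M, hM⟩ := P.exists_hasOrd
  refine (range (M - N + 1).toNat).finite_toSet.subset fun k hk => ?_
  rw [Finset.mem_coe, mem_range]
  by_contra h
  exact hk (by simp only; rw [hM _ (by omega), map_zero, mul_zero, mul_zero])

theorem adj_add (P Q : PsiDO) : (P + Q).adj = P.adj + Q.adj := by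
  ext N
  rw [coeff_add, coeff_adj, coeff_adj, coeff_adj, ← finsum_add_distrib (finite_adj P N)
    (finite_adj Q N)]
  exact finsum_congr fun k => by rw [coeff_add, map_add]; ring

/-- The adjoint as an additive map. -/
def adjHom : PsiDO →+ PsiDO := AddMonoidHom.mk' adj adj_add

theorem adj_zsmul (z : ℤ) (P : PsiDO) : (z • P).adj = z • P.adj := map_zsmul adjHom z P

theorem HasOrd.adj {P : PsiDO} {L : ℤ} (h : P.HasOrd L) : P.adj.HasOrd L := by
  intro N hN
  rw [coeff_adj]
  refine finsum_eq_zero_of_forall_eq_zero fun k => ?_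
  rw [h _ (by omega), map_zero, mul_zero, mul_zero]

theorem coeff_adj_top {P : PsiDO} {L : ℤ} (h : P.HasOrd L) :
    P.adj.coeff L = sg L * P.coeff L := by
  rw [coeff_adj, finsum_eq_single _ 0]
  · rw [Ring.choose_zero_right, Int.cast_one, one_mul, dIter_zero, Nat.cast_zero, add_zero]
  · intro k hk
    rw [h _ (by omega), map_zero, mul_zero, mul_zero]

theorem adj_fn_mul_dpow (a : K) (m : ℤ) : (fn a * dpow m).adj = sg m • (dpow m * fn a) := by
  ext N
  have h := smul_finsum' (sg m : K) (finite_dpow_mul m (fn a) N)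
  simp only [smul_eq_mul] at h
  rw [coeff_adj, coeff_zsmul, coeff_dpow_mul, h]
  refine finsum_congr fun k => ?_
  rw [coeff_fn_mul_dpow, coeff_fn]
  by_cases h : N + k = m
  · rw [if_pos h, if_pos (by omega), h]
  · rw [if_neg h, if_neg (by omega)]
    simp

theorem adj_fn (a : K) : (fn a).adj = fn a := by
  have h := adj_fn_mul_dpow a 0
  have e : dpow 0 = 1 := rfl
  rwa [e, mul_one, one_mul, sg_zero, one_smul] at h

theorem adj_dpow (m : ℤ) : (dpow m).adj = sg m • dpow m := by
  have h := adj_fn_mul_dpow 1 m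
  rwa [fn_one, mul_one, one_mul] at h

theorem adj_fn_mul (a : K) (Q : PsiDO) : (fn a * Q).adj = Q.adj * fn a := by
  refine eq_of_mono (S := fun Q => (fn a * Q).adj) (T := fun Q => Q.adj * fn a) (c := 0)
    (fun P Q => by rw [mul_add, adj_add]) (fun P Q => by rw [adj_add, add_mul])
    (fun P L h => ?_) (fun P L h => h.adj.mul (hasOrd_fn a)) (fun b n => ?_) Q
  · have := ((hasOrd_fn a).mul h).adj
    rwa [add_comm] at this
  · rw [← mul_assoc, fn_mul_fn, adj_fn_mul_dpow, adj_fn_mul_dpow, smul_mul_assoc, mul_assoc,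
      fn_mul_fn, mul_comm a]

theorem adj_dpow_one_mul (Q : PsiDO) : (dpow 1 * Q).adj = -(Q.adj * dpow 1) := by
  refine eq_of_mono (S := fun Q => (dpow 1 * Q).adj) (T := fun Q => -(Q.adj * dpow 1)) (c := 1)
    (fun P Q => by rw [mul_add, adj_add]) (fun P Q => by rw [adj_add, add_mul, neg_add])
    (fun P L h => ?_) (fun P L h m hm => ?_) (fun b n => ?_) Q
  · have := ((hasOrd_dpow 1).mul h).adj
    rwa [add_comm] at this
  · rw [coeff_neg, (h.adj.mul (hasOrd_dpow 1)) m hm, neg_zero]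
  · rw [← mul_assoc, dpow_one_mul_fn, add_mul, mul_assoc, dpow_mul_dpow, adj_add, adj_fn_mul_dpow,
      adj_fn_mul_dpow, adj_fn_mul_dpow, add_comm 1 n, sg_add, sg_one, ← dpow_mul_dpow, mul_assoc,
      dpow_one_mul_fn, mul_add, mul_neg_one, neg_smul, smul_add, smul_mul_assoc, mul_assoc]
    abel

/-- The negative exponents follow from the rule for ∂ itself, by multiplying with ∂⁻¹ on the right.
-/
theorem adj_dpow_mul (m : ℤ) (Q : PsiDO) : (dpow m * Q).adj = sg m • (Q.adj * dpow m) := by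
  induction m using Int.induction_on with
  | zero =>
    have e : dpow 0 = 1 := rfl
    rw [e, one_mul, mul_one, sg_zero, one_smul]
  | succ m ih =>
    rw [dpow_succ_mul, adj_dpow_one_mul, ih, sg_add, sg_one, smul_mul_assoc, mul_assoc,
      dpow_mul_dpow, mul_neg_one, neg_smul]
  | pred m ih =>
    have h1 := adj_dpow_one_mul (dpow (-m - 1) * Q)
    rw [← dpow_succ_mul, sub_add_cancel, ih] at h1
    have h2 := congrArg (fun R => R * dpow (-1)) h1
    simp only [neg_mul, smul_mul_assoc, mul_assoc, dpow_mul_dpow] at h2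
    have e : dpow (1 + -1) = 1 := rfl
    rw [e, mul_one] at h2
    have e2 : sg (-m - 1) = -sg (-m) := by
      rw [sub_eq_add_neg, sg_add, sg_neg 1, sg_one, mul_neg_one]
    rw [e2, neg_smul, sub_eq_add_neg, h2, neg_neg]
    rfl

/-- The adjoint reverses products. -/
theorem adj_mul (P Q : PsiDO) : (P * Q).adj = Q.adj * P.adj := by
  obtain ⟨M, hM⟩ := Q.exists_hasOrd
  refine eq_of_mono (S := fun P => (P * Q).adj) (T := fun P => Q.adj * P.adj) (c := M)
    (fun P Q => by rw [add_mul, adj_add]) (fun P Q => by rw [adj_add, mul_add])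
    (fun P L h => (h.mul hM).adj) (fun P L h => ?_) (fun b n => ?_) P
  · rw [add_comm]
    exact hM.adj.mul h.adj
  · rw [mul_assoc, adj_fn_mul, adj_dpow_mul, adj_fn_mul_dpow, smul_mul_assoc, mul_smul_comm,
      mul_assoc]

theorem adj_adj (P : PsiDO) : P.adj.adj = P := by
  refine eq_of_mono (S := fun P => P.adj.adj) (T := fun P => P) (c := 0)
    (fun P Q => by rw [adj_add, adj_add]) (fun P Q => rfl)
    (fun P L h => by rw [add_zero]; exact h.adj.adj) (fun P L h => by rwa [add_zero])
    (fun b n => ?_) P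
  rw [adj_fn_mul_dpow, adj_zsmul, adj_mul, adj_fn, adj_dpow, mul_smul_comm, smul_smul, sg_mul_self,
    one_smul]

/-! ### Differential operators -/

/-- `P` is a differential operator. -/
def IsDiff (P : PsiDO) : Prop := ∀ m < 0, P.coeff m = 0

theorem IsDiff.add {P Q : PsiDO} (hP : P.IsDiff) (hQ : Q.IsDiff) : (P + Q).IsDiff :=
  fun m hm => by rw [coeff_add, hP m hm, hQ m hm, add_zero]

theorem IsDiff.zsmul {P : PsiDO} (hP : P.IsDiff) (z : ℤ) : (z • P).IsDiff :=
  fun m hm => by rw [coeff_zsmul, hP m hm, mul_zero]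

theorem isDiff_fn (a : K) : (fn a).IsDiff := fun _ hm => if_neg hm.ne

theorem IsDiff.dpow_mul {P : PsiDO} (hP : P.IsDiff) (n : ℕ) : (dpow n * P).IsDiff := by
  induction n with
  | zero =>
    change (1 * P).IsDiff
    rwa [one_mul]
  | succ n ih =>
    intro m hm
    rw [Nat.cast_succ, dpow_succ_mul, coeff_dpow_one_mul, ih m hm, ih (m - 1) (by omega),
      tderiv_zero, add_zero]

theorem IsDiff.mul {P Q : PsiDO} (hP : P.IsDiff) (hQ : Q.IsDiff) : (P * Q).IsDiff := by
  intro m hm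
  rw [coeff_mul_eq]
  refine finsum_eq_zero_of_forall_eq_zero fun i => ?_
  by_cases hi : i < 0
  · rw [hP i hi, zero_mul]
  · obtain ⟨n, rfl⟩ := Int.eq_ofNat_of_zero_le (not_lt.mp hi)
    rw [hQ.dpow_mul n m hm, mul_zero]

theorem IsDiff.minusPart {P : PsiDO} (hP : P.IsDiff) : P.minusPart = 0 := by
  ext m
  change (if m < 0 then P.coeff m else 0) = 0
  split_ifs with h
  · exact hP m h
  · rfl

/-- All terms with derivatives drop out, because binom(k-1, k) = 0 for k ≥ 1. -/
theorem coeff_adj_neg_one (P : PsiDO) : P.adj.coeff (-1) = -P.coeff (-1) := by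
  rw [coeff_adj, finsum_eq_single _ 0]
  · rw [Ring.choose_zero_right, Int.cast_one, one_mul, dIter_zero, Nat.cast_zero, add_zero, sg_neg,
      sg_one]
    push_cast
    ring
  · intro k hk
    obtain ⟨k, rfl⟩ := Nat.exists_eq_succ_of_ne_zero hk
    have h := Ring.choose_natCast (R := ℤ) k (k + 1)
    rw [Nat.choose_succ_self] at h
    have e : -1 + ((k.succ : ℕ) : ℤ) = k := by push_cast; ring
    rw [e, h]
    simp

/-- The bridge between spectral parameter and operators: the residue of P Q^* is Res_z P(z) Q(-z),
with no derivatives of coefficients. It holds because ∂^i Q^* is, up to sign, the adjoint of Q ∂^i,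
whose residue is minus a plain coefficient of Q. -/
theorem coeff_mul_adj_neg_one (P Q : PsiDO) : (P * Q.adj).coeff (-1) =
    ∑ᶠ i : ℤ, (sg (-1 - i) : K) * (P.coeff i * Q.coeff (-1 - i)) := by
  rw [coeff_mul_eq]
  refine finsum_congr fun i => ?_
  have h1 : dpow i * Q.adj = sg i • (Q * dpow i).adj := by
    rw [adj_mul, adj_dpow, smul_mul_assoc, smul_smul, sg_mul_self, one_smul]
  have h2 : sg (-1 - i) = -sg i := by
    rw [sub_eq_add_neg, sg_add, sg_neg, sg_neg, sg_one, neg_one_mul]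
  rw [h1, coeff_zsmul, coeff_adj_neg_one, coeff_mul_dpow, h2]
  push_cast
  ring

/-- A product `P Q^*` is a differential operator if all `P (∂^n Q)^*` have residue zero. -/
theorem isDiff_mul_adj {P Q : PsiDO} (h : ∀ n : ℕ, (P * (dpow n * Q).adj).coeff (-1) = 0) :
    (P * Q.adj).IsDiff := by
  intro m hm
  obtain ⟨n, rfl⟩ : ∃ n : ℕ, m = -1 - n := ⟨(-1 - m).toNat, by omega⟩
  -- As (∂^n Q)^* = (-1)^n Q^* ∂^n, this residue is, up to sign, the coefficient of P Q^* at -1 - n.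
  have h1 := h n
  rw [adj_dpow_mul, mul_smul_comm, coeff_zsmul, ← mul_assoc, coeff_mul_dpow] at h1
  refine (mul_eq_zero.mp h1).resolve_left fun h2 => ?_
  have h3 := sg_mul_self n
  have h4 : ((sg n * sg n : ℤ) : K) = 0 := by rw [Int.cast_mul, h2, zero_mul]
  rw [h3] at h4
  simp at h4

/-- The operator with symbol `∑_m h_m z^m`. -/
def op (h : ℤ → Times) (hb : ∃ N : ℤ, ∀ m, N < m → h m = 0) : PsiDO :=
  ⟨fun m => algebraMap Times K (h m), by
    obtain ⟨N, hN⟩ := hb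
    exact ⟨N, fun m hm => by rw [hN m hm, map_zero]⟩⟩

theorem coeff_op (h : ℤ → Times) (hb : ∃ N : ℤ, ∀ m, N < m → h m = 0) (m : ℤ) :
    (op h hb).coeff m = algebraMap Times K (h m) := rfl

theorem sg_cast (m : ℤ) (f : Times) : (sg m : K) * algebraMap Times K f =
    algebraMap Times K (((-1 : ℂ) ^ m) • f) := by
  rcases Int.even_or_odd m with h | h
  · have : sg m = 1 := by rw [sg, h.neg_one_zpow]; rfl
    rw [this, h.neg_one_zpow, one_smul, Int.cast_one, one_mul]
  · have : sg m = -1 := by rw [sg, h.neg_one_zpow]; rfl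
    rw [this, h.neg_one_zpow, neg_smul, one_smul, map_neg]
    push_cast
    ring

theorem coeff_op_mul_adj_op {h h' : ℤ → Times} (hb : ∃ N : ℤ, ∀ m, N < m → h m = 0)
    (hb' : ∃ N : ℤ, ∀ m, N < m → h' m = 0) :
    (op h hb * (op h' hb').adj).coeff (-1) = algebraMap Times K (diagRes h h') := by
  obtain ⟨N, hN⟩ := hb
  obtain ⟨N', hN'⟩ := hb'
  have hfin : (Function.support fun i : ℤ =>
      ((-1 : ℂ) ^ (-1 - i)) • (h i * h' (-1 - i))).Finite :=
    (finite_mul_of_bdd hN hN' (-1)).subset fun i hi h0 => hi (by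
      simp only at h0 ⊢; rw [h0, smul_zero])
  rw [coeff_mul_adj_neg_one, diagRes]
  refine Eq.trans (finsum_congr fun i => ?_)
    (AddMonoidHom.map_finsum (algebraMap Times K).toAddMonoidHom hfin).symm
  rw [coeff_op, coeff_op, ← map_mul, sg_cast]
  rfl

/-- The bilinear residue identity on the level of pseudodifferential operators. -/
theorem isDiff_of_resZero {h h' : ℤ → Times} (hb : ∃ N : ℤ, ∀ m, N < m → h m = 0)
    (hb' : ∃ N : ℤ, ∀ m, N < m → h' m = 0) (hr : ResZero (mulExp 1 h) (mulExp 1 h')) :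
    (op h hb * (op h' hb').adj).IsDiff := by
  refine isDiff_mul_adj fun n => ?_
  -- Differentiating the bilinear identity in the second variable s_1 replaces the second symbol by
  -- that of ∂ times its operator.
  have key : ∀ n : ℕ, ∃ (f : ℤ → Times) (hf : ∃ N : ℤ, ∀ m, N < m → f m = 0),
      dpow n * op h' hb' = op f hf ∧ ResZero (mulExp 1 h) (mulExp 1 f) := by
    intro n
    induction n with
    | zero => exact ⟨h', hb', one_mul' _, hr⟩
    | succ n ih =>
      obtain ⟨f, hf, h1, h2⟩ := ih
      refine ⟨fun m => MvPowerSeries.pderiv ℂ 0 (f m) + f (m - (2 * 0 + 1 : ℕ)), ?_, ?_, ?_⟩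
      · obtain ⟨N, hN⟩ := id hf
        exact ⟨N + 1, fun m hm => by
          beta_reduce
          rw [hN m (by omega), hN _ (by push_cast; omega), map_zero, add_zero]⟩
      · ext m
        rw [Nat.cast_succ, dpow_succ_mul, h1, coeff_dpow_one_mul, coeff_op, coeff_op, coeff_op, tderiv_algebraMap, map_add]
        rfl
      · have h3 := h2.pderiv_right 0
        simp only [pderiv_mulExp] at h3
        exact h3
  obtain ⟨f, hf, h1, h2⟩ := key n
  obtain ⟨N, hN⟩ := id hb
  obtain ⟨N', hN'⟩ := id hf
  rw [h1, coeff_op_mul_adj_op, diagRes_eq_zero hN hN' h2, map_zero]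

end PsiDO

theorem coeff_hatW (v : Fock) (α : Finset ℕ) (m : ℤ) : (hatW v α).coeff m = hatw v α m := by
  rw [hatW, PsiDO.ofSymbol, dif_pos ⟨0, fun m hm => hatw_pos v α hm⟩]

namespace PsiDO

attribute [local instance 50] ring

/-! ### Wave operators -/

/-- The operator with symbol `g_α e^{-φ}`. -/
def symbOp (v : Fock) (α : Finset ℕ) : PsiDO :=
  op (symb v α) ⟨top α, fun _ hm => symb_eq_zero v α hm⟩

/-- The normalisation of the wave function. -/
def scale (v : Fock) (α : Finset ℕ) : K :=
  algebraMap Times K ((-1 : ℂ) ^ top α • 1) / algebraMap Times K (den v α)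

theorem hatW_mul_dpow (v : Fock) (α : Finset ℕ) :
    hatW v α * dpow (top α) = fn (scale v α) * symbOp v α := by
  ext N
  rw [coeff_mul_dpow, coeff_hatW, hatw_eq, sub_add_cancel, coeff_fn_mul, symbOp, coeff_op, scale,
    div_mul_eq_mul_div, ← map_mul, smul_mul_assoc, one_mul]

/-- Up to functions multiplied from the left and the right, and a sign, the operator is S_α S_β^*
for the symbols S of g e^{-φ}: the power of ∂ in the middle undoes the normalisation of both orders.
-/
theorem isDiff_hatW {v : Fock} {α β : Finset ℕ} (h : ResZero (g v α) (g v β)) :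
    (hatW v α * dpow (top α + top β) * (hatW v β).adj).IsDiff := by
  have h1 : dpow (top β) * (hatW v β).adj =
      sg (top β) • ((symbOp v β).adj * fn (scale v β)) := by
    rw [← adj_fn_mul, ← hatW_mul_dpow, adj_mul, adj_dpow, smul_mul_assoc, smul_smul, sg_mul_self,
      one_smul]
  rw [← mulExp_symb, ← mulExp_symb v β] at h
  rw [← dpow_mul_dpow, ← mul_assoc, hatW_mul_dpow, mul_assoc _ (dpow (top β)), h1, mul_smul_comm,
    mul_assoc, ← mul_assoc (symbOp v α)]
  exact ((isDiff_fn _).mul ((isDiff_of_resZero _ _ h).mul (isDiff_fn _))).zsmul _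

theorem top_zero : top {0} = 0 := rfl

theorem hatW_zero_eq (v : Fock) : hatW v {0} = fn (scale v {0}) * symbOp v {0} := by
  rw [← hatW_mul_dpow, top_zero]
  exact (mul_one _).symm

/-- The t_k-derivative of the bilinear identity, with `pderiv_mulExp` for the factor e^φ. The
derivative also hits the normalising function, which only adds a multiple of the original
differential operator. -/
theorem isDiff_timeDeriv_hatW {v : Fock} (h : ResZero (g v {0}) (g v {0})) (k : ℕ) :
    (((hatW v {0}).timeDeriv k + hatW v {0} * dpow (2 * k + 1)) * (hatW v {0}).adj).IsDiff := by
  rw [← mulExp_symb] at h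
  have h2 := h.pderiv_left k
  simp only [pderiv_mulExp] at h2
  have hb : ∃ N : ℤ, ∀ m, N < m → MvPowerSeries.pderiv ℂ k (symb v {0} m) +
      symb v {0} (m - (2 * k + 1 : ℕ)) = 0 :=
    ⟨top {0} + (2 * k + 1 : ℕ), fun m hm => by
      rw [symb_eq_zero v {0} (m := m) (by omega), symb_eq_zero v {0} (by omega), map_zero,
        add_zero]⟩
  have e : op _ hb = (symbOp v {0}).timeDeriv k + symbOp v {0} * dpow (2 * k + 1) := by
    ext m
    rw [coeff_add, coeff_mul_dpow, symbOp, coeff_op, coeff_op, map_add, ← tderiv_algebraMap]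
    push_cast
    rfl
  have h3 := isDiff_of_resZero hb ⟨top {0}, fun _ hm => symb_eq_zero v {0} hm⟩ h2
  have h4 := isDiff_of_resZero ⟨top {0}, fun _ hm => symb_eq_zero v {0} hm⟩
    ⟨top {0}, fun _ hm => symb_eq_zero v {0} hm⟩ h
  rw [e] at h3
  have h5 : ((hatW v {0}).timeDeriv k + hatW v {0} * dpow (2 * k + 1)) * (hatW v {0}).adj =
      fn (tderiv k (scale v {0})) * (symbOp v {0} * (symbOp v {0}).adj) * fn (scale v {0}) +
      fn (scale v {0}) * (((symbOp v {0}).timeDeriv k + symbOp v {0} * dpow (2 * k + 1)) *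
        (symbOp v {0}).adj) * fn (scale v {0}) := by
    rw [hatW_zero_eq, timeDeriv_mul, timeDeriv_fn, adj_fn_mul]
    simp only [mul_add, add_mul, mul_assoc]
    abel
  rw [h5]
  exact (((isDiff_fn _).mul h4).mul (isDiff_fn _)).add (((isDiff_fn _).mul h3).mul (isDiff_fn _))

/-! ### Monic operators of order zero -/

/-- The leading coefficient of X V is that of X, so the order of X can be lowered indefinitely. This
makes a right inverse of a monic operator two-sided. -/
theorem eq_zero_of_mul_monic {X V : PsiDO} (hV : V.HasOrd 0) (h1 : V.coeff 0 = 1)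
    (h : X * V = 0) : X = 0 := by
  obtain ⟨L, hL⟩ := X.exists_hasOrd
  have key : ∀ n : ℕ, X.HasOrd (L - n) := by
    intro n
    induction n with
    | zero => simpa using hL
    | succ n ih =>
      intro m hm
      by_cases hmn : L - n < m
      · exact ih m hmn
      · have h2 := coeff_mul_top ih hV
        rw [h, coeff_zero, h1, mul_one] at h2
        have e : m = L - n := by push_cast at hm; omega
        rw [e, ← h2]
  ext m
  exact key (L - m + 1).toNat m (by omega)

theorem mul_eq_one_symm {W V : PsiDO} (hV : V.HasOrd 0) (h1 : V.coeff 0 = 1)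
    (h : W * V = 1) : V * W = 1 := by
  rw [← sub_eq_zero]
  refine eq_zero_of_mul_monic hV h1 ?_
  rw [sub_mul, mul_assoc, h, mul_one, one_mul, sub_self]

theorem inv_eq {W V : PsiDO} (h1 : W * V = 1) (h2 : V * W = 1) : W⁻¹ = V := by
  have h : ∃ Q : PsiDO, W * Q = 1 ∧ Q * W = 1 := ⟨V, h1, h2⟩
  -- The inverse is defined by an arbitrary choice, which uniqueness of two-sided inverses pins
  -- down.
  have e : W⁻¹ = h.choose := dif_pos h
  obtain ⟨Q, hQ⟩ : ∃ Q, Q = h.choose := ⟨_, rfl⟩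
  have h3 : Q * W = 1 := by rw [hQ]; exact h.choose_spec.2
  rw [e, ← hQ, ← mul_one Q, ← h1, ← mul_assoc, h3, one_mul]

theorem eq_one_of_isDiff {P : PsiDO} (hd : P.IsDiff) (ho : P.HasOrd 0) (h : P.coeff 0 = 1) :
    P = 1 := by
  ext m
  change _ = if m = 0 then 1 else 0
  split_ifs with h0
  · rw [h0, h]
  · rcases lt_or_gt_of_ne h0 with h1 | h1
    · exact hd m h1
    · exact ho m h1

theorem coeff_plusPart (P : PsiDO) (m : ℤ) :
    P.plusPart.coeff m = if 0 ≤ m then P.coeff m else 0 := rfl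

theorem coeff_minusPart (P : PsiDO) (m : ℤ) :
    P.minusPart.coeff m = if m < 0 then P.coeff m else 0 := rfl

/-- If `A` has negative order and `A + B` is differential, then `A + B = B_+`. -/
theorem plusPart_eq {A B : PsiDO} (hA : A.HasOrd (-1)) (h : (A + B).IsDiff) :
    B.plusPart = A + B := by
  ext m
  rw [coeff_plusPart]
  split_ifs with hm
  · rw [coeff_add, hA m (by omega), zero_add]
  · exact (h m (by omega)).symm

theorem minusPart_eq {A B : PsiDO} (hA : A.HasOrd (-1)) (h : (A + B).IsDiff) :
    -B.minusPart = A := by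
  ext m
  rw [coeff_neg, coeff_minusPart]
  split_ifs with hm
  · have := h m hm
    rw [coeff_add] at this
    exact neg_eq_of_add_eq_zero_left this
  · rw [hA m (by omega), neg_zero]

/-! ### Dressing by an orthogonal operator -/

/-- A monic operator of order zero with `W W^* = 1` that solves the linear problem of the
hierarchy. -/
structure Dressing (W : PsiDO) : Prop where
  hasOrd : W.HasOrd 0
  monic : W.coeff 0 = 1
  mul_adj : W * W.adj = 1
  isDiff : ∀ k : ℕ, ((W.timeDeriv k + W * dpow (2 * k + 1)) * W.adj).IsDiff

namespace Dressing

variable {W : PsiDO}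

theorem coeff_adj_zero (hW : W.Dressing) : W.adj.coeff 0 = 1 := by
  rw [coeff_adj_top hW.hasOrd, hW.monic, sg_zero, Int.cast_one, one_mul]

theorem adj_mul (hW : W.Dressing) : W.adj * W = 1 :=
  mul_eq_one_symm hW.hasOrd.adj hW.coeff_adj_zero hW.mul_adj

theorem inv (hW : W.Dressing) : W⁻¹ = W.adj := inv_eq hW.mul_adj hW.adj_mul

theorem hasOrd_timeDeriv (hW : W.Dressing) (k : ℕ) : (W.timeDeriv k * W.adj).HasOrd (-1) := by
  have h : (W.timeDeriv k).HasOrd (-1) := by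
    intro m hm
    change tderiv k (W.coeff m) = 0
    by_cases h0 : m = 0
    · rw [h0, hW.monic, tderiv_one]
    · rw [hW.hasOrd m (by omega), tderiv_zero]
  exact h.mul hW.hasOrd.adj

theorem isDiff_add (hW : W.Dressing) (k : ℕ) :
    (W.timeDeriv k * W.adj + W * dpow (2 * k + 1) * W.adj).IsDiff := by
  rw [← add_mul]
  exact hW.isDiff k

/-- W_{t_k} W^* has negative order and becomes differential on adding W ∂^k W^*, so it must cancel
exactly the negative part of the latter. -/
theorem sato (hW : W.Dressing) (k : ℕ) :
    W.timeDeriv k = -(W * dpow (2 * k + 1) * W.adj).minusPart * W := by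
  rw [minusPart_eq (hW.hasOrd_timeDeriv k) (hW.isDiff_add k), mul_assoc, hW.adj_mul, mul_one]

theorem plusPart_dressed (hW : W.Dressing) (k : ℕ) : (W * dpow (2 * k + 1) * W.adj).plusPart =
    W.timeDeriv k * W.adj + W * dpow (2 * k + 1) * W.adj :=
  plusPart_eq (hW.hasOrd_timeDeriv k) (hW.isDiff_add k)

theorem plusPart_mul (hW : W.Dressing) (k : ℕ) : (W * dpow (2 * k + 1) * W.adj).plusPart * W =
    W.timeDeriv k + W * dpow (2 * k + 1) := by
  rw [hW.plusPart_dressed, ← add_mul, mul_assoc, hW.adj_mul, mul_one]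

theorem hasOrd_lax (hW : W.Dressing) : (W * dpow 1 * W.adj).HasOrd 1 :=
  (hW.hasOrd.mul (hasOrd_dpow 1)).mul hW.hasOrd.adj

theorem coeff_lax_one (hW : W.Dressing) : (W * dpow 1 * W.adj).coeff 1 = 1 := by
  have h1 := coeff_mul_top hW.hasOrd (hasOrd_dpow 1)
  have h2 := coeff_mul_top (hW.hasOrd.mul (hasOrd_dpow 1)) hW.hasOrd.adj
  rw [h1, hW.monic, hW.coeff_adj_zero, coeff_dpow, if_pos rfl, mul_one, mul_one] at h2
  exact h2

theorem adj_lax : (W * dpow 1 * W.adj).adj = -(W * dpow 1 * W.adj) := by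
  rw [PsiDO.adj_mul, PsiDO.adj_mul, adj_adj, adj_dpow, sg_one, neg_one_smul, neg_mul, mul_neg,
    mul_assoc]

/-- The leading coefficient 1 is constant, so passing to the adjoint leaves the coefficient at 0
unchanged; but L^* = -L, so this coefficient equals its negative. -/
theorem coeff_lax_zero (hW : W.Dressing) : (W * dpow 1 * W.adj).coeff 0 = 0 := by
  have h1 : (W * dpow 1 * W.adj).adj.coeff 0 = (W * dpow 1 * W.adj).coeff 0 := by
    rw [coeff_adj, finsum_eq_single _ 0]
    · rw [Ring.choose_zero_right, Int.cast_one, one_mul, dIter_zero, Nat.cast_zero, add_zero,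
        sg_zero, Int.cast_one, one_mul]
    · intro k hk
      by_cases hk1 : k = 1
      · have e : (0 : ℤ) + ((1 : ℕ) : ℤ) = 1 := rfl
        rw [hk1, e, hW.coeff_lax_one, dIter_one one_ne_zero, mul_zero, mul_zero]
      · rw [hW.hasOrd_lax _ (by omega), map_zero, mul_zero, mul_zero]
  rw [adj_lax, coeff_neg] at h1
  have h2 : algebraMap Times K 2 * (W * dpow 1 * W.adj).coeff 0 = 0 := by
    rw [map_ofNat, two_mul]
    nth_rewrite 1 [← h1]
    exact neg_add_cancel _
  have h3 : (2 : Times) ≠ 0 := fun h => by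
    have := congrArg (MvPowerSeries.coeff 0) h
    rw [← one_add_one_eq_two, map_add, MvPowerSeries.coeff_zero_one, map_zero] at this
    norm_num at this
  exact (mul_eq_zero.mp h2).resolve_left (algebraMap_ne_zero h3)

theorem lax_pow (hW : W.Dressing) (n : ℕ) : (W * dpow 1 * W.adj) ^ n = W * dpow n * W.adj := by
  induction n with
  | zero =>
    rw [pow_zero]
    change 1 = W * 1 * W.adj
    rw [mul_one, hW.mul_adj]
  | succ n ih =>
    rw [pow_succ, ih, Nat.cast_succ, ← dpow_mul_dpow]
    simp only [mul_assoc]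
    rw [← mul_assoc W.adj, hW.adj_mul, one_mul]

theorem timeDeriv_adj (hW : W.Dressing) (k : ℕ) : W.adj.timeDeriv k = -(W.adj * W.timeDeriv k * W.adj) := by
  have h0 : (1 : PsiDO).timeDeriv k = 0 := by
    rw [← fn_one, timeDeriv_fn, tderiv_one]
    ext m
    rw [coeff_fn, ite_self, coeff_zero]
  have h := timeDeriv_mul k W W.adj
  rw [hW.mul_adj, h0] at h
  have h1 := congrArg (W.adj * ·) h
  simp only [mul_add, ← mul_assoc, hW.adj_mul, one_mul, mul_zero] at h1
  exact (neg_eq_of_add_eq_zero_right h1.symm).symm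

/-- Differentiating L = W ∂ W^* gives the commutator of W_{t_k} W^* with L. Adding the corresponding
odd power of L, which commutes with L, turns this operator into the positive part of that power. -/
theorem lax_equation (hW : W.Dressing) (k : ℕ) : (W * dpow 1 * W.adj).timeDeriv k =
    ((W * dpow 1 * W.adj) ^ (2 * k + 1)).plusPart * (W * dpow 1 * W.adj) -
      W * dpow 1 * W.adj * ((W * dpow 1 * W.adj) ^ (2 * k + 1)).plusPart := by
  have h0 : (dpow 1).timeDeriv k = 0 := by
    ext m
    change tderiv k ((dpow 1).coeff m) = 0
    rw [coeff_dpow]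
    split_ifs
    · exact tderiv_one k
    · exact tderiv_zero k
  have h1 : ((W * dpow 1 * W.adj) ^ (2 * k + 1)).plusPart =
      W.timeDeriv k * W.adj + (W * dpow 1 * W.adj) ^ (2 * k + 1) := by
    rw [hW.lax_pow]
    push_cast
    exact hW.plusPart_dressed k
  have h2 : W.timeDeriv k * W.adj * (W * dpow 1 * W.adj) = W.timeDeriv k * dpow 1 * W.adj := by
    simp only [mul_assoc]
    rw [← mul_assoc W.adj W, hW.adj_mul, one_mul]
  rw [h1, add_mul, mul_add, h2, ← pow_succ, ← pow_succ', timeDeriv_mul, timeDeriv_mul, h0,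
    hW.timeDeriv_adj, mul_zero, add_zero, mul_neg]
  simp only [mul_assoc]
  abel

end Dressing

/-! ### Wave functions as images of operators -/

/-- `w = P e^φ`. -/
def IsWave (P : PsiDO) (w : ℤ → K) : Prop :=
  ∃ (d : Times) (U : ℤ → Times), d ≠ 0 ∧
    (∀ m, P.coeff m = algebraMap Times K (U m) / algebraMap Times K d) ∧
    ∀ m, w m = algebraMap Times K (mulExp 1 U m) / algebraMap Times K d

namespace IsWave

/-- Multiplication by e^φ is linear over power series in the times, so P e^φ does not depend on the
common denominator chosen. -/
theorem unique {P : PsiDO} {w w' : ℤ → K} (h : P.IsWave w) (h' : P.IsWave w') : w = w' := by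
  obtain ⟨d, U, hd, hP, hw⟩ := h
  obtain ⟨e, V, he, hP', hw'⟩ := h'
  have key : (fun m => e * U m) = fun m => d * V m := by
    funext m
    have h1 := hP m
    rw [hP' m, div_eq_div_iff (algebraMap_ne_zero he) (algebraMap_ne_zero hd), ← map_mul,
      ← map_mul] at h1
    rw [mul_comm e, mul_comm d]
    exact (IsFractionRing.injective Times K h1).symm
  funext m
  have h1 := congrArg (fun U => mulExp 1 U m) key
  simp only [mulExp_mul] at h1
  rw [hw, hw', div_eq_div_iff (algebraMap_ne_zero hd) (algebraMap_ne_zero he), ← map_mul,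
    ← map_mul, mul_comm, h1, mul_comm]

theorem add {P Q : PsiDO} {w w' : ℤ → K} (h : P.IsWave w) (h' : Q.IsWave w') :
    (P + Q).IsWave fun m => w m + w' m := by
  obtain ⟨d, U, hd, hP, hw⟩ := h
  obtain ⟨e, V, he, hQ, hw'⟩ := h'
  refine ⟨d * e, fun m => e * U m + d * V m, mul_ne_zero hd he, fun m => ?_, fun m => ?_⟩
  · rw [coeff_add, hP, hQ, div_add_div _ _ (algebraMap_ne_zero hd) (algebraMap_ne_zero he)]
    simp only [map_add, map_mul]
    rw [mul_comm (algebraMap Times K (U m))]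
  · beta_reduce
    rw [hw, hw', div_add_div _ _ (algebraMap_ne_zero hd) (algebraMap_ne_zero he), mulExp_add,
      mulExp_mul, mulExp_mul]
    simp only [map_add, map_mul]
    rw [mul_comm (algebraMap Times K (mulExp 1 U m))]

theorem fn_mul {P : PsiDO} {w : ℤ → K} (h : P.IsWave w) (x : K) :
    (fn x * P).IsWave fun m => x * w m := by
  obtain ⟨d, U, hd, hP, hw⟩ := h
  obtain ⟨a, b, hb, rfl⟩ := exists_eq_div x
  refine ⟨b * d, fun m => a * U m, mul_ne_zero hb hd, fun m => ?_, fun m => ?_⟩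
  · rw [coeff_fn_mul, hP, div_mul_div_comm, map_mul, map_mul]
  · beta_reduce
    rw [hw, div_mul_div_comm, mulExp_mul, map_mul, map_mul]

/-- The factor z^{2k+1} that ∂/∂t_{2k+1} draws from e^φ corresponds to right multiplication by
∂^{2k+1}; the denominator d² comes from the quotient rule. -/
theorem timeDeriv {P : PsiDO} {w : ℤ → K} (h : P.IsWave w) (k : ℕ) :
    (P.timeDeriv k + P * dpow (2 * k + 1)).IsWave fun m => tderiv k (w m) := by
  obtain ⟨d, U, hd, hP, hw⟩ := h
  have hd' := algebraMap_ne_zero hd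
  refine ⟨d ^ 2, fun m => d * (MvPowerSeries.pderiv ℂ k (U m) + U (m - (2 * k + 1 : ℕ))) +
    -MvPowerSeries.pderiv ℂ k d * U m, pow_ne_zero 2 hd, fun m => ?_, fun m => ?_⟩
  · rw [coeff_add, coeff_mul_dpow]
    change tderiv k (P.coeff m) + _ = _
    rw [hP, hP, tderiv_div k _ hd]
    have e : (((2 * k + 1 : ℕ) : ℕ) : ℤ) = 2 * k + 1 := by push_cast; rfl
    rw [e, map_add, map_mul, map_mul, map_add, map_neg, map_pow]
    field_simp
    ring
  · beta_reduce
    rw [hw, tderiv_div k _ hd, mulExp_add, mulExp_mul, mulExp_mul, pderiv_mulExp]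
    simp only [map_add, map_mul, map_neg, map_pow]
    congr 1
    ring

theorem dpow_mul {P : PsiDO} {w : ℤ → K} (h : P.IsWave w) (n : ℕ) :
    (dpow n * P).IsWave fun m => dIter n (w m) := by
  induction n with
  | zero =>
    change (1 * P).IsWave w
    rwa [one_mul]
  | succ n ih =>
    rw [Nat.cast_succ, dpow_succ_mul, dpow_one_mul_eq]
    simp only [dIter_succ]
    exact ih.timeDeriv 0

theorem sum_mul {P : PsiDO} {w : ℤ → K} (h : P.IsWave w) (b : ℕ → K) (M : ℕ) :
    ((∑ n ∈ range M, fn (b n) * dpow n) * P).IsWave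
      fun m => ∑ n ∈ range M, b n * dIter n (w m) := by
  induction M with
  | zero =>
    refine ⟨1, 0, one_ne_zero, fun m => ?_, fun m => ?_⟩
    · rw [sum_range_zero, zero_mul, coeff_zero, Pi.zero_apply, map_zero, zero_div]
    · have h0 := congrFun (mulExp_mul 1 0 0) m
      simp only [zero_mul] at h0
      change ∑ n ∈ range 0, _ = algebraMap Times K (mulExp 1 (fun _ => 0) m) / _
      rw [h0, map_zero, zero_div, sum_range_zero]
  | succ M ih =>
    simp only [sum_range_succ, add_mul]
    refine ih.add ?_
    rw [mul_assoc]
    exact (h.dpow_mul M).fn_mul (b M)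

theorem act {B P : PsiDO} {w : ℤ → K} (h : P.IsWave w) (hB : B.IsDiff) :
    (B * P).IsWave (B.act w) := by
  obtain ⟨L, hL⟩ := B.exists_hasOrd
  have h1 : ∀ n : ℕ, (L + 1).toNat ≤ n → B.coeff n = 0 := fun n hn => hL n (by omega)
  have e1 : B = ∑ n ∈ range (L + 1).toNat, fn (B.coeff n) * dpow n := by
    ext m
    have e : (∑ n ∈ range (L + 1).toNat, fn (B.coeff n) * dpow n).coeff m =
      ∑ n ∈ range (L + 1).toNat, (fn (B.coeff n) * dpow n).coeff m := map_sum (coeffHom m) _ _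
    rw [e]
    simp only [coeff_fn_mul_dpow]
    rcases lt_or_ge m 0 with hm | hm
    · rw [hB m hm, sum_eq_zero fun n _ => if_neg (by omega)]
    · obtain ⟨n, rfl⟩ := Int.eq_ofNat_of_zero_le hm
      simp only [Nat.cast_inj]
      rw [sum_ite_eq]
      split_ifs with hn
      · rfl
      · exact h1 n (not_lt.mp fun h => hn (mem_range.mpr h))
  have e2 : B.act w = fun m => ∑ n ∈ range (L + 1).toNat, B.coeff n * dIter n (w m) := by
    funext m
    refine finsum_eq_sum_of_support_subset _ fun n hn => ?_
    rw [Finset.mem_coe, mem_range]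
    by_contra hn'
    exact hn (by simp only; rw [h1 n (not_lt.mp hn'), zero_mul])
  rw [e2]
  have h2 := h.sum_mul (fun n => B.coeff n) (L + 1).toNat
  rwa [← e1] at h2

end IsWave

theorem isDiff_plusPart (P : PsiDO) : P.plusPart.IsDiff := fun _ hm => if_neg (not_le.mpr hm)

/-- Both sides are the wave function of the same operator, W_{t_k} + W ∂^{2k+1} = (W ∂^{2k+1} W^*)_+
W. -/
theorem Dressing.tderiv_wave {W : PsiDO} (hW : W.Dressing) {w : ℤ → K} (h : W.IsWave w) (k : ℕ)
    (m : ℤ) : tderiv k (w m) = (W * dpow (2 * k + 1) * W.adj).plusPart.act w m := by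
  have h1 := h.act (isDiff_plusPart (W * dpow (2 * k + 1) * W.adj))
  rw [hW.plusPart_mul] at h1
  exact congrFun ((h.timeDeriv k).unique h1) m

theorem tauTop_zero (v : Fock) : tauTop v {0} = tau v ∅ := by
  rw [tauTop, top_zero, erase_singleton]

/-- For α = β = (1) no power of ∂ stands between the factors: the product with the adjoint is
differential, of order at most zero and monic, so it is 1. -/
theorem dressing_hatW {v : Fock} (h0 : tau v ∅ ≠ 0) (h : ResZero (g v {0}) (g v {0})) :
    (hatW v {0}).Dressing := by
  have ho : (hatW v {0}).HasOrd 0 := fun m hm => by rw [coeff_hatW, hatw_pos v _ hm]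
  have h1 : (hatW v {0}).coeff 0 = 1 := by
    rw [coeff_hatW, hatw_zero (singleton_nonempty 0) (by rwa [tauTop_zero])]
  have h2 : (hatW v {0}).adj.coeff 0 = 1 := by
    rw [coeff_adj_top ho, h1, sg_zero, Int.cast_one, one_mul]
  refine ⟨ho, h1, eq_one_of_isDiff ?_ (ho.mul ho.adj) ?_, isDiff_timeDeriv_hatW h⟩
  · have h3 := isDiff_hatW h
    have e : dpow ((top {0} : ℕ) + (top {0} : ℕ)) = 1 := rfl
    rwa [e, mul_one] at h3
  · have h3 := coeff_mul_top ho ho.adj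
    rwa [h1, h2, mul_one] at h3

theorem isWave_hatW {v : Fock} (h0 : tau v ∅ ≠ 0) : (hatW v {0}).IsWave (wave v {0}) := by
  obtain ⟨d, U, hd, h1, h2⟩ := fracMulExp_wave (v := v) (α := {0}) (by rwa [tauTop_zero])
  refine ⟨d, U, hd, fun m => by rw [coeff_hatW, h1], fun m => ?_⟩
  rw [h2, top_zero]
  simp only [Nat.cast_zero, sub_zero]

end PsiDO

end CKP

end

/-! ### The theorem -/

theorem mainTheorem5 (v : CKP.Fock) (hv : CKP.IsEven v) :
    CKP.IsBoseFermi CKP.sigma ∧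
    (∀ α : Finset ℕ, Odd α.card → CKP.tau v α = 0) ∧
    (∀ α : Finset ℕ, Even α.card → ∀ m, CKP.g v α m = 0) ∧
    (CKP.Hirota v ↔ ∀ α β : Finset ℕ, Odd α.card → Odd β.card →
      CKP.ResZero (CKP.g v α) (CKP.g v β)) ∧
    (∀ α : Finset ℕ, Odd α.card →
      CKP.g v α = CKP.mulExp 1 (CKP.applyShift (CKP.bracket v α))) ∧
    (∀ α : Finset ℕ, Odd α.card → CKP.tauTop v α ≠ 0 →
      CKP.FracMulExp (CKP.hatw v α) (CKP.top α) (CKP.wave v α) ∧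
      CKP.hatw v α 0 = 1 ∧ ∀ m, 0 < m → CKP.hatw v α m = 0) ∧
    (∀ α β : Finset ℕ, Odd α.card → Odd β.card → CKP.tauTop v α ≠ 0 → CKP.tauTop v β ≠ 0 →
      (CKP.ResZero (CKP.g v α) (CKP.g v β) ↔ CKP.FracResZero (CKP.wave v α) (CKP.wave v β))) ∧
    (CKP.Hirota v →
      (∀ α β : Finset ℕ, Odd α.card → Odd β.card → CKP.tauTop v α ≠ 0 → CKP.tauTop v β ≠ 0 →
        CKP.FracResZero (CKP.wave v α) (CKP.wave v β) ∧
        (CKP.hatW v α * CKP.PsiDO.dpow (CKP.top α + CKP.top β) * (CKP.hatW v β).adj).minusPart = 0) ∧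
      (CKP.tau v ∅ ≠ 0 →
        (CKP.hatW v {0} * (CKP.hatW v {0})⁻¹ = 1 ∧ (CKP.hatW v {0})⁻¹ * CKP.hatW v {0} = 1) ∧
        (CKP.hatW v {0}).adj = (CKP.hatW v {0})⁻¹ ∧
        (∀ k : ℕ, (CKP.hatW v {0}).timeDeriv k =
          -(CKP.hatW v {0} * CKP.PsiDO.dpow (2 * k + 1) * (CKP.hatW v {0})⁻¹).minusPart *
            CKP.hatW v {0}) ∧
        (∀ (k : ℕ) (m : ℤ), CKP.tderiv k (CKP.wave v {0} m) =
          (CKP.hatW v {0} * CKP.PsiDO.dpow (2 * k + 1) * (CKP.hatW v {0})⁻¹).plusPart.act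
            (CKP.wave v {0}) m) ∧
        ((CKP.Lax v).coeff 1 = 1 ∧ (CKP.Lax v).coeff 0 = 0 ∧
          ∀ m, 1 < m → (CKP.Lax v).coeff m = 0) ∧
        (CKP.Lax v).adj = -CKP.Lax v ∧
        (∀ k : ℕ, (CKP.Lax v).timeDeriv k =
          (CKP.Lax v ^ (2 * k + 1)).plusPart * CKP.Lax v -
            CKP.Lax v * (CKP.Lax v ^ (2 * k + 1)).plusPart))) := by
  have hres : CKP.Hirota v → ∀ α β : Finset ℕ, Odd α.card → Odd β.card →
      CKP.ResZero (CKP.g v α) (CKP.g v β) := (CKP.hirota_iff_resZero_g hv).mp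
  refine ⟨CKP.isBoseFermi_sigma, fun α hα => CKP.tau_eq_zero hv hα,
    fun α hα m => CKP.g_eq_zero hv hα m, CKP.hirota_iff_resZero_g hv, fun α _ => CKP.g_eq v α,
    fun α hα h => ⟨CKP.fracMulExp_wave h,
      CKP.hatw_zero (Finset.card_pos.mp hα.pos) h, fun m hm => CKP.hatw_pos v α hm⟩,
    fun α β _ _ hα hβ => CKP.resZero_iff_fracResZero hα hβ, fun h => ⟨fun α β hα hβ ha hb =>
      ⟨(CKP.resZero_iff_fracResZero ha hb).mp (hres h α β hα hβ),
        (CKP.PsiDO.isDiff_hatW (hres h α β hα hβ)).minusPart⟩, fun h0 => ?_⟩⟩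
  -- The partition (1) is encoded as {0}; it has one part, so its bilinear identity with itself is
  -- among the component equations.
  have hW := CKP.PsiDO.dressing_hatW h0 (hres h {0} {0} (by simp) (by simp))
  have hL : CKP.Lax v = CKP.hatW v {0} * CKP.PsiDO.dpow 1 * (CKP.hatW v {0}).adj := by
    rw [CKP.Lax, hW.inv]
  rw [hL, hW.inv]
  exact ⟨⟨hW.mul_adj, hW.adj_mul⟩, rfl, hW.sato,
    hW.tderiv_wave (CKP.PsiDO.isWave_hatW h0),
    ⟨hW.coeff_lax_one, hW.coeff_lax_zero, hW.hasOrd_lax⟩, CKP.PsiDO.Dressing.adj_lax,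
    hW.lax_equation⟩
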